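/- Let $L_1,L_2>0$, $\Omega=(0,L_1)\times(0,L_2)\subset\mathbb R^2$, and let $m\ge 0$ be an integer. Let $\lambda=\lambda(x,y)$ be a real function on $\Omega$ satisfying the positive $m$-condition: there are positive constants $c_0,c_1$ with $c_0\le\lambda\le c_1$ a.e. in $\Omega$, and moreover $\nabla\lambda\in L^\infty(\Omega)$ if $m\in\{0,1\}$, and $\lambda\in H^{\max(3,m)}(\Omega)$ if $m\ge 2$. For a function $\theta$ on $\Omega$ put $T\theta=\lambda\theta_x+\theta_y$ (in the sense of distributions, where $\langle\lambda\theta_x,\varphi\rangle=-\int_\Omega\theta\,(\lambda\varphi)_x$ for $\varphi\in\mathcal C_c^\infty(\Omega)$), and let $$\mathcal X_1^m(\Omega)=\{\theta\in H^m(\Omega): T\theta\in H^m(\Omega)\},$$ endowed with its natural norm $\big(\|\theta\|_{H^m(\Omega)}^2+\|T\theta\|_{H^m(\Omega)}^2\big)^{1/2}$. Let $\mathcal C^\infty(\overline\Omega)$ be the space of restrictions to $\Omega$ of $\mathcal C^\infty$ functions on $\mathbb R^2$. Then $\mathcal C^\infty(\overline\Omega)\cap\mathcal X_1^m(\Omega)$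 is dense in $\mathcal X_1^m(\Omega)$. -/

import Mathlib

open MeasureTheory Set
open scoped ENNReal ContDiff

noncomputable section

namespace TransportSpace

/-- The open rectangle `(0, L₁) × (0, L₂)`. -/
def rect (L₁ L₂ : ℝ) : Set (ℝ × ℝ) := Ioo 0 L₁ ×ˢ Ioo 0 L₂

/-- The classical partial derivative `∂f/∂x`. -/
def dx (f : ℝ × ℝ → ℝ) : ℝ × ℝ → ℝ := fun p => fderiv ℝ f p (1, 0)

/-- The classical partial derivative `∂f/∂y`. -/
def dy (f : ℝ × ℝ → ℝ) : ℝ × ℝ → ℝ := fun p => fderiv ℝ f p (0, 1)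

/-- The classical derivative `∂^α f = ∂_x^{α₁} ∂_y^{α₂} f`. -/
def partialD (α : ℕ × ℕ) (f : ℝ × ℝ → ℝ) : ℝ × ℝ → ℝ := dx^[α.1] (dy^[α.2] f)

/-- Test functions on `Ω`: smooth, with compact support contained in `Ω`. -/
structure IsTest (Ω : Set (ℝ × ℝ)) (φ : ℝ × ℝ → ℝ) : Prop where
  smooth : ContDiff ℝ ∞ φ
  compact : HasCompactSupport φ
  support : tsupport φ ⊆ Ω

/-- `v` is the weak (distributional) derivative `∂^α u` on the open set `Ω`. Functions are defined
on the whole plane, but only their values on `Ω` matter. -/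
structure HasWeakDeriv (Ω : Set (ℝ × ℝ)) (α : ℕ × ℕ) (u v : ℝ × ℝ → ℝ) : Prop where
  locInt : LocallyIntegrableOn u Ω
  locInt_deriv : LocallyIntegrableOn v Ω
  integral_eq : ∀ φ, IsTest Ω φ →
    ∫ p in Ω, u p * partialD α φ p = (-1) ^ (α.1 + α.2) * ∫ p in Ω, v p * φ p

/-- The Sobolev space `H^m(Ω)`: all weak derivatives of order at most `m` exist and are in
`L²(Ω)`. -/
def H (Ω : Set (ℝ × ℝ)) (m : ℕ) : Set (ℝ × ℝ → ℝ) :=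
  {u | ∀ α : ℕ × ℕ, α.1 + α.2 ≤ m →
    ∃ v, HasWeakDeriv Ω α u v ∧ MemLp v 2 (volume.restrict Ω)}

/-- `‖∂^α u‖_{L²(Ω)}`. A weak derivative is unique up to a null set, so that the infimum runs over
a single value; it is `∞` when there is no weak derivative. -/
def weakDerivNorm (Ω : Set (ℝ × ℝ)) (α : ℕ × ℕ) (u : ℝ × ℝ → ℝ) : ℝ≥0∞ :=
  ⨅ (v : ℝ × ℝ → ℝ) (_ : HasWeakDeriv Ω α u v), eLpNorm v 2 (volume.restrict Ω)

/-- The multi-indices of order at most `m`. -/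
def multiIdx (m : ℕ) : Finset (ℕ × ℕ) :=
  (Finset.range (m + 1) ×ˢ Finset.range (m + 1)).filter fun α => α.1 + α.2 ≤ m

/-- The norm `(∑_{|α| ≤ m} ‖∂^α u‖²_{L²(Ω)})^{1/2}` of `H^m(Ω)`. -/
def HNorm (Ω : Set (ℝ × ℝ)) (m : ℕ) (u : ℝ × ℝ → ℝ) : ℝ≥0∞ :=
  (∑ α ∈ multiIdx m, weakDerivNorm Ω α u ^ 2) ^ (1 / 2 : ℝ)

/-- The positive `m`-condition on the coefficient `lam`: it lies between two positive constants;
its weak gradient is bounded if `m ≤ 1`, and it belongs to `H^{max(3, m)}(Ω)` if `m ≥ 2`. -/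
structure PositiveCondition (Ω : Set (ℝ × ℝ)) (m : ℕ) (lam : ℝ × ℝ → ℝ) : Prop where
  bounds : ∃ c₀ c₁ : ℝ, 0 < c₀ ∧ 0 < c₁ ∧
    ∀ᵐ p ∂(volume.restrict Ω), c₀ ≤ lam p ∧ lam p ≤ c₁
  grad_bounded : m ≤ 1 → ∃ lx ly : ℝ × ℝ → ℝ,
    HasWeakDeriv Ω (1, 0) lam lx ∧ HasWeakDeriv Ω (0, 1) lam ly ∧
    MemLp lx ∞ (volume.restrict Ω) ∧ MemLp ly ∞ (volume.restrict Ω)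
  mem_H : 2 ≤ m → lam ∈ H Ω (max 3 m)

/-- `w` is `T θ = lam θ_x + θ_y` on `Ω`, in the sense of distributions. For `θ` in `L²(Ω)` only,
`θ_x` is a distribution, and its product with the weakly differentiable function `lam` is
`⟨lam θ_x, φ⟩ = ⟨θ_x, lam φ⟩ = - ∫ θ (lam φ)_x`, where `(lam φ)_x = lam φ_x + lam_x φ`. -/
def IsT (Ω : Set (ℝ × ℝ)) (lam θ w : ℝ × ℝ → ℝ) : Prop :=
  LocallyIntegrableOn w Ω ∧ ∃ lx, HasWeakDeriv Ω (1, 0) lam lx ∧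
    ∀ φ, IsTest Ω φ → ∫ p in Ω, w p * φ p =
      - ∫ p in Ω, θ p * (lam p * dx φ p + lx p * φ p + dy φ p)

/-- The space `X₁^m(Ω)` of all `θ ∈ H^m(Ω)` with `T θ = lam θ_x + θ_y ∈ H^m(Ω)`. -/
def X₁ (Ω : Set (ℝ × ℝ)) (m : ℕ) (lam : ℝ × ℝ → ℝ) : Set (ℝ × ℝ → ℝ) :=
  {θ | θ ∈ H Ω m ∧ ∃ w, IsT Ω lam θ w ∧ w ∈ H Ω m}

/-- `‖T θ‖_{H^m(Ω)}`. As `T θ` is unique up to a null set, the infimum runs over a single value;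
it is `∞` when `T θ` is not a function. -/
def TNorm (Ω : Set (ℝ × ℝ)) (m : ℕ) (lam θ : ℝ × ℝ → ℝ) : ℝ≥0∞ :=
  ⨅ (w : ℝ × ℝ → ℝ) (_ : IsT Ω lam θ w), HNorm Ω m w

/-- The natural (graph) norm `(‖θ‖²_{H^m(Ω)} + ‖T θ‖²_{H^m(Ω)})^{1/2}` of `X₁^m(Ω)`. -/
def X₁Norm (Ω : Set (ℝ × ℝ)) (m : ℕ) (lam θ : ℝ × ℝ → ℝ) : ℝ≥0∞ :=
  (HNorm Ω m θ ^ 2 + TNorm Ω m lam θ ^ 2) ^ (1 / 2 : ℝ)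

/-- `C^∞(Ω̄)`: the functions on `Ω` that are restrictions of smooth functions on the plane. -/
def SmoothUpToBoundary (Ω : Set (ℝ × ℝ)) : Set (ℝ × ℝ → ℝ) :=
  {f | ∃ F : ℝ × ℝ → ℝ, ContDiff ℝ ∞ F ∧ EqOn f F Ω}

end TransportSpace

end

noncomputable section

namespace TransportSpace

open Filter Topology
open scoped NNReal

variable {Ω : Set (ℝ × ℝ)} {L₁ L₂ : ℝ}

/-! ### Classical derivatives and test functions -/

/-! The approximants are explicit: `mollify` averages `θ` over a ball of radius `ε` centred not at
`p` but at the image of `p` under a homothety that pulls the rectangle inwards by more than `ε` on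
each side. The ball stays inside the rectangle, so `θ` need not be extended. Write `J` for this
operator and `s = shrink L₁ L₂ ε`, so that `s → 1`. For `p` in the rectangle the kernel is a test
function of the integration variable, hence `∂(J u) = s J(∂u)` exactly (`SmallRadius.dx_mollify`).
With uniform `L²` bounds from a Schur-type estimate (`eLpNorm_le_of_concentrated`), `J u → u` in
every `H^k` to which `u` belongs (`sobolevTendsto_mollify`).

It remains to show `T(J θ) → T θ` in `H^m`, although `θ_x` and `θ_y` separately need not be in
`H^m`. For `m = 0` this is Friedrichs' lemma (`sobolevTendsto_transport_mollify_zero`). The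
commutator `T J θ - J T θ` is an integral operator in `θ` alone. Its worst term is `(s lam(p) -
lam(q)) ∂_x k`, where `k` is the kernel; the first factor is `O(ε)` because `lam` is Lipschitz, and
this compensates for the power of `ε` lost in differentiating `k`. The commutators are therefore
uniformly bounded on `L²`, and they tend to zero on smooth functions, hence on all of `L²`.

For larger `m` one differentiates the equation: `T θ_x = (T θ)_x - lam_x θ_x` and `T θ_y = (T θ)_y -
lam_y θ_x`, both in the weak sense. On the rectangle, `∂_x(T J θ) = lam_x ∂_x(J θ) + s T J θ_x`, and
similarly in `y`, so the result follows by induction on `m` (`sobolevTendsto_transport_mollify`)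
once `lam_x` and `lam_y` multiply `H^k` for `k < m`. If `m ≤ 1` this only asks for bounded
derivatives. If `m ≥ 2` it follows from planar Sobolev estimates proved here: `H² ⊂ L^∞` and `H¹ ·
H¹ ⊂ L²` (`exists_mul_bound`). -/

theorem contDiff_dx {f : ℝ × ℝ → ℝ} (hf : ContDiff ℝ ∞ f) : ContDiff ℝ ∞ (dx f) :=
  (hf.fderiv_right (m := ∞) le_rfl).clm_apply contDiff_const

theorem contDiff_dy {f : ℝ × ℝ → ℝ} (hf : ContDiff ℝ ∞ f) : ContDiff ℝ ∞ (dy f) :=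
  (hf.fderiv_right (m := ∞) le_rfl).clm_apply contDiff_const

theorem dy_dx_comm {f : ℝ × ℝ → ℝ} (hf : ContDiff ℝ ∞ f) : dy (dx f) = dx (dy f) := by
  funext p
  have h2 : ContDiffAt ℝ 2 f p := hf.contDiffAt.of_le (WithTop.coe_le_coe.2 le_top)
  have hsym := h2.isSymmSndFDerivAt (by simp)
  have hd : DifferentiableAt ℝ (fderiv ℝ f) p :=
    ((hf.fderiv_right (m := ∞) le_rfl).differentiable (by simp)).differentiableAt
  have e : ∀ v w : ℝ × ℝ, fderiv ℝ (fun q => fderiv ℝ f q v) p w = fderiv ℝ (fderiv ℝ f) p w v := by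
    intro v w
    rw [fderiv_clm_apply hd (differentiableAt_const v)]
    simp
  change fderiv ℝ (fun q => fderiv ℝ f q (1, 0)) p (0, 1)
    = fderiv ℝ (fun q => fderiv ℝ f q (0, 1)) p (1, 0)
  rw [e, e]
  exact hsym.eq _ _

theorem contDiff_iterate_dx {f : ℝ × ℝ → ℝ} (hf : ContDiff ℝ ∞ f) (n : ℕ) :
    ContDiff ℝ ∞ (dx^[n] f) := by
  induction n with
  | zero => exact hf
  | succ n ih => rw [Function.iterate_succ_apply']; exact contDiff_dx ih

theorem contDiff_iterate_dy {f : ℝ × ℝ → ℝ} (hf : ContDiff ℝ ∞ f) (n : ℕ) :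
    ContDiff ℝ ∞ (dy^[n] f) := by
  induction n with
  | zero => exact hf
  | succ n ih => rw [Function.iterate_succ_apply']; exact contDiff_dy ih

theorem dy_iterate_dx {f : ℝ × ℝ → ℝ} (hf : ContDiff ℝ ∞ f) (n : ℕ) :
    dy (dx^[n] f) = dx^[n] (dy f) := by
  induction n with
  | zero => rfl
  | succ n ih =>
    rw [Function.iterate_succ_apply', Function.iterate_succ_apply',
      dy_dx_comm (contDiff_iterate_dx hf n), ih]

theorem partialD_succ_left (a b : ℕ) (f : ℝ × ℝ → ℝ) :
    partialD (a + 1, b) f = dx (partialD (a, b) f) := by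
  simp only [partialD, Function.iterate_succ_apply']

/-- In `partialD` the `y`-derivatives are taken innermost, so a further `dy` on the outside has to
be commuted past the `x`-derivatives; this is where smoothness enters. -/
theorem partialD_succ_right (a b : ℕ) {f : ℝ × ℝ → ℝ} (hf : ContDiff ℝ ∞ f) :
    partialD (a, b + 1) f = dy (partialD (a, b) f) := by
  simp only [partialD]
  rw [dy_iterate_dx (contDiff_iterate_dy hf b), Function.iterate_succ_apply']

theorem tsupport_dx_subset (f : ℝ × ℝ → ℝ) : tsupport (dx f) ⊆ tsupport f :=
  tsupport_fderiv_apply_subset ℝ (1, 0)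

theorem tsupport_dy_subset (f : ℝ × ℝ → ℝ) : tsupport (dy f) ⊆ tsupport f :=
  tsupport_fderiv_apply_subset ℝ (0, 1)

theorem IsTest.dx {φ : ℝ × ℝ → ℝ} (h : IsTest Ω φ) : IsTest Ω (dx φ) :=
  ⟨contDiff_dx h.smooth, h.compact.mono' (subset_tsupport _ |>.trans (tsupport_dx_subset φ)),
    (tsupport_dx_subset φ).trans h.support⟩

theorem IsTest.dy {φ : ℝ × ℝ → ℝ} (h : IsTest Ω φ) : IsTest Ω (dy φ) :=
  ⟨contDiff_dy h.smooth, h.compact.mono' (subset_tsupport _ |>.trans (tsupport_dy_subset φ)),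
    (tsupport_dy_subset φ).trans h.support⟩

theorem IsTest.partialD {φ : ℝ × ℝ → ℝ} (h : IsTest Ω φ) (a b : ℕ) :
    IsTest Ω (partialD (a, b) φ) := by
  induction a with
  | zero =>
    induction b with
    | zero => exact h
    | succ b ih => rw [partialD_succ_right 0 b h.smooth]; exact ih.dy
  | succ a ih => rw [partialD_succ_left]; exact ih.dx

theorem IsTest.smooth_mul {F φ : ℝ × ℝ → ℝ} (hF : ContDiff ℝ ∞ F) (h : IsTest Ω φ) :
    IsTest Ω (F * φ) :=
  ⟨hF.mul h.smooth, h.compact.mul_left, (tsupport_mul_subset_right).trans h.support⟩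

theorem dx_mul {f g : ℝ × ℝ → ℝ} (hf : ContDiff ℝ ∞ f) (hg : ContDiff ℝ ∞ g) (p : ℝ × ℝ) :
    dx (f * g) p = dx f p * g p + f p * dx g p := by
  unfold dx
  rw [fderiv_mul (hf.differentiable (by simp) p) (hg.differentiable (by simp) p)]
  simp; ring

theorem dy_mul {f g : ℝ × ℝ → ℝ} (hf : ContDiff ℝ ∞ f) (hg : ContDiff ℝ ∞ g) (p : ℝ × ℝ) :
    dy (f * g) p = dy f p * g p + f p * dy g p := by
  unfold dy
  rw [fderiv_mul (hf.differentiable (by simp) p) (hg.differentiable (by simp) p)]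
  simp; ring

theorem IsTest.integrableOn_mul {u φ : ℝ × ℝ → ℝ} (hu : LocallyIntegrableOn u Ω)
    (h : IsTest Ω φ) : IntegrableOn (fun p => u p * φ p) Ω := by
  have h1 : IntegrableOn (fun p => u p * φ p) (tsupport φ) :=
    (hu.integrableOn_compact_subset h.support h.compact).mul_continuousOn
      h.smooth.continuous.continuousOn h.compact
  refine Integrable.integrableOn ((integrableOn_iff_integrable_of_support_subset ?_).1 h1)
  exact (Function.support_mul_subset_right u φ).trans (subset_tsupport φ)

/-! ### Weak derivatives -/

theorem hasWeakDeriv_x_iff {u v : ℝ × ℝ → ℝ} : HasWeakDeriv Ω (1, 0) u v ↔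
    LocallyIntegrableOn u Ω ∧ LocallyIntegrableOn v Ω ∧
      ∀ φ, IsTest Ω φ → ∫ p in Ω, u p * dx φ p = -∫ p in Ω, v p * φ p :=
  ⟨fun h => ⟨h.1, h.2, fun φ hφ => by simpa [partialD] using h.3 φ hφ⟩,
    fun h => ⟨h.1, h.2.1, fun φ hφ => by simpa [partialD] using h.2.2 φ hφ⟩⟩

theorem hasWeakDeriv_y_iff {u v : ℝ × ℝ → ℝ} : HasWeakDeriv Ω (0, 1) u v ↔
    LocallyIntegrableOn u Ω ∧ LocallyIntegrableOn v Ω ∧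
      ∀ φ, IsTest Ω φ → ∫ p in Ω, u p * dy φ p = -∫ p in Ω, v p * φ p :=
  ⟨fun h => ⟨h.1, h.2, fun φ hφ => by simpa [partialD] using h.3 φ hφ⟩,
    fun h => ⟨h.1, h.2.1, fun φ hφ => by simpa [partialD] using h.2.2 φ hφ⟩⟩

theorem locallyIntegrableOn_congr_ae {u v : ℝ × ℝ → ℝ}
    (h : LocallyIntegrableOn u Ω)
    (huv : u =ᵐ[volume.restrict Ω] v) : LocallyIntegrableOn v Ω := by
  intro x hx
  obtain ⟨s, hs, hi⟩ := h x hx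
  have hΩ' : Ω ∈ 𝓝[Ω] x := self_mem_nhdsWithin
  refine ⟨s ∩ Ω, inter_mem hs hΩ', (hi.mono_set inter_subset_left).congr ?_⟩
  exact ae_mono (Measure.restrict_mono inter_subset_right le_rfl) huv

theorem HasWeakDeriv.congr {α : ℕ × ℕ} {u v u' v' : ℝ × ℝ → ℝ}
    (h : HasWeakDeriv Ω α u v)
    (hu : u =ᵐ[volume.restrict Ω] u') (hv : v =ᵐ[volume.restrict Ω] v') :
    HasWeakDeriv Ω α u' v' := by
  refine ⟨locallyIntegrableOn_congr_ae h.1 hu, locallyIntegrableOn_congr_ae h.2 hv, fun φ hφ => ?_⟩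
  rw [← integral_congr_ae (f := fun p => u p * partialD α φ p) (hu.mono fun p hp => by simp only [hp]),
    h.3 φ hφ, integral_congr_ae (f := fun p => v p * φ p) (g := fun p => v' p * φ p)
      (hv.mono fun p hp => by simp only [hp])]

theorem HasWeakDeriv.add {α : ℕ × ℕ} {u v u' v' : ℝ × ℝ → ℝ} (h : HasWeakDeriv Ω α u v)
    (h' : HasWeakDeriv Ω α u' v') : HasWeakDeriv Ω α (u + u') (v + v') := by
  refine ⟨h.1.add h'.1, h.2.add h'.2, fun φ hφ => ?_⟩
  have hp := hφ.partialD α.1 α.2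
  simp only [Pi.add_apply, add_mul]
  rw [integral_add (hp.integrableOn_mul h.1) (hp.integrableOn_mul h'.1),
    integral_add (hφ.integrableOn_mul h.2) (hφ.integrableOn_mul h'.2), h.3 φ hφ, h'.3 φ hφ, mul_add]

theorem HasWeakDeriv.const_mul {α : ℕ × ℕ} {u v : ℝ × ℝ → ℝ} (c : ℝ) (h : HasWeakDeriv Ω α u v) :
    HasWeakDeriv Ω α (fun p => c * u p) (fun p => c * v p) := by
  refine ⟨h.1.smul c, h.2.smul c, fun φ hφ => ?_⟩
  simp only [mul_assoc, integral_const_mul, h.3 φ hφ]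
  ring

theorem HasWeakDeriv.neg {α : ℕ × ℕ} {u v : ℝ × ℝ → ℝ} (h : HasWeakDeriv Ω α u v) :
    HasWeakDeriv Ω α (-u) (-v) := by
  have := h.const_mul (-1)
  simpa [Pi.neg_def] using this

theorem HasWeakDeriv.sub {α : ℕ × ℕ} {u v u' v' : ℝ × ℝ → ℝ} (h : HasWeakDeriv Ω α u v)
    (h' : HasWeakDeriv Ω α u' v') : HasWeakDeriv Ω α (u - u') (v - v') := by
  rw [sub_eq_add_neg, sub_eq_add_neg]; exact h.add h'.neg

/-- This and its variants `comp_y`, `of_comp_x`, `of_comp_y` translate between multi-index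
derivatives and iterated first derivatives, the form used in all inductions on the order. -/
theorem HasWeakDeriv.comp_x {a b : ℕ} {u v w : ℝ × ℝ → ℝ} (h : HasWeakDeriv Ω (1, 0) u v)
    (h' : HasWeakDeriv Ω (a, b) v w) : HasWeakDeriv Ω (a + 1, b) u w := by
  refine ⟨h.1, h'.2, fun φ hφ => ?_⟩
  rw [partialD_succ_left, (hasWeakDeriv_x_iff.1 h).2.2 _ (hφ.partialD a b), h'.3 φ hφ]
  ring

theorem HasWeakDeriv.comp_y {a b : ℕ} {u v w : ℝ × ℝ → ℝ} (h : HasWeakDeriv Ω (0, 1) u v)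
    (h' : HasWeakDeriv Ω (a, b) v w) : HasWeakDeriv Ω (a, b + 1) u w := by
  refine ⟨h.1, h'.2, fun φ hφ => ?_⟩
  rw [partialD_succ_right a b hφ.smooth, (hasWeakDeriv_y_iff.1 h).2.2 _ (hφ.partialD a b),
    h'.3 φ hφ]
  ring

theorem HasWeakDeriv.of_comp_x {a b : ℕ} {u v w : ℝ × ℝ → ℝ} (h : HasWeakDeriv Ω (1, 0) u v)
    (h' : HasWeakDeriv Ω (a + 1, b) u w) : HasWeakDeriv Ω (a, b) v w := by
  refine ⟨h.2, h'.2, fun φ hφ => ?_⟩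
  have h1 := h'.3 φ hφ
  rw [partialD_succ_left, (hasWeakDeriv_x_iff.1 h).2.2 _ (hφ.partialD a b)] at h1
  linear_combination -h1

theorem HasWeakDeriv.of_comp_y {a b : ℕ} {u v w : ℝ × ℝ → ℝ} (h : HasWeakDeriv Ω (0, 1) u v)
    (h' : HasWeakDeriv Ω (a, b + 1) u w) : HasWeakDeriv Ω (a, b) v w := by
  refine ⟨h.2, h'.2, fun φ hφ => ?_⟩
  have h1 := h'.3 φ hφ
  rw [partialD_succ_right a b hφ.smooth,
    (hasWeakDeriv_y_iff.1 h).2.2 _ (hφ.partialD a b)] at h1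
  linear_combination -h1

theorem hasWeakDeriv_zero_self {u : ℝ × ℝ → ℝ} (h : LocallyIntegrableOn u Ω) :
    HasWeakDeriv Ω (0, 0) u u :=
  ⟨h, h, fun φ _ => by simp [partialD]⟩

/-- Locally integrable functions with the same integrals against test functions agree a.e. -/
theorem ae_eq_of_forall_integral_test_eq (hΩ : IsOpen Ω) {v w : ℝ × ℝ → ℝ}
    (hv : LocallyIntegrableOn v Ω) (hw : LocallyIntegrableOn w Ω)
    (h : ∀ φ, IsTest Ω φ → ∫ p in Ω, v p * φ p = ∫ p in Ω, w p * φ p) :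
    v =ᵐ[volume.restrict Ω] w := by
  have h0 : ∀ᵐ x ∂(volume : Measure (ℝ × ℝ)), x ∈ Ω → (v - w) x = 0 := by
    refine IsOpen.ae_eq_zero_of_integral_contDiff_smul_eq_zero hΩ (hv.sub hw) fun g hg hc hs => ?_
    have ht : IsTest Ω g := ⟨hg, hc, hs⟩
    have h1 : ∫ x, g x • (v - w) x = ∫ x in Ω, g x • (v - w) x := by
      refine (setIntegral_eq_integral_of_forall_compl_eq_zero fun x hx => ?_).symm
      rw [image_eq_zero_of_notMem_tsupport (fun hx' => hx (hs hx')), zero_smul]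
    rw [h1]
    have h2 : ∀ x, g x • (v - w) x = v x * g x - w x * g x := fun x => by
      simp only [smul_eq_mul, Pi.sub_apply]; ring
    simp only [h2]
    rw [integral_sub (ht.integrableOn_mul hv) (ht.integrableOn_mul hw), h g ht, sub_self]
  rw [EventuallyEq, ae_restrict_iff' hΩ.measurableSet]
  exact h0.mono fun x hx hxΩ => sub_eq_zero.1 (hx hxΩ)

theorem HasWeakDeriv.unique (hΩ : IsOpen Ω) {α : ℕ × ℕ} {u v w : ℝ × ℝ → ℝ}
    (h : HasWeakDeriv Ω α u v) (h' : HasWeakDeriv Ω α u w) : v =ᵐ[volume.restrict Ω] w := by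
  refine ae_eq_of_forall_integral_test_eq hΩ h.2 h'.2 fun φ hφ => ?_
  exact mul_left_cancel₀ (pow_ne_zero _ (by norm_num)) ((h.3 φ hφ).symm.trans (h'.3 φ hφ))

theorem locallyIntegrableOn_of_memLp {u : ℝ × ℝ → ℝ} {q : ℝ≥0∞} (hq : 1 ≤ q)
    (h : MemLp u q (volume.restrict Ω)) :
    LocallyIntegrableOn u Ω :=
  locallyIntegrableOn_of_locallyIntegrable_restrict (h.locallyIntegrable hq)

/-! ### Smooth functions: weak derivatives and products. -/

theorem integral_mul_dir {v : ℝ × ℝ} {F φ : ℝ × ℝ → ℝ} (hF : ContDiff ℝ ∞ F) (h : IsTest Ω φ) :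
    ∫ p in Ω, F p * fderiv ℝ φ p v = -∫ p in Ω, fderiv ℝ F p v * φ p := by
  have hφ' : HasCompactSupport (fun p => fderiv ℝ φ p v) := h.compact.fderiv_apply ℝ v
  have cφ' : Continuous (fun p => fderiv ℝ φ p v) :=
    ((h.smooth.fderiv_right (m := ∞) le_rfl).clm_apply contDiff_const).continuous
  have cF' : Continuous (fun p => fderiv ℝ F p v) :=
    ((hF.fderiv_right (m := ∞) le_rfl).clm_apply contDiff_const).continuous
  rw [setIntegral_eq_integral_of_forall_compl_eq_zero,
    setIntegral_eq_integral_of_forall_compl_eq_zero]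
  · exact integral_mul_fderiv_eq_neg_fderiv_mul_of_integrable
      ((cF'.mul h.smooth.continuous).integrable_of_hasCompactSupport h.compact.mul_left)
      ((hF.continuous.mul cφ').integrable_of_hasCompactSupport hφ'.mul_left)
      ((hF.continuous.mul h.smooth.continuous).integrable_of_hasCompactSupport h.compact.mul_left)
      (fun x _ => hF.differentiable (by simp) x) (fun x _ => h.smooth.differentiable (by simp) x)
  · intro x hx
    rw [image_eq_zero_of_notMem_tsupport (fun hx' => hx (h.support hx')), mul_zero]
  · intro x hx
    have : x ∉ tsupport (fun p => fderiv ℝ φ p v) := fun hx' =>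
      hx (h.support (tsupport_fderiv_apply_subset ℝ v hx'))
    rw [image_eq_zero_of_notMem_tsupport this, mul_zero]

theorem hasWeakDeriv_dx {F : ℝ × ℝ → ℝ} (hF : ContDiff ℝ ∞ F) : HasWeakDeriv Ω (1, 0) F (dx F) :=
  hasWeakDeriv_x_iff.2 ⟨(hF.continuous.locallyIntegrable).locallyIntegrableOn _,
    ((contDiff_dx hF).continuous.locallyIntegrable).locallyIntegrableOn _,
    fun _ hφ => integral_mul_dir hF hφ⟩

theorem hasWeakDeriv_dy {F : ℝ × ℝ → ℝ} (hF : ContDiff ℝ ∞ F) : HasWeakDeriv Ω (0, 1) F (dy F) :=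
  hasWeakDeriv_y_iff.2 ⟨(hF.continuous.locallyIntegrable).locallyIntegrableOn _,
    ((contDiff_dy hF).continuous.locallyIntegrable).locallyIntegrableOn _,
    fun _ hφ => integral_mul_dir hF hφ⟩

theorem locallyIntegrableOn_mul_continuous (hΩ : IsOpen Ω) {u F : ℝ × ℝ → ℝ}
    (hu : LocallyIntegrableOn u Ω) (hF : Continuous F) :
    LocallyIntegrableOn (u * F) Ω :=
  hu.mul_continuousOn hF.continuousOn hΩ.isLocallyClosed

/-- The product rule, with one smooth factor. -/
theorem HasWeakDeriv.mul_smooth_x (hΩ : IsOpen Ω) {u v F : ℝ × ℝ → ℝ}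
    (h : HasWeakDeriv Ω (1, 0) u v) (hF : ContDiff ℝ ∞ F) :
    HasWeakDeriv Ω (1, 0) (u * F) (v * F + u * dx F) := by
  have hux := locallyIntegrableOn_mul_continuous hΩ h.1 (contDiff_dx hF).continuous
  have hvF := locallyIntegrableOn_mul_continuous hΩ h.2 hF.continuous
  refine hasWeakDeriv_x_iff.2 ⟨locallyIntegrableOn_mul_continuous hΩ h.1 hF.continuous, hvF.add hux, fun φ hφ => ?_⟩
  have h1 := (hasWeakDeriv_x_iff.1 h).2.2 _ (hφ.smooth_mul hF)
  have e1 : ∀ p, u p * dx (F * φ) p = (u * F) p * dx φ p + (u * dx F) p * φ p := fun p => by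
    rw [dx_mul hF hφ.smooth]; simp only [Pi.mul_apply]; ring
  simp only [e1] at h1
  rw [integral_add (hφ.dx.integrableOn_mul (locallyIntegrableOn_mul_continuous hΩ h.1 hF.continuous))
    (hφ.integrableOn_mul hux)] at h1
  simp only [Pi.add_apply, add_mul]
  rw [integral_add (hφ.integrableOn_mul hvF) (hφ.integrableOn_mul hux)]
  have e2 : ∀ p, v p * (F * φ) p = (v * F) p * φ p := fun p => by
    simp only [Pi.mul_apply]; ring
  simp only [e2] at h1
  linarith

theorem HasWeakDeriv.mul_smooth_y (hΩ : IsOpen Ω) {u v F : ℝ × ℝ → ℝ}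
    (h : HasWeakDeriv Ω (0, 1) u v) (hF : ContDiff ℝ ∞ F) :
    HasWeakDeriv Ω (0, 1) (u * F) (v * F + u * dy F) := by
  have hux := locallyIntegrableOn_mul_continuous hΩ h.1 (contDiff_dy hF).continuous
  have hvF := locallyIntegrableOn_mul_continuous hΩ h.2 hF.continuous
  refine hasWeakDeriv_y_iff.2 ⟨locallyIntegrableOn_mul_continuous hΩ h.1 hF.continuous, hvF.add hux, fun φ hφ => ?_⟩
  have h1 := (hasWeakDeriv_y_iff.1 h).2.2 _ (hφ.smooth_mul hF)
  have e1 : ∀ p, u p * dy (F * φ) p = (u * F) p * dy φ p + (u * dy F) p * φ p := fun p => by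
    rw [dy_mul hF hφ.smooth]; simp only [Pi.mul_apply]; ring
  simp only [e1] at h1
  rw [integral_add (hφ.dy.integrableOn_mul (locallyIntegrableOn_mul_continuous hΩ h.1 hF.continuous))
    (hφ.integrableOn_mul hux)] at h1
  simp only [Pi.add_apply, add_mul]
  rw [integral_add (hφ.integrableOn_mul hvF) (hφ.integrableOn_mul hux)]
  have e2 : ∀ p, v p * (F * φ) p = (v * F) p * φ p := fun p => by
    simp only [Pi.mul_apply]; ring
  simp only [e2] at h1
  linarith

/-! ### Quantitative membership in Sobolev spaces -/

/-- `u` lies in `H^k(Ω)`, and all the weak derivatives of `u` of order at most `k` (obtained by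
iterated differentiation) have an `L²(Ω)` norm of at most `C`. -/
def SobolevBound (Ω : Set (ℝ × ℝ)) : ℕ → (ℝ × ℝ → ℝ) → ℝ≥0 → Prop
  | 0, u, C => AEStronglyMeasurable u (volume.restrict Ω) ∧
      eLpNorm u 2 (volume.restrict Ω) ≤ C
  | k + 1, u, C => (AEStronglyMeasurable u (volume.restrict Ω) ∧
      eLpNorm u 2 (volume.restrict Ω) ≤ C) ∧ ∃ ux uy,
      HasWeakDeriv Ω (1, 0) u ux ∧ HasWeakDeriv Ω (0, 1) u uy ∧
      SobolevBound Ω k ux C ∧ SobolevBound Ω k uy C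

theorem SobolevBound.zero_order {k : ℕ} {u : ℝ × ℝ → ℝ} {C : ℝ≥0} (h : SobolevBound Ω k u C) :
    SobolevBound Ω 0 u C := by
  cases k with
  | zero => exact h
  | succ k => exact h.1

theorem SobolevBound.norm_le {k : ℕ} {u : ℝ × ℝ → ℝ} {C : ℝ≥0} (h : SobolevBound Ω k u C) :
    eLpNorm u 2 (volume.restrict Ω) ≤ C := h.zero_order.2

theorem SobolevBound.memLp {k : ℕ} {u : ℝ × ℝ → ℝ} {C : ℝ≥0} (h : SobolevBound Ω k u C) :
    MemLp u 2 (volume.restrict Ω) := ⟨h.zero_order.1, h.norm_le.trans_lt ENNReal.coe_lt_top⟩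

theorem SobolevBound.of_memLp {u : ℝ × ℝ → ℝ} (h : MemLp u 2 (volume.restrict Ω)) :
    ∃ C, SobolevBound Ω 0 u C :=
  ⟨(eLpNorm u 2 (volume.restrict Ω)).toNNReal, h.1, (ENNReal.coe_toNNReal h.2.ne).ge⟩

theorem SobolevBound.mono {k : ℕ} {u : ℝ × ℝ → ℝ} {C D : ℝ≥0} (h : SobolevBound Ω k u C)
    (hCD : C ≤ D) : SobolevBound Ω k u D := by
  have hCD' : (C : ℝ≥0∞) ≤ D := by exact_mod_cast hCD
  induction k generalizing u with
  | zero => exact ⟨h.1, h.2.trans hCD'⟩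
  | succ k ih =>
    obtain ⟨h0, ux, uy, hx, hy, bx, b_y⟩ := h
    exact ⟨⟨h0.1, h0.2.trans hCD'⟩, ux, uy, hx, hy, ih bx, ih b_y⟩

theorem SobolevBound.of_succ {k : ℕ} {u : ℝ × ℝ → ℝ} {C : ℝ≥0}
    (h : SobolevBound Ω (k + 1) u C) : SobolevBound Ω k u C := by
  induction k generalizing u with
  | zero => exact h.1
  | succ k ih =>
    obtain ⟨h0, ux, uy, hx, hy, bx, b_y⟩ := h
    exact ⟨h0, ux, uy, hx, hy, ih bx, ih b_y⟩

theorem SobolevBound.of_le {k l : ℕ} {u : ℝ × ℝ → ℝ} {C : ℝ≥0}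
    (h : SobolevBound Ω l u C) (hkl : k ≤ l) : SobolevBound Ω k u C := by
  induction hkl with
  | refl => exact h
  | step _ ih => exact ih h.of_succ

theorem SobolevBound.congr {k : ℕ} {u v : ℝ × ℝ → ℝ} {C : ℝ≥0}
    (h : SobolevBound Ω k u C) (huv : u =ᵐ[volume.restrict Ω] v) : SobolevBound Ω k v C := by
  cases k with
  | zero => exact ⟨h.1.congr huv, (eLpNorm_congr_ae huv).symm.trans_le h.2⟩
  | succ k =>
    obtain ⟨h0, ux, uy, hx, hy, bx, b_y⟩ := h
    exact ⟨⟨h0.1.congr huv, (eLpNorm_congr_ae huv).symm.trans_le h0.2⟩, ux, uy,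
      hx.congr huv .rfl, hy.congr huv .rfl, bx, b_y⟩

theorem SobolevBound.add {k : ℕ} {u v : ℝ × ℝ → ℝ} {C D : ℝ≥0}
    (h : SobolevBound Ω k u C) (h' : SobolevBound Ω k v D) :
    SobolevBound Ω k (u + v) (C + D) := by
  induction k generalizing u v with
  | zero =>
    refine ⟨h.1.add h'.1, (eLpNorm_add_le h.1 h'.1 (by norm_num)).trans ?_⟩
    push_cast
    exact add_le_add h.2 h'.2
  | succ k ih =>
    obtain ⟨h0, ux, uy, hx, hy, bx, b_y⟩ := h
    obtain ⟨h0', ux', uy', hx', hy', bx', b_y'⟩ := h'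
    refine ⟨⟨h0.1.add h0'.1, (eLpNorm_add_le h0.1 h0'.1 (by norm_num)).trans ?_⟩, ux + ux',
      uy + uy', hx.add hx', hy.add hy', ih bx bx', ih b_y b_y'⟩
    push_cast
    exact add_le_add h0.2 h0'.2

theorem SobolevBound.const_mul {k : ℕ} {u : ℝ × ℝ → ℝ} {C : ℝ≥0} (c : ℝ)
    (h : SobolevBound Ω k u C) : SobolevBound Ω k (fun p => c * u p) (‖c‖₊ * C) := by
  have key : ∀ {u : ℝ × ℝ → ℝ}, SobolevBound Ω 0 u C →
      SobolevBound Ω 0 (fun p => c * u p) (‖c‖₊ * C) := by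
    intro u h
    refine ⟨h.1.const_mul c, ?_⟩
    have := eLpNorm_const_smul_le (c := c) (f := u) (p := 2) (μ := volume.restrict Ω)
    refine (this.trans (mul_le_mul_right h.2 _)).trans_eq ?_
    push_cast
    rfl
  induction k generalizing u with
  | zero => exact key h
  | succ k ih =>
    obtain ⟨h0, ux, uy, hx, hy, bx, b_y⟩ := h
    exact ⟨key h0, _, _, hx.const_mul c, hy.const_mul c, ih bx, ih b_y⟩

theorem SobolevBound.sub {k : ℕ} {u v : ℝ × ℝ → ℝ} {C D : ℝ≥0}
    (h : SobolevBound Ω k u C) (h' : SobolevBound Ω k v D) :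
    SobolevBound Ω k (u - v) (C + D) := by
  have := h.add (h'.const_mul (-1))
  simp only [nnnorm_neg, nnnorm_one, one_mul] at this
  refine this.congr (Eventually.of_forall fun p => ?_)
  simp only [Pi.add_apply, Pi.sub_apply]
  ring

theorem SobolevBound.sub_comm {k : ℕ} {u v : ℝ × ℝ → ℝ} {C : ℝ≥0}
    (h : SobolevBound Ω k (u - v) C) : SobolevBound Ω k (v - u) C := by
  have := h.const_mul (-1)
  simp only [nnnorm_neg, nnnorm_one, one_mul] at this
  exact this.congr (Eventually.of_forall fun p => by simp)

theorem SobolevBound.exists_hasWeakDeriv {k : ℕ} {u : ℝ × ℝ → ℝ} {C : ℝ≥0}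
    (h : SobolevBound Ω k u C) (a b : ℕ) (hab : a + b ≤ k) :
    ∃ v, HasWeakDeriv Ω (a, b) u v ∧ MemLp v 2 (volume.restrict Ω) ∧
      eLpNorm v 2 (volume.restrict Ω) ≤ C := by
  induction k generalizing u a b with
  | zero =>
    obtain ⟨rfl, rfl⟩ : a = 0 ∧ b = 0 := by omega
    exact ⟨u, hasWeakDeriv_zero_self (locallyIntegrableOn_of_memLp (by norm_num) h.memLp),
      h.memLp, h.norm_le⟩
  | succ k ih =>
    have h' := h
    obtain ⟨h0, ux, uy, hx, hy, bx, b_y⟩ := h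
    rcases a with _ | a
    · rcases b with _ | b
      · exact ⟨u, hasWeakDeriv_zero_self (locallyIntegrableOn_of_memLp (by norm_num) h'.memLp),
          h'.memLp, h'.norm_le⟩
      · obtain ⟨v, hv, hv'⟩ := ih b_y 0 b (by omega)
        exact ⟨v, hy.comp_y hv, hv'⟩
    · obtain ⟨v, hv, hv'⟩ := ih bx a b (by omega)
      exact ⟨v, hx.comp_x hv, hv'⟩

theorem SobolevBound.mem_H {k : ℕ} {u : ℝ × ℝ → ℝ} {C : ℝ≥0} (h : SobolevBound Ω k u C) :
    u ∈ H Ω k := fun α hα => by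
  obtain ⟨v, hv, hv', -⟩ := h.exists_hasWeakDeriv α.1 α.2 hα
  exact ⟨v, hv, hv'⟩

/-- Together with `SobolevBound.mem_H` this shows that the recursive description by first
derivatives gives the same space as the definition by multi-indices. -/
theorem exists_sobolevBound_of_mem_H (hΩ : IsOpen Ω) {k : ℕ} {u : ℝ × ℝ → ℝ} (h : u ∈ H Ω k) :
    ∃ C, SobolevBound Ω k u C := by
  induction k generalizing u with
  | zero =>
    obtain ⟨v, hv, hv'⟩ := h (0, 0) le_rfl
    -- The weak derivative of order zero is the function itself up to a null set, so square
    -- integrability passes to `u`.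
    exact SobolevBound.of_memLp (hv'.ae_eq (hv.unique hΩ (hasWeakDeriv_zero_self hv.1)))
  | succ k ih =>
    obtain ⟨v, hv, hv'⟩ := h (0, 0) (by simp)
    obtain ⟨C, hC⟩ :=
      SobolevBound.of_memLp (hv'.ae_eq (hv.unique hΩ (hasWeakDeriv_zero_self hv.1)))
    obtain ⟨ux, hx, -⟩ := h (1, 0) (by simp)
    obtain ⟨uy, hy, -⟩ := h (0, 1) (by simp)
    have bx : ux ∈ H Ω k := fun α hα => by
      obtain ⟨w, hw, hw'⟩ := h (α.1 + 1, α.2) (by simp only; omega)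
      exact ⟨w, hx.of_comp_x hw, hw'⟩
    have b_y : uy ∈ H Ω k := fun α hα => by
      obtain ⟨w, hw, hw'⟩ := h (α.1, α.2 + 1) (by simp only; omega)
      exact ⟨w, hy.of_comp_y hw, hw'⟩
    obtain ⟨Cx, hCx⟩ := ih bx
    obtain ⟨Cy, hCy⟩ := ih b_y
    have i1 : C ≤ C + Cx + Cy := by rw [add_assoc]; exact le_self_add
    have i2 : Cx ≤ C + Cx + Cy := by rw [add_assoc, add_left_comm]; exact le_self_add
    exact ⟨C + Cx + Cy, hC.mono i1, ux, uy, hx, hy, hCx.mono i2, hCy.mono le_add_self⟩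

theorem SobolevBound.weakDerivNorm_le {k : ℕ} {u : ℝ × ℝ → ℝ} {C : ℝ≥0}
    (h : SobolevBound Ω k u C) (α : ℕ × ℕ) (hα : α.1 + α.2 ≤ k) : weakDerivNorm Ω α u ≤ C := by
  obtain ⟨v, hv, -, hv'⟩ := h.exists_hasWeakDeriv α.1 α.2 hα
  exact (iInf₂_le v hv).trans hv'

theorem SobolevBound.HNorm_sq_le {k : ℕ} {u : ℝ × ℝ → ℝ} {C : ℝ≥0}
    (h : SobolevBound Ω k u C) : HNorm Ω k u ^ 2 ≤ (multiIdx k).card * (C : ℝ≥0∞) ^ 2 := by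
  rw [HNorm, ← ENNReal.rpow_natCast, ← ENNReal.rpow_mul]
  norm_num
  rw [← nsmul_eq_mul]
  refine Finset.sum_le_card_nsmul _ _ _ fun α hα => ?_
  exact pow_le_pow_left₀ zero_le (h.weakDerivNorm_le α (Finset.mem_filter.1 hα).2) 2

/-- Both norms are infima over representatives, so exhibiting one representative of the derivatives
and of the transport term is enough for an upper bound. -/
theorem X₁Norm_le {k : ℕ} {lam u w : ℝ × ℝ → ℝ} {C : ℝ≥0} (h : SobolevBound Ω k u C)
    (hw : IsT Ω lam u w) (h' : SobolevBound Ω k w C) :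
    X₁Norm Ω k lam u ≤ (2 * (multiIdx k).card * (C : ℝ≥0∞) ^ 2) ^ (1 / 2 : ℝ) := by
  refine ENNReal.rpow_le_rpow ?_ (by norm_num)
  rw [mul_assoc, two_mul]
  refine add_le_add h.HNorm_sq_le (le_trans ?_ h'.HNorm_sq_le)
  exact pow_le_pow_left₀ zero_le (iInf₂_le w hw) 2

/-! ### `L²` estimates for integral operators with a concentrated kernel -/

theorem eLpNorm_two_sq {X : Type*} [MeasurableSpace X] (μ : Measure X) (f : X → ℝ) :
    eLpNorm f 2 μ ^ 2 = ∫⁻ x, ‖f x‖ₑ ^ 2 ∂μ := by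
  have := eLpNorm_nnreal_pow_eq_lintegral (μ := μ) (f := f) (p := 2) (by norm_num)
  norm_num at this
  exact_mod_cast this

theorem lintegral_mul_sq_le {X : Type*} [MeasurableSpace X] (μ : Measure X) {f g : X → ℝ≥0∞}
    (hf : AEMeasurable f μ) (hg : AEMeasurable g μ) :
    (∫⁻ x, f x * g x ∂μ) ^ 2 ≤ (∫⁻ x, f x ^ 2 ∂μ) * ∫⁻ x, g x ^ 2 ∂μ := by
  have h := ENNReal.lintegral_mul_le_Lp_mul_Lq μ Real.HolderConjugate.two_two hf hg
  have h2 := pow_le_pow_left₀ zero_le h 2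
  refine h2.trans_eq ?_
  rw [mul_pow, ← ENNReal.rpow_natCast, ← ENNReal.rpow_natCast, ← ENNReal.rpow_mul,
    ← ENNReal.rpow_mul]
  norm_num

theorem le_of_sq_le_sq_ennreal {a b : ℝ≥0∞} (h : a ^ 2 ≤ b ^ 2) : a ≤ b := by
  by_contra! hlt
  exact absurd h (not_le.2 (ENNReal.pow_lt_pow_left (by norm_num) hlt))

theorem volume_closedBall_prod (p : ℝ × ℝ) (r : ℝ) :
    volume (Metric.closedBall p r) = ENNReal.ofReal (2 * r) ^ 2 := by
  obtain ⟨a, b⟩ := p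
  rw [← closedBall_prod_same, Measure.volume_eq_prod, Measure.prod_prod, Real.volume_closedBall,
    Real.volume_closedBall, sq]

/-! ### The homothety that moves the rectangle away from its boundary. -/

/-- The factor of the homothety `contraction`. -/
def shrink (L₁ L₂ ε : ℝ) : ℝ := 1 - (2 / L₁ + 2 / L₂) * ε

/-- The homothety of centre `(L₁/2, L₂/2)` and factor `shrink L₁ L₂ ε`. -/
def contraction (L₁ L₂ ε : ℝ) (p : ℝ × ℝ) : ℝ × ℝ :=
  (L₁ / 2 + shrink L₁ L₂ ε * (p.1 - L₁ / 2), L₂ / 2 + shrink L₁ L₂ ε * (p.2 - L₂ / 2))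

/-- `ε` is a positive radius that is small with respect to the rectangle. -/
def SmallRadius (L₁ L₂ ε : ℝ) : Prop := 0 < ε ∧ 0 < L₁ ∧ 0 < L₂ ∧ (2 / L₁ + 2 / L₂) * ε ≤ 1 / 2

theorem SmallRadius.half_le {ε : ℝ} (h : SmallRadius L₁ L₂ ε) : 1 / 2 ≤ shrink L₁ L₂ ε := by
  have := h.2.2.2
  unfold shrink
  linarith

theorem SmallRadius.le_one {ε : ℝ} (h : SmallRadius L₁ L₂ ε) : shrink L₁ L₂ ε ≤ 1 := by
  obtain ⟨h0, h1, h2, h3⟩ := h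
  unfold shrink
  have : 0 ≤ (2 / L₁ + 2 / L₂) * ε := by positivity
  linarith

theorem eventually_smallRadius (hL₁ : 0 < L₁) (hL₂ : 0 < L₂) :
    ∀ᶠ ε in 𝓝[>] (0 : ℝ), SmallRadius L₁ L₂ ε := by
  have h : Tendsto (fun ε : ℝ => (2 / L₁ + 2 / L₂) * ε) (𝓝[>] 0) (𝓝 0) := by
    have : Tendsto (fun ε : ℝ => (2 / L₁ + 2 / L₂) * ε) (𝓝 0) (𝓝 ((2 / L₁ + 2 / L₂) * 0)) :=
      tendsto_id.const_mul _
    rw [mul_zero] at this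
    exact this.mono_left nhdsWithin_le_nhds
  filter_upwards [h.eventually_le_const (by norm_num : (0 : ℝ) < 1 / 2), self_mem_nhdsWithin]
    with ε h1 h2
  exact ⟨h2, hL₁, hL₂, h1⟩

theorem tendsto_shrink : Tendsto (shrink L₁ L₂) (𝓝[>] 0) (𝓝 1) := by
  have : Continuous (shrink L₁ L₂) := by unfold shrink; fun_prop
  have h := this.tendsto 0
  simp only [shrink, mul_zero, sub_zero] at h
  exact h.mono_left nhdsWithin_le_nhds

theorem continuous_contraction (ε : ℝ) : Continuous (contraction L₁ L₂ ε) := by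
  unfold contraction; fun_prop

theorem contDiff_contraction (ε : ℝ) : ContDiff ℝ ∞ (contraction L₁ L₂ ε) := by
  unfold contraction; fun_prop

theorem isOpen_rect : IsOpen (rect L₁ L₂) := isOpen_Ioo.prod isOpen_Ioo

theorem measurableSet_rect : MeasurableSet (rect L₁ L₂) := isOpen_rect.measurableSet

theorem volume_rect_lt_top : volume (rect L₁ L₂) < ⊤ := by
  rw [rect, Measure.volume_eq_prod, Measure.prod_prod]
  simpa using ENNReal.mul_lt_top ENNReal.ofReal_lt_top ENNReal.ofReal_lt_top

instance : IsFiniteMeasure (volume.restrict (rect L₁ L₂)) :=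
  ⟨by rw [Measure.restrict_apply_univ]; exact volume_rect_lt_top⟩

/-- The constant in `shrink` is chosen for this: each side moves inwards by `ε` plus a positive
multiple of `ε`, which leaves room for a closed ball of radius `ε`. -/
theorem SmallRadius.closedBall_subset {ε : ℝ} (h : SmallRadius L₁ L₂ ε) {p : ℝ × ℝ}
    (hp : p ∈ rect L₁ L₂) : Metric.closedBall (contraction L₁ L₂ ε p) ε ⊆ rect L₁ L₂ := by
  have hs := h.half_le
  obtain ⟨h0, h1, h2, h3⟩ := h
  obtain ⟨⟨p1, p2⟩, p3, p4⟩ := hp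
  have e1 : (1 - shrink L₁ L₂ ε) * (L₁ / 2) = ε + L₁ / L₂ * ε := by
    unfold shrink; field_simp; ring
  have e2 : (1 - shrink L₁ L₂ ε) * (L₂ / 2) = ε + L₂ / L₁ * ε := by
    unfold shrink; field_simp; ring
  have f1 : 0 < L₁ / L₂ * ε := by positivity
  have f2 : 0 < L₂ / L₁ * ε := by positivity
  intro q hq
  rw [Metric.mem_closedBall, dist_eq_norm, Prod.norm_def, max_le_iff, Prod.fst_sub, Prod.snd_sub,
    Real.norm_eq_abs, Real.norm_eq_abs, abs_le, abs_le] at hq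
  simp only [contraction] at hq
  obtain ⟨⟨q1, q2⟩, q3, q4⟩ := hq
  set s := shrink L₁ L₂ ε
  have hs0 : 0 < s := by linarith
  have a1 := mul_pos hs0 p1
  have a2 := mul_pos hs0 (sub_pos.2 p2)
  have a3 := mul_pos hs0 p3
  have a4 := mul_pos hs0 (sub_pos.2 p4)
  refine ⟨⟨?_, ?_⟩, ?_, ?_⟩ <;> nlinarith

theorem SmallRadius.dist_contraction_le {ε : ℝ} (h : SmallRadius L₁ L₂ ε) {p : ℝ × ℝ}
    (hp : p ∈ rect L₁ L₂) :
    dist (contraction L₁ L₂ ε p) p ≤ (2 / L₁ + 2 / L₂) * (L₁ + L₂) * ε := by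
  obtain ⟨h0, h1, h2, h3⟩ := h
  obtain ⟨⟨p1, p2⟩, p3, p4⟩ := hp
  have hK : 0 < (2 / L₁ + 2 / L₂) * ε := by positivity
  rw [dist_eq_norm, Prod.norm_def, max_le_iff, Prod.fst_sub, Prod.snd_sub,
    Real.norm_eq_abs, Real.norm_eq_abs, abs_le, abs_le]
  simp only [contraction, shrink]
  set K := (2 / L₁ + 2 / L₂) * ε with hKdef
  have e : (2 / L₁ + 2 / L₂) * (L₁ + L₂) * ε = K * (L₁ + L₂) := by rw [hKdef]; ring
  rw [e]
  have b1 := mul_pos hK p1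
  have b2 := mul_pos hK (sub_pos.2 p2)
  have b3 := mul_pos hK p3
  have b4 := mul_pos hK (sub_pos.2 p4)
  have b5 := mul_pos hK h1
  have b6 := mul_pos hK h2
  refine ⟨⟨?_, ?_⟩, ?_, ?_⟩ <;> nlinarith

/-- The set lies in a ball centred at the preimage of `q` under the homothety, of radius `ε / s ≤
2ε` because `s ≥ 1/2`. In the sup norm this is a square of side `4ε`. -/
theorem SmallRadius.volume_preimage_le {ε : ℝ} (h : SmallRadius L₁ L₂ ε) (q : ℝ × ℝ) :
    volume {p | q ∈ Metric.closedBall (contraction L₁ L₂ ε p) ε} ≤ ENNReal.ofReal (4 * ε) ^ 2 := by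
  have hs := h.half_le
  have hs0 : 0 < shrink L₁ L₂ ε := by linarith
  have h0 := h.1
  set s := shrink L₁ L₂ ε with hsdef
  set c : ℝ × ℝ := (L₁ / 2 + s⁻¹ * (q.1 - L₁ / 2), L₂ / 2 + s⁻¹ * (q.2 - L₂ / 2)) with hc
  have hsub : {p | q ∈ Metric.closedBall (contraction L₁ L₂ ε p) ε} ⊆
      Metric.closedBall c (2 * ε) := by
    intro p hp
    have key : ∀ l a b : ℝ, |b - (l / 2 + s * (a - l / 2))| ≤ ε →
        |a - (l / 2 + s⁻¹ * (b - l / 2))| ≤ 2 * ε := by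
      intro l a b hab
      have e : a - (l / 2 + s⁻¹ * (b - l / 2)) = s⁻¹ * -(b - (l / 2 + s * (a - l / 2))) := by
        field_simp; ring
      rw [e, abs_mul, abs_neg, abs_of_pos (inv_pos.2 hs0)]
      have : s⁻¹ ≤ 2 := by rw [inv_le_comm₀ hs0 (by norm_num)]; linarith
      exact mul_le_mul this hab (abs_nonneg _) (by norm_num)
    rw [mem_ofPred_eq, Metric.mem_closedBall, dist_eq_norm, Prod.norm_def, max_le_iff] at hp
    rw [Metric.mem_closedBall, dist_eq_norm, Prod.norm_def, max_le_iff]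
    exact ⟨key _ _ _ hp.1, key _ _ _ hp.2⟩
  refine (measure_mono hsub).trans_eq ?_
  rw [volume_closedBall_prod]
  ring_nf

/-- A Schur-type estimate. Cauchy–Schwarz in `q` costs the area `(2ε)²` of the support, and Tonelli
costs the area, at most `(4ε)²`, of the points `p` that see a given `q`. With the square of `M / ε²`
this makes `64 M²`, independently of `ε`. -/
theorem eLpNorm_le_of_concentrated {ε M : ℝ} (h : SmallRadius L₁ L₂ ε) (hM : 0 ≤ M)
    {u g : ℝ × ℝ → ℝ} (hu : AEStronglyMeasurable u (volume.restrict (rect L₁ L₂)))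
    {K : ℝ × ℝ → ℝ × ℝ → ℝ}
    (hg : ∀ p ∈ rect L₁ L₂, g p = ∫ q in rect L₁ L₂, K p q * u q)
    (hK : ∀ p ∈ rect L₁ L₂, ∀ᵐ q ∂(volume.restrict (rect L₁ L₂)), |K p q| ≤ M / ε ^ 2)
    (hK0 : ∀ p ∈ rect L₁ L₂, ∀ q ∉ Metric.closedBall (contraction L₁ L₂ ε p) ε, K p q = 0) :
    eLpNorm g 2 (volume.restrict (rect L₁ L₂)) ≤
      ENNReal.ofReal (8 * M) * eLpNorm u 2 (volume.restrict (rect L₁ L₂)) := by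
  set μ := volume.restrict (rect L₁ L₂) with hμ
  have h0 := h.1
  set S : Set ((ℝ × ℝ) × (ℝ × ℝ)) := {z | dist z.2 (contraction L₁ L₂ ε z.1) ≤ ε} with hS
  have mS : MeasurableSet S := by
    refine IsClosed.measurableSet (isClosed_le ?_ continuous_const)
    exact continuous_snd.dist ((continuous_contraction ε).comp continuous_fst)
  set χ : ℝ × ℝ → ℝ × ℝ → ℝ≥0∞ := fun p q => S.indicator 1 (p, q) with hχ
  have mχ : Measurable (Function.uncurry χ) := (measurable_one.indicator mS)
  have χsq : ∀ p q, χ p q ^ 2 = χ p q := fun p q => by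
    simp only [hχ, indicator]; split_ifs <;> simp
  have mu : AEMeasurable (fun q => ‖u q‖ₑ) μ := hu.enorm
  set c := ENNReal.ofReal (M / ε ^ 2) with hc
  have hpt : ∀ p ∈ rect L₁ L₂, ‖g p‖ₑ ^ 2 ≤
      c ^ 2 * (ENNReal.ofReal (2 * ε) ^ 2 * ∫⁻ q, χ p q * ‖u q‖ₑ ^ 2 ∂μ) := by
    intro p hp
    -- The indicator `χ` is written twice, so that in Cauchy–Schwarz one copy measures the support
    -- while the other stays with `u`.
    have i1 : ‖g p‖ₑ ≤ c * ∫⁻ q, χ p q * (χ p q * ‖u q‖ₑ) ∂μ := by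
      rw [hg p hp, ← lintegral_const_mul' _ _ ENNReal.ofReal_ne_top]
      refine (enorm_integral_le_lintegral_enorm _).trans ?_
      refine lintegral_mono_ae ((hK p hp).mono fun q hq => ?_)
      by_cases hq' : q ∈ Metric.closedBall (contraction L₁ L₂ ε p) ε
      · have : χ p q = 1 := indicator_of_mem (f := 1) (show (p, q) ∈ S from hq')
        rw [this, one_mul, one_mul, enorm_mul]
        refine mul_le_mul_left ?_ _
        rw [Real.enorm_eq_ofReal_abs]
        exact ENNReal.ofReal_le_ofReal hq
      · rw [hK0 p hp q hq', zero_mul]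
        simp
    refine (pow_le_pow_left₀ zero_le i1 2).trans ?_
    rw [mul_pow]
    refine mul_le_mul_right ?_ _
    have mχp : Measurable (χ p) := mχ.comp measurable_prodMk_left
    refine (lintegral_mul_sq_le μ mχp.aemeasurable (mχp.aemeasurable.mul mu)).trans ?_
    simp only [Pi.mul_apply, mul_pow, χsq]
    refine mul_le_mul' ?_ le_rfl
    have : ∀ q, χ p q = (Metric.closedBall (contraction L₁ L₂ ε p) ε).indicator 1 q := fun q => rfl
    simp only [this]
    rw [lintegral_indicator_one measurableSet_closedBall, ← volume_closedBall_prod]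
    exact Measure.restrict_apply_le _ _
  apply le_of_sq_le_sq_ennreal
  rw [eLpNorm_two_sq, mul_pow, eLpNorm_two_sq]
  have mF : AEMeasurable (Function.uncurry fun p q => χ p q * ‖u q‖ₑ ^ 2) (μ.prod μ) :=
    mχ.aemeasurable.mul ((mu.pow_const 2).comp_quasiMeasurePreserving
      Measure.quasiMeasurePreserving_snd)
  calc ∫⁻ p, ‖g p‖ₑ ^ 2 ∂μ
      ≤ ∫⁻ p, c ^ 2 * (ENNReal.ofReal (2 * ε) ^ 2 * ∫⁻ q, χ p q * ‖u q‖ₑ ^ 2 ∂μ) ∂μ :=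
        setLIntegral_mono_ae' measurableSet_rect (Eventually.of_forall hpt)
    _ = c ^ 2 * (ENNReal.ofReal (2 * ε) ^ 2 * ∫⁻ q, ∫⁻ p, χ p q * ‖u q‖ₑ ^ 2 ∂μ ∂μ) := by
        rw [lintegral_const_mul' _ _ (by simp [hc]),
          lintegral_const_mul' _ _ (ENNReal.pow_ne_top ENNReal.ofReal_ne_top),
          lintegral_lintegral_swap mF]
    _ ≤ c ^ 2 * (ENNReal.ofReal (2 * ε) ^ 2 *
          ∫⁻ q, ENNReal.ofReal (4 * ε) ^ 2 * ‖u q‖ₑ ^ 2 ∂μ) := by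
        refine mul_le_mul_right (mul_le_mul_right (lintegral_mono fun q => ?_) _) _
        rw [lintegral_mul_const' _ _ (by simp)]
        refine mul_le_mul_left ?_ _
        have : ∀ p, χ p q = {p | q ∈ Metric.closedBall (contraction L₁ L₂ ε p) ε}.indicator 1 p :=
          fun p => rfl
        simp only [this]
        have mq : MeasurableSet {p | q ∈ Metric.closedBall (contraction L₁ L₂ ε p) ε} :=
          measurable_prodMk_right mS
        rw [lintegral_indicator_one mq]
        exact (Measure.restrict_apply_le _ _).trans (h.volume_preimage_le q)
    _ = ENNReal.ofReal (8 * M) ^ 2 * ∫⁻ q, ‖u q‖ₑ ^ 2 ∂μ := by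
        rw [lintegral_const_mul' _ _ (ENNReal.pow_ne_top ENNReal.ofReal_ne_top), ← mul_assoc, ← mul_assoc, ← mul_pow, ← mul_pow]
        congr 2
        rw [← ENNReal.ofReal_mul (by positivity), ← ENNReal.ofReal_mul (by positivity)]
        congr 1
        field_simp
        ring

/-! ### Regularization on the rectangle -/

/-- A smooth bump function of integral one, supported in the unit ball. -/
def mollifier : ℝ × ℝ → ℝ :=
  (⟨1 / 2, 1, by norm_num, by norm_num⟩ : ContDiffBump (0 : ℝ × ℝ)).normed volume

/-- The bump function `mollifier`, rescaled to the ball of radius `ε`. -/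
def kernel (ε : ℝ) (z : ℝ × ℝ) : ℝ := ε⁻¹ ^ 2 * mollifier (ε⁻¹ • z)

theorem contDiff_mollifier : ContDiff ℝ ∞ mollifier := ContDiffBump.contDiff_normed _

theorem tsupport_mollifier : tsupport mollifier = Metric.closedBall 0 1 :=
  ContDiffBump.tsupport_normed_eq _

theorem hasCompactSupport_mollifier : HasCompactSupport mollifier :=
  ContDiffBump.hasCompactSupport_normed _

theorem integral_mollifier : ∫ z, mollifier z = 1 := ContDiffBump.integral_normed _

theorem mollifier_nonneg (z : ℝ × ℝ) : 0 ≤ mollifier z := ContDiffBump.nonneg_normed _ _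

theorem kernel_nonneg (ε : ℝ) (z : ℝ × ℝ) : 0 ≤ kernel ε z :=
  mul_nonneg (by positivity) (mollifier_nonneg _)

theorem contDiff_kernel (ε : ℝ) : ContDiff ℝ ∞ (kernel ε) :=
  contDiff_const.mul (contDiff_mollifier.comp (contDiff_const_smul ε⁻¹))

theorem kernel_eq_zero {ε : ℝ} (hε : 0 < ε) {z : ℝ × ℝ} (hz : ε < ‖z‖) : kernel ε z = 0 := by
  have : ε⁻¹ • z ∉ tsupport mollifier := by
    rw [tsupport_mollifier, mem_closedBall_zero_iff, norm_smul, norm_inv, Real.norm_of_nonneg hε.le,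
      not_le, ← div_eq_inv_mul, one_lt_div hε]
    exact hz
  rw [kernel, image_eq_zero_of_notMem_tsupport this, mul_zero]

theorem tsupport_kernel_subset {ε : ℝ} (hε : 0 < ε) :
    tsupport (kernel ε) ⊆ Metric.closedBall 0 ε := by
  refine closure_minimal (fun z hz => ?_) Metric.isClosed_closedBall
  rw [mem_closedBall_zero_iff]
  by_contra! h
  exact hz (kernel_eq_zero hε h)

theorem hasCompactSupport_kernel {ε : ℝ} (hε : 0 < ε) : HasCompactSupport (kernel ε) :=
  HasCompactSupport.of_support_subset_isCompact (isCompact_closedBall 0 ε)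
    ((subset_tsupport _).trans (tsupport_kernel_subset hε))

theorem fderiv_kernel_eq_zero {ε : ℝ} (hε : 0 < ε) {z : ℝ × ℝ} (hz : ε < ‖z‖) (v : ℝ × ℝ) :
    fderiv ℝ (kernel ε) z v = 0 := by
  have : z ∉ tsupport (fun z => fderiv ℝ (kernel ε) z v) := fun h => by
    have := tsupport_kernel_subset hε (tsupport_fderiv_apply_subset ℝ v h)
    rw [mem_closedBall_zero_iff] at this
    linarith
  exact image_eq_zero_of_notMem_tsupport (f := fun z => fderiv ℝ (kernel ε) z v) this

theorem fderiv_kernel (ε : ℝ) (z v : ℝ × ℝ) :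
    fderiv ℝ (kernel ε) z v = ε⁻¹ ^ 3 * fderiv ℝ mollifier (ε⁻¹ • z) v := by
  have h1 : HasFDerivAt mollifier (fderiv ℝ mollifier (ε⁻¹ • z)) (ε⁻¹ • z) :=
    (contDiff_mollifier.differentiable (by simp) _).hasFDerivAt
  have h2 : HasFDerivAt (fun z : ℝ × ℝ => ε⁻¹ • z)
      (ε⁻¹ • ContinuousLinearMap.id ℝ (ℝ × ℝ)) z := (hasFDerivAt_id z).const_smul ε⁻¹
  have h3 : HasFDerivAt (kernel ε) _ z := (h1.comp z h2).const_mul (ε⁻¹ ^ 2)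
  rw [h3.fderiv]
  simp only [smul_apply, ContinuousLinearMap.comp_apply,
    ContinuousLinearMap.id_apply, map_smul, smul_eq_mul]
  ring

/-- By scaling: the kernel is of size `ε⁻²`, and each derivative costs one more factor `ε⁻¹`. -/
theorem exists_kernel_bound : ∃ M : ℝ, 0 ≤ M ∧ ∀ ε : ℝ, 0 < ε → ∀ z,
    |kernel ε z| ≤ M / ε ^ 2 ∧ |dx (kernel ε) z| ≤ M / ε ^ 3 ∧ |dy (kernel ε) z| ≤ M / ε ^ 3 := by
  obtain ⟨M₀, h₀⟩ := hasCompactSupport_mollifier.exists_bound_of_continuous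
    contDiff_mollifier.continuous
  obtain ⟨M₁, h₁⟩ := (hasCompactSupport_mollifier.fderiv_apply ℝ (1, 0)).exists_bound_of_continuous
    (contDiff_dx contDiff_mollifier).continuous
  obtain ⟨M₂, h₂⟩ := (hasCompactSupport_mollifier.fderiv_apply ℝ (0, 1)).exists_bound_of_continuous
    (contDiff_dy contDiff_mollifier).continuous
  have n₀ := (norm_nonneg _).trans (h₀ 0)
  have n₁ := (norm_nonneg _).trans (h₁ 0)
  have n₂ := (norm_nonneg _).trans (h₂ 0)
  simp only [Real.norm_eq_abs] at h₀ h₁ h₂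
  refine ⟨M₀ + M₁ + M₂, by positivity, fun ε hε z => ⟨?_, ?_, ?_⟩⟩
  · rw [kernel, abs_mul, abs_of_nonneg (by positivity), div_eq_inv_mul, inv_pow]
    exact mul_le_mul_of_nonneg_left ((h₀ _).trans (by linarith)) (by positivity)
  · rw [dx, fderiv_kernel, abs_mul, abs_of_nonneg (by positivity), div_eq_inv_mul, inv_pow]
    exact mul_le_mul_of_nonneg_left ((h₁ _).trans (by linarith)) (by positivity)
  · rw [dy, fderiv_kernel, abs_mul, abs_of_nonneg (by positivity), div_eq_inv_mul, inv_pow]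
    exact mul_le_mul_of_nonneg_left ((h₂ _).trans (by linarith)) (by positivity)

theorem integral_kernel {ε : ℝ} (hε : 0 < ε) : ∫ z, kernel ε z = 1 := by
  simp only [kernel]
  rw [integral_const_mul, Measure.integral_comp_inv_smul, integral_mollifier]
  simp
  field_simp

/-- The regularization of `u`: an average of `u` over a ball of radius `ε`, centred at a point
that has been moved into the rectangle. -/
def mollify (L₁ L₂ ε : ℝ) (u : ℝ × ℝ → ℝ) (p : ℝ × ℝ) : ℝ :=
  ∫ q in rect L₁ L₂, kernel ε (contraction L₁ L₂ ε p - q) * u q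

theorem fderiv_comp_sub_left {f : ℝ × ℝ → ℝ} (hf : ContDiff ℝ ∞ f) (a q v : ℝ × ℝ) :
    fderiv ℝ (fun q => f (a - q)) q v = -fderiv ℝ f (a - q) v := by
  have h1 : HasFDerivAt f (fderiv ℝ f (a - q)) (a - q) :=
    (hf.differentiable (by simp) _).hasFDerivAt
  have h2 : HasFDerivAt (fun q : ℝ × ℝ => a - q) (-ContinuousLinearMap.id ℝ (ℝ × ℝ)) q :=
    (hasFDerivAt_id q).const_sub a
  have h3 : HasFDerivAt (fun q => f (a - q)) _ q := h1.comp q h2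
  rw [h3.fderiv]
  simp

/-- As a function of the integration variable the kernel may be inserted into any weak identity on
the rectangle, without boundary terms. -/
theorem SmallRadius.isTest_kernel {ε : ℝ} (h : SmallRadius L₁ L₂ ε) {p : ℝ × ℝ}
    (hp : p ∈ rect L₁ L₂) :
    IsTest (rect L₁ L₂) (fun q => kernel ε (contraction L₁ L₂ ε p - q)) := by
  have hs : tsupport (fun q => kernel ε (contraction L₁ L₂ ε p - q)) ⊆
      Metric.closedBall (contraction L₁ L₂ ε p) ε := by
    refine closure_minimal (fun q hq => ?_) Metric.isClosed_closedBall
    rw [mem_closedBall_iff_norm']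
    by_contra! hlt
    exact hq (kernel_eq_zero h.1 hlt)
  exact ⟨(contDiff_kernel ε).comp (contDiff_const.sub contDiff_id),
    HasCompactSupport.of_support_subset_isCompact (isCompact_closedBall _ ε)
      ((subset_tsupport _).trans hs), hs.trans (h.closedBall_subset hp)⟩

theorem SmallRadius.integral_kernel_sub {ε : ℝ} (h : SmallRadius L₁ L₂ ε) {p : ℝ × ℝ}
    (hp : p ∈ rect L₁ L₂) :
    ∫ q in rect L₁ L₂, kernel ε (contraction L₁ L₂ ε p - q) = 1 := by
  rw [setIntegral_eq_integral_of_forall_compl_eq_zero, integral_sub_left_eq_self (kernel ε),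
    integral_kernel h.1]
  intro q hq
  exact image_eq_zero_of_notMem_tsupport (f := fun q => kernel ε (contraction L₁ L₂ ε p - q))
    (fun hq' => hq ((h.isTest_kernel hp).support hq'))

theorem locallyIntegrable_indicator_rect {u : ℝ × ℝ → ℝ}
    (hu : MemLp u 2 (volume.restrict (rect L₁ L₂))) :
    LocallyIntegrable ((rect L₁ L₂).indicator u) :=
  ((memLp_indicator_iff_restrict measurableSet_rect).2 hu).locallyIntegrable (by norm_num)

/-- Extending `u` by zero makes the regularization an honest convolution, which yields smoothness on
the whole plane. The extension plays no role in the values on the rectangle. -/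
theorem mollify_eq_convolution (ε : ℝ) (u : ℝ × ℝ → ℝ) :
    mollify L₁ L₂ ε u = (convolution ((rect L₁ L₂).indicator u) (kernel ε)
      (ContinuousLinearMap.mul ℝ ℝ) volume) ∘ contraction L₁ L₂ ε := by
  funext p
  simp only [mollify, Function.comp_apply, convolution, ContinuousLinearMap.mul_apply']
  rw [← integral_indicator measurableSet_rect]
  refine integral_congr_ae (Eventually.of_forall fun q => ?_)
  by_cases hq : q ∈ rect L₁ L₂ <;> simp [hq, mul_comm]

theorem contDiff_mollify {ε : ℝ} (hε : 0 < ε) {u : ℝ × ℝ → ℝ}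
    (hu : MemLp u 2 (volume.restrict (rect L₁ L₂))) : ContDiff ℝ ∞ (mollify L₁ L₂ ε u) := by
  rw [mollify_eq_convolution]
  exact ((hasCompactSupport_kernel hε).contDiff_convolution_right _
    (locallyIntegrable_indicator_rect hu) (contDiff_kernel ε)).comp (contDiff_contraction ε)

theorem fderiv_mollify {ε : ℝ} (hε : 0 < ε) {u : ℝ × ℝ → ℝ}
    (hu : MemLp u 2 (volume.restrict (rect L₁ L₂))) (p v : ℝ × ℝ) :
    fderiv ℝ (mollify L₁ L₂ ε u) p v = shrink L₁ L₂ ε *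
      ∫ q in rect L₁ L₂, fderiv ℝ (kernel ε) (contraction L₁ L₂ ε p - q) v * u q := by
  have hloc := locallyIntegrable_indicator_rect hu
  have hcs := hasCompactSupport_kernel hε
  have hsm : ContDiff ℝ 1 (kernel ε) := (contDiff_kernel ε).of_le (WithTop.coe_le_coe.2 le_top)
  have h1 := hcs.hasFDerivAt_convolution_right
    (ContinuousLinearMap.mul ℝ ℝ) hloc hsm (contraction L₁ L₂ ε p)
  have h2 : HasFDerivAt (contraction L₁ L₂ ε)
      (shrink L₁ L₂ ε • ContinuousLinearMap.id ℝ (ℝ × ℝ)) p := by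
    have hx : HasFDerivAt (fun p : ℝ × ℝ => L₁ / 2 + shrink L₁ L₂ ε * (p.1 - L₁ / 2))
        (shrink L₁ L₂ ε • ContinuousLinearMap.fst ℝ ℝ ℝ) p :=
      ((hasFDerivAt_fst.sub_const _).const_mul _).const_add _
    have hy : HasFDerivAt (fun p : ℝ × ℝ => L₂ / 2 + shrink L₁ L₂ ε * (p.2 - L₂ / 2))
        (shrink L₁ L₂ ε • ContinuousLinearMap.snd ℝ ℝ ℝ) p :=
      ((hasFDerivAt_snd.sub_const _).const_mul _).const_add _
    refine (hx.prodMk hy).congr_fderiv ?_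
    ext <;> simp
  rw [mollify_eq_convolution, (h1.comp p h2).fderiv]
  simp only [ContinuousLinearMap.comp_smul, ContinuousLinearMap.comp_id,
    smul_apply, smul_eq_mul, convolution]
  congr 1
  have hint := (hcs.fderiv ℝ).convolutionExists_right
    ((ContinuousLinearMap.mul ℝ ℝ).precompR (ℝ × ℝ)) hloc (hsm.continuous_fderiv (by simp))
    (contraction L₁ L₂ ε p)
  rw [ContinuousLinearMap.integral_apply hint, ← integral_indicator measurableSet_rect]
  refine integral_congr_ae (Eventually.of_forall fun q => ?_)
  by_cases hq : q ∈ rect L₁ L₂ <;> simp [hq, mul_comm]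

/-- The derivative falls on the kernel and is moved to `u` by the definition of the weak derivative;
the sign of that step cancels the sign from `a - q`. The factor `shrink` is the chain rule for the
homothety. -/
theorem SmallRadius.dx_mollify {ε : ℝ} (h : SmallRadius L₁ L₂ ε) {u ux : ℝ × ℝ → ℝ}
    (hu : MemLp u 2 (volume.restrict (rect L₁ L₂))) (hx : HasWeakDeriv (rect L₁ L₂) (1, 0) u ux)
    {p : ℝ × ℝ} (hp : p ∈ rect L₁ L₂) :
    dx (mollify L₁ L₂ ε u) p = shrink L₁ L₂ ε * mollify L₁ L₂ ε ux p := by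
  have h1 := (hasWeakDeriv_x_iff.1 hx).2.2 _ (h.isTest_kernel hp)
  have h2 : ∀ q, dx (fun q => kernel ε (contraction L₁ L₂ ε p - q)) q =
      -fderiv ℝ (kernel ε) (contraction L₁ L₂ ε p - q) (1, 0) := fun q =>
    fderiv_comp_sub_left (contDiff_kernel ε) _ _ _
  simp only [h2, mul_neg, integral_neg, neg_inj] at h1
  rw [dx, fderiv_mollify h.1 hu, mollify]
  simp only [mul_comm _ (u _), mul_comm _ (ux _), h1]

theorem SmallRadius.dy_mollify {ε : ℝ} (h : SmallRadius L₁ L₂ ε) {u uy : ℝ × ℝ → ℝ}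
    (hu : MemLp u 2 (volume.restrict (rect L₁ L₂))) (hy : HasWeakDeriv (rect L₁ L₂) (0, 1) u uy)
    {p : ℝ × ℝ} (hp : p ∈ rect L₁ L₂) :
    dy (mollify L₁ L₂ ε u) p = shrink L₁ L₂ ε * mollify L₁ L₂ ε uy p := by
  have h1 := (hasWeakDeriv_y_iff.1 hy).2.2 _ (h.isTest_kernel hp)
  have h2 : ∀ q, dy (fun q => kernel ε (contraction L₁ L₂ ε p - q)) q =
      -fderiv ℝ (kernel ε) (contraction L₁ L₂ ε p - q) (0, 1) := fun q =>
    fderiv_comp_sub_left (contDiff_kernel ε) _ _ _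
  simp only [h2, mul_neg, integral_neg, neg_inj] at h1
  rw [dy, fderiv_mollify h.1 hu, mollify]
  simp only [mul_comm _ (u _), mul_comm _ (uy _), h1]

theorem SmallRadius.mollify_add {ε : ℝ} (h : SmallRadius L₁ L₂ ε) {u v : ℝ × ℝ → ℝ}
    (hu : MemLp u 2 (volume.restrict (rect L₁ L₂)))
    (hv : MemLp v 2 (volume.restrict (rect L₁ L₂))) {p : ℝ × ℝ} (hp : p ∈ rect L₁ L₂) :
    mollify L₁ L₂ ε (u + v) p = mollify L₁ L₂ ε u p + mollify L₁ L₂ ε v p := by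
  have ht := h.isTest_kernel hp
  simp only [mollify, Pi.add_apply, mul_comm (kernel _ _), add_mul]
  exact integral_add (ht.integrableOn_mul (locallyIntegrableOn_of_memLp (by norm_num) hu))
    (ht.integrableOn_mul (locallyIntegrableOn_of_memLp (by norm_num) hv))

theorem SmallRadius.mollify_sub {ε : ℝ} (h : SmallRadius L₁ L₂ ε) {u v : ℝ × ℝ → ℝ}
    (hu : MemLp u 2 (volume.restrict (rect L₁ L₂)))
    (hv : MemLp v 2 (volume.restrict (rect L₁ L₂))) {p : ℝ × ℝ} (hp : p ∈ rect L₁ L₂) :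
    mollify L₁ L₂ ε (u - v) p = mollify L₁ L₂ ε u p - mollify L₁ L₂ ε v p := by
  have := h.mollify_add (hu.sub hv) hv hp
  rw [sub_add_cancel] at this
  linarith

theorem exists_mollify_norm_bound : ∃ M : ℝ, 0 ≤ M ∧ ∀ ε, SmallRadius L₁ L₂ ε → ∀ u : ℝ × ℝ → ℝ,
    AEStronglyMeasurable u (volume.restrict (rect L₁ L₂)) →
    eLpNorm (mollify L₁ L₂ ε u) 2 (volume.restrict (rect L₁ L₂)) ≤
      ENNReal.ofReal M * eLpNorm u 2 (volume.restrict (rect L₁ L₂)) := by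
  obtain ⟨M, hM, hk⟩ := exists_kernel_bound
  refine ⟨8 * M, by positivity, fun ε h u hu => eLpNorm_le_of_concentrated h hM hu
    (fun p _ => rfl) (fun p _ => Eventually.of_forall fun q => (hk ε h.1 _).1) fun p _ q hq => kernel_eq_zero h.1 ?_⟩
  rw [mem_closedBall_iff_norm', not_le] at hq
  exact hq

/-- The kernel is a probability density in `q`, concentrated at points whose distance to `p` is of
order `ε`. -/
theorem eventually_mollify_sub_le_of_uniformContinuous {g : ℝ × ℝ → ℝ} (hg : UniformContinuous g)
    (hg2 : MemLp g 2 (volume.restrict (rect L₁ L₂)))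
    (hL₁ : 0 < L₁) (hL₂ : 0 < L₂) {δ : ℝ} (hδ : 0 < δ) :
    ∀ᶠ ε in 𝓝[>] (0 : ℝ), ∀ p ∈ rect L₁ L₂, |mollify L₁ L₂ ε g p - g p| ≤ δ := by
  obtain ⟨r, hr, hrδ⟩ := Metric.uniformContinuous_iff.1 hg δ hδ
  -- The radius of the ball contributes `ε`; the displacement of its centre by the homothety
  -- contributes the rest.
  set K := 1 + (2 / L₁ + 2 / L₂) * (L₁ + L₂) with hK
  have ht : Tendsto (fun ε : ℝ => K * ε) (𝓝[>] 0) (𝓝 0) := by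
    have : Tendsto (fun ε : ℝ => K * ε) (𝓝 0) (𝓝 (K * 0)) := tendsto_id.const_mul _
    rw [mul_zero] at this
    exact this.mono_left nhdsWithin_le_nhds
  filter_upwards [ht.eventually_lt_const hr, eventually_smallRadius hL₁ hL₂] with ε hε h p hp
  have htest := h.isTest_kernel hp
  have i1 : IntegrableOn (fun q => kernel ε (contraction L₁ L₂ ε p - q)) (rect L₁ L₂) :=
    (htest.smooth.continuous.integrable_of_hasCompactSupport htest.compact).integrableOn
  have i2 : IntegrableOn (fun q => kernel ε (contraction L₁ L₂ ε p - q) * g q) (rect L₁ L₂) := by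
    simp only [mul_comm (kernel _ _)]
    exact htest.integrableOn_mul (locallyIntegrableOn_of_memLp (by norm_num) hg2)
  have e1 : mollify L₁ L₂ ε g p - g p =
      ∫ q in rect L₁ L₂, kernel ε (contraction L₁ L₂ ε p - q) * (g q - g p) := by
    simp only [mul_sub]
    rw [integral_sub i2 (i1.mul_const _), integral_mul_const, h.integral_kernel_sub hp, one_mul,
      mollify]
  rw [e1, ← Real.norm_eq_abs]
  have e2 : δ = ∫ q in rect L₁ L₂, kernel ε (contraction L₁ L₂ ε p - q) * δ := by
    rw [integral_mul_const, h.integral_kernel_sub hp, one_mul]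
  rw [e2]
  refine norm_integral_le_of_norm_le (i1.mul_const δ) (Eventually.of_forall fun q => ?_)
  rw [norm_mul, Real.norm_of_nonneg (kernel_nonneg _ _)]
  by_cases hq : ε < ‖contraction L₁ L₂ ε p - q‖
  · rw [kernel_eq_zero h.1 hq, zero_mul, zero_mul]
  · refine mul_le_mul_of_nonneg_left ?_ (kernel_nonneg _ _)
    rw [← dist_eq_norm]
    refine (hrδ ?_).le
    have d1 := h.dist_contraction_le hp
    have d2 : dist q (contraction L₁ L₂ ε p) ≤ ε := by
      rw [dist_comm, dist_eq_norm]; exact not_lt.1 hq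
    have d3 := dist_triangle q (contraction L₁ L₂ ε p) p
    have : K * ε = ε + (2 / L₁ + 2 / L₂) * (L₁ + L₂) * ε := by rw [hK]; ring
    linarith

/-! ### Convergence in Sobolev spaces -/

/-- `F ε` tends to `v` in `H^k(Ω)` as `ε → 0+`. -/
def SobolevTendsto (Ω : Set (ℝ × ℝ)) (k : ℕ) (F : ℝ → ℝ × ℝ → ℝ) (v : ℝ × ℝ → ℝ) : Prop :=
  ∀ η : ℝ≥0, 0 < η → ∀ᶠ ε in 𝓝[>] (0 : ℝ), SobolevBound Ω k (F ε - v) η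

theorem SobolevTendsto.of_le {k l : ℕ} {F : ℝ → ℝ × ℝ → ℝ} {v : ℝ × ℝ → ℝ}
    (h : SobolevTendsto Ω l F v) (hkl : k ≤ l) : SobolevTendsto Ω k F v :=
  fun η hη => (h η hη).mono fun _ hε => hε.of_le hkl

theorem SobolevTendsto.congr {k : ℕ} {F G : ℝ → ℝ × ℝ → ℝ} {v w : ℝ × ℝ → ℝ}
    (h : SobolevTendsto Ω k F v) (hFG : ∀ᶠ ε in 𝓝[>] (0 : ℝ), F ε =ᵐ[volume.restrict Ω] G ε)
    (hvw : v =ᵐ[volume.restrict Ω] w) : SobolevTendsto Ω k G w := fun η hη => by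
  filter_upwards [h η hη, hFG] with ε h1 h2
  exact h1.congr (h2.sub hvw)

theorem SobolevTendsto.add {k : ℕ} {F G : ℝ → ℝ × ℝ → ℝ} {v w : ℝ × ℝ → ℝ}
    (h : SobolevTendsto Ω k F v) (h' : SobolevTendsto Ω k G w) :
    SobolevTendsto Ω k (fun ε => F ε + G ε) (v + w) := fun η hη => by
  filter_upwards [h (η / 2) (half_pos hη), h' (η / 2) (half_pos hη)] with ε h1 h2
  have := h1.add h2
  rw [add_halves] at this
  rwa [add_sub_add_comm]

theorem SobolevTendsto.sub {k : ℕ} {F G : ℝ → ℝ × ℝ → ℝ} {v w : ℝ × ℝ → ℝ}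
    (h : SobolevTendsto Ω k F v) (h' : SobolevTendsto Ω k G w) :
    SobolevTendsto Ω k (fun ε => F ε - G ε) (v - w) := fun η hη => by
  filter_upwards [h (η / 2) (half_pos hη), h' (η / 2) (half_pos hη)] with ε h1 h2
  have := h1.sub h2
  rw [add_halves] at this
  rwa [sub_sub_sub_comm]

theorem SobolevTendsto.of_bound_mul {k l : ℕ} {F G : ℝ → ℝ × ℝ → ℝ} {v w : ℝ × ℝ → ℝ} {K : ℝ≥0}
    (h : SobolevTendsto Ω k F v) (hK : ∀ ε η, SobolevBound Ω k (F ε - v) η →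
      SobolevBound Ω l (G ε - w) (K * η)) : SobolevTendsto Ω l G w := fun η hη => by
  -- Dividing by `K + 1` instead of `K` covers the case `K = 0`; the same device recurs below.
  have hK0 : 0 < K + 1 := by positivity
  filter_upwards [h (η / (K + 1)) (div_pos hη hK0)] with ε h1
  refine (hK ε _ h1).mono ?_
  rw [← mul_div_assoc, div_le_iff₀ hK0, mul_comm]
  exact mul_le_mul_right le_self_add _

/-- Split `c F - a v = (c - a) v + c (F - v)`. It serves to absorb the factor `shrink`, which tends
to one. -/
theorem SobolevTendsto.const_mul {k : ℕ} {F : ℝ → ℝ × ℝ → ℝ} {v : ℝ × ℝ → ℝ}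
    (h : SobolevTendsto Ω k F v) {C : ℝ≥0} (hv : SobolevBound Ω k v C) {c : ℝ → ℝ} {a : ℝ}
    (hc : Tendsto c (𝓝[>] 0) (𝓝 a)) :
    SobolevTendsto Ω k (fun ε p => c ε * F ε p) (fun p => a * v p) := by
  have h1 : SobolevTendsto Ω k (fun ε p => (c ε - a) * v p) 0 := fun η hη => by
    have ht : Tendsto (fun ε => ‖c ε - a‖₊ * C) (𝓝[>] 0) (𝓝 (‖a - a‖₊ * C)) :=
      (hc.sub_const a).nnnorm.mul_const C
    rw [sub_self, nnnorm_zero, zero_mul] at ht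
    filter_upwards [ht.eventually_le_const hη] with ε hε
    rw [sub_zero]
    exact (hv.const_mul _).mono hε
  have h2 : SobolevTendsto Ω k (fun ε p => c ε * (F ε p - v p)) 0 := fun η hη => by
    have hK0 : 0 < ‖a‖₊ + 1 := by positivity
    filter_upwards [h (η / (‖a‖₊ + 1)) (div_pos hη hK0),
      hc.nnnorm.eventually_le_const (lt_add_of_pos_right ‖a‖₊ one_pos)] with ε h1 h2
    rw [sub_zero]
    refine (h1.const_mul (c ε)).mono ?_
    rw [← mul_div_assoc, div_le_iff₀ hK0, mul_comm]
    exact mul_le_mul_right h2 _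
  have h3 : SobolevTendsto Ω k (fun _ p => a * v p) (fun p => a * v p) := fun η hη =>
    Eventually.of_forall fun ε => by
      rw [sub_self]
      have := (hv.const_mul 0).congr (v := 0) (Eventually.of_forall fun p => by simp)
      rw [nnnorm_zero, zero_mul] at this
      exact this.mono hη.le
  refine ((h1.add h2).add h3).congr (Eventually.of_forall fun ε => Eventually.of_forall fun p => ?_)
    (Eventually.of_forall fun p => ?_)
  · simp only [Pi.add_apply]; ring
  · simp

theorem SobolevTendsto.succ {k : ℕ} {F Fx Fy : ℝ → ℝ × ℝ → ℝ} {v vx vy : ℝ × ℝ → ℝ}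
    (h : SobolevTendsto Ω 0 F v)
    (hFx : ∀ᶠ ε in 𝓝[>] (0 : ℝ), HasWeakDeriv Ω (1, 0) (F ε) (Fx ε))
    (hFy : ∀ᶠ ε in 𝓝[>] (0 : ℝ), HasWeakDeriv Ω (0, 1) (F ε) (Fy ε))
    (hx : HasWeakDeriv Ω (1, 0) v vx) (hy : HasWeakDeriv Ω (0, 1) v vy)
    (tx : SobolevTendsto Ω k Fx vx) (ty : SobolevTendsto Ω k Fy vy) :
    SobolevTendsto Ω (k + 1) F v := fun η hη => by
  filter_upwards [h η hη, hFx, hFy, tx η hη, ty η hη] with ε h1 h2 h3 h4 h5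
  exact ⟨h1, _, _, h2.sub hx, h3.sub hy, h4, h5⟩

theorem enorm_integral_mul_le {X : Type*} [MeasurableSpace X] {μ : Measure X} {f g : X → ℝ}
    (hf : AEStronglyMeasurable f μ) (hg : AEStronglyMeasurable g μ) :
    ‖∫ x, f x * g x ∂μ‖ₑ ≤ eLpNorm f 2 μ * eLpNorm g 2 μ := by
  refine (enorm_integral_le_lintegral_enorm _).trans (le_of_sq_le_sq_ennreal ?_)
  simp only [enorm_mul]
  rw [mul_pow, eLpNorm_two_sq, eLpNorm_two_sq]
  exact lintegral_mul_sq_le μ hf.enorm hg.enorm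

/-- This passes to the limit in weak identities that are known for the regularizations. -/
theorem SobolevTendsto.tendsto_integral_mul {F : ℝ → ℝ × ℝ → ℝ} {v a : ℝ × ℝ → ℝ}
    (h : SobolevTendsto Ω 0 F v) (hv : MemLp v 2 (volume.restrict Ω))
    (ha : MemLp a 2 (volume.restrict Ω)) :
    Tendsto (fun ε => ∫ p in Ω, a p * F ε p) (𝓝[>] 0) (𝓝 (∫ p in Ω, a p * v p)) := by
  obtain ⟨A, hA⟩ := SobolevBound.of_memLp ha
  rw [Metric.tendsto_nhds]
  intro δ hδ
  lift δ to ℝ≥0 using hδ.le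
  have hK0 : 0 < A + 1 := by positivity
  have hδ' : 0 < δ := by exact_mod_cast hδ
  filter_upwards [h (δ / (A + 1)) (div_pos hδ' hK0)] with ε h1
  have hF : MemLp (F ε) 2 (volume.restrict Ω) := by
    have := h1.memLp.add hv
    rwa [sub_add_cancel] at this
  have e : (∫ p in Ω, a p * F ε p) - ∫ p in Ω, a p * v p = ∫ p in Ω, a p * (F ε - v) p := by
    simp only [Pi.sub_apply, mul_sub]
    exact (integral_sub (ha.integrable_mul hF) (ha.integrable_mul hv)).symm
  have i1 : ‖(∫ p in Ω, a p * F ε p) - ∫ p in Ω, a p * v p‖ₑ ≤ ((A * (δ / (A + 1)) : ℝ≥0) : ℝ≥0∞) := by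
    rw [e]
    refine (enorm_integral_mul_le ha.1 h1.memLp.1).trans ?_
    push_cast
    exact mul_le_mul' hA.norm_le h1.norm_le
  have i2 : ‖(∫ p in Ω, a p * F ε p) - ∫ p in Ω, a p * v p‖₊ ≤ A * (δ / (A + 1)) :=
    ENNReal.coe_le_coe.1 i1
  have i3 : A * (δ / (A + 1)) < δ := by
    rw [← mul_div_assoc, div_lt_iff₀ hK0, mul_comm]
    exact mul_lt_mul_of_pos_left (lt_add_of_pos_right A one_pos) hδ'
  rw [dist_eq_norm]
  exact_mod_cast i2.trans_lt i3

/-! ### Convergence of the regularizations -/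

/-- The operators are uniformly bounded on `L²`, and converge uniformly on the rectangle for
continuous functions of compact support, which are dense. -/
theorem sobolevTendsto_mollify_zero (hL₁ : 0 < L₁) (hL₂ : 0 < L₂) {u : ℝ × ℝ → ℝ}
    (hu : MemLp u 2 (volume.restrict (rect L₁ L₂))) :
    SobolevTendsto (rect L₁ L₂) 0 (fun ε => mollify L₁ L₂ ε u) u := fun η hη => by
  set μ := volume.restrict (rect L₁ L₂) with hμ
  obtain ⟨M, hM, hbound⟩ := exists_mollify_norm_bound (L₁ := L₁) (L₂ := L₂)
  lift M to ℝ≥0 using hM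
  have hM0 : 0 < M + 1 := by positivity
  -- The error `u - g` enters once by itself and once through its average, at total cost `(M + 1) η'
  -- = η / 2`.
  set η' : ℝ≥0 := η / 2 / (M + 1) with hη'
  have hη'0 : 0 < η' := div_pos (half_pos hη) hM0
  obtain ⟨g, hgc, hgu, hgcont, hg2⟩ := ((memLp_indicator_iff_restrict
    measurableSet_rect).2 hu).exists_hasCompactSupport_eLpNorm_sub_le (by norm_num)
    (ENNReal.coe_ne_zero.2 hη'0.ne')
  have hg2' : MemLp g 2 μ := hg2.restrict _
  have hug : eLpNorm (u - g) 2 μ ≤ η' := by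
    refine le_trans ?_ ((eLpNorm_mono_measure _ (Measure.restrict_le_self (s := rect L₁ L₂))).trans hgu)
    refine (eLpNorm_congr_ae ?_).le
    filter_upwards [ae_restrict_mem measurableSet_rect] with p hp
    simp [hp]
  -- The square root of the area turns the uniform bound for `g` into an `L²` bound.
  set V : ℝ≥0 := (μ univ ^ (2 : ℝ≥0∞).toReal⁻¹).toNNReal with hV
  have hVtop : μ univ ^ (2 : ℝ≥0∞).toReal⁻¹ ≠ ⊤ :=
    ENNReal.rpow_ne_top_of_nonneg (by positivity) (measure_ne_top _ _)
  have hV0 : 0 < V + 1 := by positivity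
  have hδ : 0 < η / 2 / (V + 1) := div_pos (half_pos hη) hV0
  filter_upwards [eventually_smallRadius hL₁ hL₂, eventually_mollify_sub_le_of_uniformContinuous
    (hgc.uniformContinuous_of_continuous hgcont) hg2' hL₁ hL₂
    (NNReal.coe_pos.2 hδ)] with ε h hg
  have mm : ∀ {w : ℝ × ℝ → ℝ}, MemLp w 2 μ → AEStronglyMeasurable (mollify L₁ L₂ ε w) μ :=
    fun hw => (contDiff_mollify h.1 hw).continuous.aestronglyMeasurable
  have e : (fun p => mollify L₁ L₂ ε u p - u p) =ᵐ[μ]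
      (mollify L₁ L₂ ε (u - g) + (mollify L₁ L₂ ε g - g)) - (u - g) := by
    filter_upwards [ae_restrict_mem measurableSet_rect] with p hp
    simp only [Pi.add_apply, Pi.sub_apply]
    rw [h.mollify_sub hu hg2' hp]
    ring
  refine ⟨(mm hu).sub hu.1, ?_⟩
  refine (eLpNorm_congr_ae e).trans_le ?_
  refine (eLpNorm_sub_le ((mm (hu.sub hg2')).add ((mm hg2').sub hg2'.1)) (hu.sub hg2').1
    (by norm_num)).trans ?_
  have i1 : eLpNorm (mollify L₁ L₂ ε (u - g)) 2 μ ≤ M * η' := by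
    refine (hbound ε h _ (hu.sub hg2').1).trans ?_
    rw [ENNReal.ofReal_coe_nnreal]
    exact mul_le_mul' le_rfl hug
  have i2 : eLpNorm (mollify L₁ L₂ ε g - g) 2 μ ≤ V * (η / 2 / (V + 1) : ℝ≥0) := by
    have := eLpNorm_le_of_ae_bound (p := 2) (μ := μ) (f := mollify L₁ L₂ ε g - g)
      (C := (η / 2 / (V + 1) : ℝ≥0)) (by
        filter_upwards [ae_restrict_mem measurableSet_rect] with p hp using hg p hp)
    rwa [ENNReal.ofReal_coe_nnreal, ← ENNReal.coe_toNNReal hVtop] at this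
  refine (add_le_add ((eLpNorm_add_le (mm (hu.sub hg2')) ((mm hg2').sub hg2'.1)
    (by norm_num)).trans (add_le_add i1 i2)) hug).trans ?_
  have j1 : (M + 1) * η' = η / 2 := by rw [hη']; field_simp
  have j2 : V * (η / 2 / (V + 1)) ≤ η / 2 := by
    rw [← mul_div_assoc, div_le_iff₀ hV0, mul_comm]
    exact mul_le_mul_right le_self_add _
  have j3 : M * η' + V * (η / 2 / (V + 1)) + η' ≤ η := by
    calc M * η' + V * (η / 2 / (V + 1)) + η' = (M + 1) * η' + V * (η / 2 / (V + 1)) := by ring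
      _ ≤ η / 2 + η / 2 := by rw [j1]; exact add_le_add le_rfl j2
      _ = η := add_halves η
  exact_mod_cast j3

theorem hasWeakDeriv_mollify_x {ε : ℝ} (h : SmallRadius L₁ L₂ ε) {u ux : ℝ × ℝ → ℝ}
    (hu : MemLp u 2 (volume.restrict (rect L₁ L₂))) (hx : HasWeakDeriv (rect L₁ L₂) (1, 0) u ux) :
    HasWeakDeriv (rect L₁ L₂) (1, 0) (mollify L₁ L₂ ε u)
      (fun p => shrink L₁ L₂ ε * mollify L₁ L₂ ε ux p) :=
  (hasWeakDeriv_dx (contDiff_mollify h.1 hu)).congr .rfl <| by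
    filter_upwards [ae_restrict_mem measurableSet_rect] with p hp using h.dx_mollify hu hx hp

theorem hasWeakDeriv_mollify_y {ε : ℝ} (h : SmallRadius L₁ L₂ ε) {u uy : ℝ × ℝ → ℝ}
    (hu : MemLp u 2 (volume.restrict (rect L₁ L₂))) (hy : HasWeakDeriv (rect L₁ L₂) (0, 1) u uy) :
    HasWeakDeriv (rect L₁ L₂) (0, 1) (mollify L₁ L₂ ε u)
      (fun p => shrink L₁ L₂ ε * mollify L₁ L₂ ε uy p) :=
  (hasWeakDeriv_dy (contDiff_mollify h.1 hu)).congr .rfl <| by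
    filter_upwards [ae_restrict_mem measurableSet_rect] with p hp using h.dy_mollify hu hy hp

/-- The derivative of the regularization is `shrink` times the regularization of the derivative, so
the order can be raised one step at a time. -/
theorem sobolevTendsto_mollify (hL₁ : 0 < L₁) (hL₂ : 0 < L₂) {k : ℕ} {u : ℝ × ℝ → ℝ} {C : ℝ≥0}
    (hu : SobolevBound (rect L₁ L₂) k u C) :
    SobolevTendsto (rect L₁ L₂) k (fun ε => mollify L₁ L₂ ε u) u := by
  induction k generalizing u with
  | zero => exact sobolevTendsto_mollify_zero hL₁ hL₂ hu.memLp
  | succ k ih =>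
    have hu2 := hu.memLp
    obtain ⟨-, ux, uy, hx, hy, bx, b_y⟩ := hu
    have tx := (ih bx).const_mul bx (tendsto_shrink (L₁ := L₁) (L₂ := L₂))
    have ty := (ih b_y).const_mul b_y (tendsto_shrink (L₁ := L₁) (L₂ := L₂))
    simp only [one_mul] at tx ty
    refine (sobolevTendsto_mollify_zero hL₁ hL₂ hu2).succ ?_ ?_ hx hy tx ty
    · exact (eventually_smallRadius hL₁ hL₂).mono fun ε h => hasWeakDeriv_mollify_x h hu2 hx
    · exact (eventually_smallRadius hL₁ hL₂).mono fun ε h => hasWeakDeriv_mollify_y h hu2 hy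

theorem exists_contDiff_sobolevBound_sub (hL₁ : 0 < L₁) (hL₂ : 0 < L₂) {k : ℕ} {u : ℝ × ℝ → ℝ}
    {C : ℝ≥0} (hu : SobolevBound (rect L₁ L₂) k u C) {η : ℝ≥0} (hη : 0 < η) :
    ∃ F : ℝ × ℝ → ℝ, ContDiff ℝ ∞ F ∧ SobolevBound (rect L₁ L₂) k (F - u) η := by
  obtain ⟨ε, h1, h2⟩ :=
    ((sobolevTendsto_mollify hL₁ hL₂ hu η hη).and (eventually_smallRadius hL₁ hL₂)).exists
  exact ⟨_, contDiff_mollify h2.1 hu.memLp, h1⟩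

/-! ### Product rules -/

theorem IsTest.memLp_mul {u φ : ℝ × ℝ → ℝ} (hφ : IsTest Ω φ)
    (hu : MemLp u 2 (volume.restrict Ω)) : MemLp (fun p => u p * φ p) 2 (volume.restrict Ω) := by
  obtain ⟨M, hM⟩ := hφ.compact.exists_bound_of_continuous hφ.smooth.continuous
  have h : MemLp φ ⊤ (volume.restrict Ω) :=
    memLp_top_of_bound hφ.smooth.continuous.aestronglyMeasurable M (Eventually.of_forall hM)
  exact MemLp.mul (p := 2) (q := ⊤) h hu

theorem IsTest.memLp {φ : ℝ × ℝ → ℝ} (hφ : IsTest Ω φ) : MemLp φ 2 (volume.restrict Ω) :=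
  (hφ.smooth.continuous.memLp_of_hasCompactSupport hφ.compact).restrict _

theorem sobolevTendsto_dx_mollify (hL₁ : 0 < L₁) (hL₂ : 0 < L₂) {k : ℕ} {u ux : ℝ × ℝ → ℝ}
    (hu : MemLp u 2 (volume.restrict (rect L₁ L₂))) {C : ℝ≥0}
    (bx : SobolevBound (rect L₁ L₂) k ux C) (hx : HasWeakDeriv (rect L₁ L₂) (1, 0) u ux) :
    SobolevTendsto (rect L₁ L₂) k (fun ε => dx (mollify L₁ L₂ ε u)) ux := by
  have tx := (sobolevTendsto_mollify hL₁ hL₂ bx).const_mul bx (tendsto_shrink (L₁ := L₁) (L₂ := L₂))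
  simp only [one_mul] at tx
  refine tx.congr ?_ .rfl
  filter_upwards [eventually_smallRadius hL₁ hL₂] with ε h
  filter_upwards [ae_restrict_mem measurableSet_rect] with p hp using (h.dx_mollify hu hx hp).symm

theorem sobolevTendsto_dy_mollify (hL₁ : 0 < L₁) (hL₂ : 0 < L₂) {k : ℕ} {u uy : ℝ × ℝ → ℝ}
    (hu : MemLp u 2 (volume.restrict (rect L₁ L₂))) {C : ℝ≥0}
    (b_y : SobolevBound (rect L₁ L₂) k uy C) (hy : HasWeakDeriv (rect L₁ L₂) (0, 1) u uy) :
    SobolevTendsto (rect L₁ L₂) k (fun ε => dy (mollify L₁ L₂ ε u)) uy := by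
  have ty := (sobolevTendsto_mollify hL₁ hL₂ b_y).const_mul b_y
    (tendsto_shrink (L₁ := L₁) (L₂ := L₂))
  simp only [one_mul] at ty
  refine ty.congr ?_ .rfl
  filter_upwards [eventually_smallRadius hL₁ hL₂] with ε h
  filter_upwards [ae_restrict_mem measurableSet_rect] with p hp using (h.dy_mollify hu hy hp).symm

theorem locallyIntegrableOn_mul {u v : ℝ × ℝ → ℝ} (hu : MemLp u 2 (volume.restrict Ω))
    (hv : MemLp v 2 (volume.restrict Ω)) : LocallyIntegrableOn (u * v) Ω :=
  locallyIntegrableOn_of_locallyIntegrable_restrict (hu.integrable_mul hv).locallyIntegrable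

/-- For smooth `v` this is `HasWeakDeriv.mul_smooth_x`. In general `v` is regularized; each integral
then pairs a fixed `L²` function with `v` or its derivative, so it converges, although the products
themselves are only integrable. -/
theorem HasWeakDeriv.mul_x (hL₁ : 0 < L₁) (hL₂ : 0 < L₂) {u ux v vx : ℝ × ℝ → ℝ}
    (hu : HasWeakDeriv (rect L₁ L₂) (1, 0) u ux) (hv : HasWeakDeriv (rect L₁ L₂) (1, 0) v vx)
    (u2 : MemLp u 2 (volume.restrict (rect L₁ L₂)))
    (ux2 : MemLp ux 2 (volume.restrict (rect L₁ L₂)))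
    (v2 : MemLp v 2 (volume.restrict (rect L₁ L₂)))
    (vx2 : MemLp vx 2 (volume.restrict (rect L₁ L₂))) :
    HasWeakDeriv (rect L₁ L₂) (1, 0) (u * v) (ux * v + u * vx) := by
  have hl1 := locallyIntegrableOn_mul ux2 v2
  have hl2 := locallyIntegrableOn_mul u2 vx2
  refine hasWeakDeriv_x_iff.2 ⟨locallyIntegrableOn_mul u2 v2, hl1.add hl2, fun φ hφ => ?_⟩
  have tF := sobolevTendsto_mollify_zero hL₁ hL₂ v2
  obtain ⟨C, hC⟩ := SobolevBound.of_memLp vx2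
  have tFx := sobolevTendsto_dx_mollify hL₁ hL₂ v2 hC hv
  have t1 := tF.tendsto_integral_mul v2 (hφ.dx.memLp_mul u2)
  have t2 := tF.tendsto_integral_mul v2 (hφ.memLp_mul ux2)
  have t3 := tFx.tendsto_integral_mul vx2 (hφ.memLp_mul u2)
  have key : ∀ᶠ ε in 𝓝[>] (0 : ℝ),
      ∫ p in rect L₁ L₂, u p * dx φ p * mollify L₁ L₂ ε v p =
      -((∫ p in rect L₁ L₂, ux p * φ p * mollify L₁ L₂ ε v p) +
        ∫ p in rect L₁ L₂, u p * φ p * dx (mollify L₁ L₂ ε v) p) := by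
    filter_upwards [self_mem_nhdsWithin] with ε hε
    have sF := contDiff_mollify hε v2
    have h1 := (hasWeakDeriv_x_iff.1 (hu.mul_smooth_x isOpen_rect sF)).2.2 φ hφ
    have i1 := hφ.integrableOn_mul (locallyIntegrableOn_mul_continuous isOpen_rect hu.2 sF.continuous)
    have i2 := hφ.integrableOn_mul
      (locallyIntegrableOn_mul_continuous isOpen_rect hu.1 (contDiff_dx sF).continuous)
    simp only [Pi.add_apply, add_mul] at h1
    rw [integral_add i1 i2] at h1
    simp only [Pi.mul_apply, mul_right_comm _ (mollify L₁ L₂ ε v _),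
      mul_right_comm _ (dx (mollify L₁ L₂ ε v) _)] at h1
    exact h1
  have := tendsto_nhds_unique (t1.congr' key) (t2.add t3).neg
  simp only [Pi.add_apply, add_mul]
  rw [integral_add (hφ.integrableOn_mul hl1) (hφ.integrableOn_mul hl2)]
  simp only [Pi.mul_apply, mul_right_comm _ (v _), mul_right_comm _ (vx _)]
  exact this

theorem HasWeakDeriv.mul_y (hL₁ : 0 < L₁) (hL₂ : 0 < L₂) {u uy v vy : ℝ × ℝ → ℝ}
    (hu : HasWeakDeriv (rect L₁ L₂) (0, 1) u uy) (hv : HasWeakDeriv (rect L₁ L₂) (0, 1) v vy)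
    (u2 : MemLp u 2 (volume.restrict (rect L₁ L₂)))
    (uy2 : MemLp uy 2 (volume.restrict (rect L₁ L₂)))
    (v2 : MemLp v 2 (volume.restrict (rect L₁ L₂)))
    (vy2 : MemLp vy 2 (volume.restrict (rect L₁ L₂))) :
    HasWeakDeriv (rect L₁ L₂) (0, 1) (u * v) (uy * v + u * vy) := by
  have hl1 := locallyIntegrableOn_mul uy2 v2
  have hl2 := locallyIntegrableOn_mul u2 vy2
  refine hasWeakDeriv_y_iff.2 ⟨locallyIntegrableOn_mul u2 v2, hl1.add hl2, fun φ hφ => ?_⟩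
  have tF := sobolevTendsto_mollify_zero hL₁ hL₂ v2
  obtain ⟨C, hC⟩ := SobolevBound.of_memLp vy2
  have tFy := sobolevTendsto_dy_mollify hL₁ hL₂ v2 hC hv
  have t1 := tF.tendsto_integral_mul v2 (hφ.dy.memLp_mul u2)
  have t2 := tF.tendsto_integral_mul v2 (hφ.memLp_mul uy2)
  have t3 := tFy.tendsto_integral_mul vy2 (hφ.memLp_mul u2)
  have key : ∀ᶠ ε in 𝓝[>] (0 : ℝ),
      ∫ p in rect L₁ L₂, u p * dy φ p * mollify L₁ L₂ ε v p =
      -((∫ p in rect L₁ L₂, uy p * φ p * mollify L₁ L₂ ε v p) +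
        ∫ p in rect L₁ L₂, u p * φ p * dy (mollify L₁ L₂ ε v) p) := by
    filter_upwards [self_mem_nhdsWithin] with ε hε
    have sF := contDiff_mollify hε v2
    have h1 := (hasWeakDeriv_y_iff.1 (hu.mul_smooth_y isOpen_rect sF)).2.2 φ hφ
    have i1 := hφ.integrableOn_mul (locallyIntegrableOn_mul_continuous isOpen_rect hu.2 sF.continuous)
    have i2 := hφ.integrableOn_mul
      (locallyIntegrableOn_mul_continuous isOpen_rect hu.1 (contDiff_dy sF).continuous)
    simp only [Pi.add_apply, add_mul] at h1
    rw [integral_add i1 i2] at h1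
    simp only [Pi.mul_apply, mul_right_comm _ (mollify L₁ L₂ ε v _),
      mul_right_comm _ (dy (mollify L₁ L₂ ε v) _)] at h1
    exact h1
  have := tendsto_nhds_unique (t1.congr' key) (t2.add t3).neg
  simp only [Pi.add_apply, add_mul]
  rw [integral_add (hφ.integrableOn_mul hl1) (hφ.integrableOn_mul hl2)]
  simp only [Pi.mul_apply, mul_right_comm _ (v _), mul_right_comm _ (vy _)]
  exact this

/-- The identity `∫ u_x (v φ)_y = ∫ u_y (v φ)_x`. -/
theorem integral_cross_deriv (hL₁ : 0 < L₁) (hL₂ : 0 < L₂) {u ux uy v vx vy : ℝ × ℝ → ℝ}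
    (hux : HasWeakDeriv (rect L₁ L₂) (1, 0) u ux) (huy : HasWeakDeriv (rect L₁ L₂) (0, 1) u uy)
    (hvx : HasWeakDeriv (rect L₁ L₂) (1, 0) v vx) (hvy : HasWeakDeriv (rect L₁ L₂) (0, 1) v vy)
    (ux2 : MemLp ux 2 (volume.restrict (rect L₁ L₂)))
    (uy2 : MemLp uy 2 (volume.restrict (rect L₁ L₂)))
    (v2 : MemLp v 2 (volume.restrict (rect L₁ L₂)))
    (vx2 : MemLp vx 2 (volume.restrict (rect L₁ L₂)))
    (vy2 : MemLp vy 2 (volume.restrict (rect L₁ L₂))) {φ : ℝ × ℝ → ℝ}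
    (hφ : IsTest (rect L₁ L₂) φ) :
    (∫ p in rect L₁ L₂, ux p * dy φ p * v p) + ∫ p in rect L₁ L₂, ux p * φ p * vy p =
    (∫ p in rect L₁ L₂, uy p * dx φ p * v p) + ∫ p in rect L₁ L₂, uy p * φ p * vx p := by
  have tF := sobolevTendsto_mollify_zero hL₁ hL₂ v2
  obtain ⟨Cx, hCx⟩ := SobolevBound.of_memLp vx2
  obtain ⟨Cy, hCy⟩ := SobolevBound.of_memLp vy2
  have tFx := sobolevTendsto_dx_mollify hL₁ hL₂ v2 hCx hvx
  have tFy := sobolevTendsto_dy_mollify hL₁ hL₂ v2 hCy hvy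
  have t1 := tF.tendsto_integral_mul v2 (hφ.dy.memLp_mul ux2)
  have t2 := tFy.tendsto_integral_mul vy2 (hφ.memLp_mul ux2)
  have t3 := tF.tendsto_integral_mul v2 (hφ.dx.memLp_mul uy2)
  have t4 := tFx.tendsto_integral_mul vx2 (hφ.memLp_mul uy2)
  refine tendsto_nhds_unique (t1.add t2) ((t3.add t4).congr' ?_)
  filter_upwards [self_mem_nhdsWithin] with ε hε
  have sF := contDiff_mollify hε v2
  set F := mollify L₁ L₂ ε v
  -- With `v` regularized to the smooth `F`, both sides equal `-∫ u (Fφ)_{xy}`.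
  have hT := hφ.smooth_mul sF
  have h1 := (hasWeakDeriv_x_iff.1 hux).2.2 _ hT.dy
  have h2 := (hasWeakDeriv_y_iff.1 huy).2.2 _ hT.dx
  rw [dy_dx_comm hT.smooth, h1, neg_inj] at h2
  have e1 : ∀ p, ux p * dy (F * φ) p = ux p * dy φ p * F p + ux p * φ p * dy F p := fun p => by
    rw [dy_mul sF hφ.smooth]; ring
  have e2 : ∀ p, uy p * dx (F * φ) p = uy p * dx φ p * F p + uy p * φ p * dx F p := fun p => by
    rw [dx_mul sF hφ.smooth]; ring
  have j1 : ∀ {w G ψ : ℝ × ℝ → ℝ}, LocallyIntegrableOn w (rect L₁ L₂) → ContDiff ℝ ∞ G →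
      IsTest (rect L₁ L₂) ψ → IntegrableOn (fun p => w p * ψ p * G p) (rect L₁ L₂) := by
    intro w G ψ hw hG hψ
    refine ((hψ.smooth_mul hG).integrableOn_mul hw).congr (Eventually.of_forall fun p => ?_)
    simp only [Pi.mul_apply]; ring
  simp only [e1, e2] at h2
  rw [integral_add (j1 hux.2 sF hφ.dy) (j1 hux.2 (contDiff_dy sF) hφ),
    integral_add (j1 huy.2 sF hφ.dx) (j1 huy.2 (contDiff_dx sF) hφ)] at h2
  exact h2.symm

/-! ### Lipschitz representatives -/

/-- Convergence in `L²` gives convergence in measure, hence almost everywhere along a subsequence.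
The predicate `P` carries along further properties of the parameters. -/
theorem SobolevTendsto.exists_seq_ae {F : ℝ → ℝ × ℝ → ℝ} {v : ℝ × ℝ → ℝ}
    (h : SobolevTendsto Ω 0 F v) (hv : MemLp v 2 (volume.restrict Ω)) {P : ℝ → Prop}
    (hP : ∀ᶠ ε in 𝓝[>] (0 : ℝ), P ε) :
    ∃ e : ℕ → ℝ, (∀ n, P (e n)) ∧
      (∀ n, AEStronglyMeasurable (F (e n)) (volume.restrict Ω)) ∧
      ∀ᵐ p ∂(volume.restrict Ω), Tendsto (fun n => F (e n) p) atTop (𝓝 (v p)) := by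
  have hex : ∀ n : ℕ, ∃ ε, SobolevBound Ω 0 (F ε - v) (1 / ((n : ℝ≥0) + 1)) ∧ P ε := fun n =>
    ((h _ (by positivity)).and hP).exists
  choose e he hPe using hex
  have hm : ∀ n, AEStronglyMeasurable (F (e n)) (volume.restrict Ω) := fun n => by
    have := ((he n).memLp.add hv).1
    rwa [sub_add_cancel] at this
  have ht : Tendsto (fun n => eLpNorm (F (e n) - v) 2 (volume.restrict Ω)) atTop (𝓝 0) := by
    refine tendsto_of_tendsto_of_tendsto_of_le_of_le tendsto_const_nhds ?_ (fun _ => zero_le)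
      fun n => (he n).norm_le
    rw [← ENNReal.coe_zero]
    exact ENNReal.tendsto_coe.2
      (tendsto_one_div_add_atTop_nhds_zero_nat (𝕜 := ℝ≥0))
  obtain ⟨ns, -, hns⟩ :=
    (tendstoInMeasure_of_tendsto_eLpNorm (by norm_num) hm hv.1 ht).exists_seq_tendsto_ae
  exact ⟨e ∘ ns, fun n => hPe _, fun n => hm _, hns⟩

theorem convex_rect : Convex ℝ (rect L₁ L₂) := (convex_Ioo _ _).prod (convex_Ioo _ _)

theorem SmallRadius.abs_mollify_le {ε : ℝ} (h : SmallRadius L₁ L₂ ε) {u : ℝ × ℝ → ℝ} {B : ℝ}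
    (hB : ∀ᵐ p ∂(volume.restrict (rect L₁ L₂)), |u p| ≤ B) {p : ℝ × ℝ} (hp : p ∈ rect L₁ L₂) :
    |mollify L₁ L₂ ε u p| ≤ B := by
  have ht := h.isTest_kernel hp
  have i1 : IntegrableOn (fun q => kernel ε (contraction L₁ L₂ ε p - q)) (rect L₁ L₂) :=
    (ht.smooth.continuous.integrable_of_hasCompactSupport ht.compact).integrableOn
  have e2 : B = ∫ q in rect L₁ L₂, kernel ε (contraction L₁ L₂ ε p - q) * B := by
    rw [integral_mul_const, h.integral_kernel_sub hp, one_mul]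
  rw [e2, mollify, ← Real.norm_eq_abs]
  refine norm_integral_le_of_norm_le (i1.mul_const B) ?_
  filter_upwards [hB] with q hq
  rw [norm_mul, Real.norm_of_nonneg (kernel_nonneg _ _)]
  exact mul_le_mul_of_nonneg_left hq (kernel_nonneg _ _)

/-- The regularizations have gradients bounded uniformly in `ε`, and the rectangle is convex, so
they share a Lipschitz constant, which survives the almost everywhere limit. -/
theorem exists_lipschitz_representative (hL₁ : 0 < L₁) (hL₂ : 0 < L₂) {u ux uy : ℝ × ℝ → ℝ}
    (hu : MemLp u 2 (volume.restrict (rect L₁ L₂)))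
    (hx : HasWeakDeriv (rect L₁ L₂) (1, 0) u ux) (hy : HasWeakDeriv (rect L₁ L₂) (0, 1) u uy)
    (bx : MemLp ux ⊤ (volume.restrict (rect L₁ L₂)))
    (b_y : MemLp uy ⊤ (volume.restrict (rect L₁ L₂))) :
    ∃ (K : ℝ≥0) (g : ℝ × ℝ → ℝ), LipschitzWith K g ∧ u =ᵐ[volume.restrict (rect L₁ L₂)] g := by
  obtain ⟨B, hBx, hBy⟩ : ∃ B : ℝ≥0, (∀ᵐ p ∂(volume.restrict (rect L₁ L₂)), |ux p| ≤ B) ∧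
      ∀ᵐ p ∂(volume.restrict (rect L₁ L₂)), |uy p| ≤ B := by
    refine ⟨(eLpNorm ux ⊤ (volume.restrict (rect L₁ L₂))).toNNReal +
      (eLpNorm uy ⊤ (volume.restrict (rect L₁ L₂))).toNNReal, ?_, ?_⟩
    · have := ae_le_eLpNormEssSup (f := ux) (μ := volume.restrict (rect L₁ L₂))
      filter_upwards [this] with p hp
      rw [← eLpNorm_exponent_top, ← ENNReal.coe_toNNReal bx.2.ne] at hp
      have : ‖ux p‖₊ ≤ (eLpNorm ux ⊤ (volume.restrict (rect L₁ L₂))).toNNReal := by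
        exact_mod_cast hp
      exact_mod_cast this.trans le_self_add
    · have := ae_le_eLpNormEssSup (f := uy) (μ := volume.restrict (rect L₁ L₂))
      filter_upwards [this] with p hp
      rw [← eLpNorm_exponent_top, ← ENNReal.coe_toNNReal b_y.2.ne] at hp
      have : ‖uy p‖₊ ≤ (eLpNorm uy ⊤ (volume.restrict (rect L₁ L₂))).toNNReal := by
        exact_mod_cast hp
      exact_mod_cast this.trans le_add_self
  have hlip : ∀ ε, SmallRadius L₁ L₂ ε →
      LipschitzOnWith (2 * B) (mollify L₁ L₂ ε u) (rect L₁ L₂) := by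
    intro ε h
    refine convex_rect.lipschitzOnWith_of_nnnorm_fderiv_le (𝕜 := ℝ)
      (fun p _ => (contDiff_mollify h.1 hu).differentiable (by simp) p) fun p hp => ?_
    have hs : |shrink L₁ L₂ ε| ≤ 1 := by
      rw [abs_le]; exact ⟨by linarith [h.half_le], h.le_one⟩
    have i1 : |dx (mollify L₁ L₂ ε u) p| ≤ B := by
      rw [h.dx_mollify hu hx hp, abs_mul]
      exact (mul_le_mul hs (h.abs_mollify_le hBx hp) (abs_nonneg _) zero_le_one).trans_eq
        (one_mul _)
    have i2 : |dy (mollify L₁ L₂ ε u) p| ≤ B := by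
      rw [h.dy_mollify hu hy hp, abs_mul]
      exact (mul_le_mul hs (h.abs_mollify_le hBy hp) (abs_nonneg _) zero_le_one).trans_eq
        (one_mul _)
    rw [← NNReal.coe_le_coe, coe_nnnorm]
    refine ContinuousLinearMap.opNorm_le_bound _ (by positivity) fun v => ?_
    -- The plane carries the sup norm, so the two partial derivatives, each at most `B`, give the
    -- operator norm bound `2 * B`.
    have ev : v = v.1 • ((1 : ℝ), (0 : ℝ)) + v.2 • ((0 : ℝ), (1 : ℝ)) := by ext <;> simp
    have e1 : fderiv ℝ (mollify L₁ L₂ ε u) p v =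
        v.1 * dx (mollify L₁ L₂ ε u) p + v.2 * dy (mollify L₁ L₂ ε u) p := by
      conv_lhs => rw [ev, map_add, map_smul, map_smul]
      rfl
    rw [e1]
    refine (norm_add_le _ _).trans ?_
    rw [norm_mul, norm_mul]
    have n1 := norm_fst_le v
    have n2 := norm_snd_le v
    have m1 := mul_le_mul n1 i1 (abs_nonneg _) (norm_nonneg _)
    have m2 := mul_le_mul n2 i2 (abs_nonneg _) (norm_nonneg _)
    push_cast
    simp only [Real.norm_eq_abs (dx _ _), Real.norm_eq_abs (dy _ _)]
    linarith
  obtain ⟨e, he, -, hae⟩ := (sobolevTendsto_mollify_zero hL₁ hL₂ hu).exists_seq_ae hu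
    (eventually_smallRadius hL₁ hL₂)
  -- On the set of convergence, which has full measure, `u` itself is Lipschitz; it is then extended
  -- from there to the plane.
  have hS : LipschitzOnWith (2 * B) u {p | p ∈ rect L₁ L₂ ∧
      Tendsto (fun n => mollify L₁ L₂ (e n) u p) atTop (𝓝 (u p))} := by
    refine LipschitzOnWith.of_dist_le_mul fun p hp q hq => ?_
    exact le_of_tendsto (hp.2.dist hq.2)
      (Eventually.of_forall fun n => (hlip _ (he n)).dist_le_mul p hp.1 q hq.1)
  obtain ⟨g, hg, hgu⟩ := hS.extend_real
  refine ⟨2 * B, g, hg, ?_⟩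
  filter_upwards [hae, ae_restrict_mem measurableSet_rect] with p h1 h2 using hgu ⟨h2, h1⟩

/-! ### Sobolev embeddings on the rectangle -/

theorem SobolevBound.of_hasWeakDeriv_x (hΩ : IsOpen Ω) {k : ℕ} {u ux : ℝ × ℝ → ℝ} {C : ℝ≥0}
    (h : SobolevBound Ω (k + 1) u C) (hx : HasWeakDeriv Ω (1, 0) u ux) :
    SobolevBound Ω k ux C := by
  obtain ⟨-, vx, vy, hvx, -, bx, -⟩ := h
  exact bx.congr (hvx.unique hΩ hx)

theorem SobolevBound.of_hasWeakDeriv_y (hΩ : IsOpen Ω) {k : ℕ} {u uy : ℝ × ℝ → ℝ} {C : ℝ≥0}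
    (h : SobolevBound Ω (k + 1) u C) (hy : HasWeakDeriv Ω (0, 1) u uy) :
    SobolevBound Ω k uy C := by
  obtain ⟨-, vx, vy, -, hvy, -, b_y⟩ := h
  exact b_y.congr (hvy.unique hΩ hy)

/-- The one-dimensional embedding of `W^{1,1}` into `L^∞`: bound `f t` by `f s` plus the integral of
`|f'|`, then average over `s`. -/
theorem enorm_le_lintegral_Ioo {L : ℝ} (hL : 0 < L) {f f' : ℝ → ℝ}
    (hf : ∀ x, HasDerivAt f (f' x) x) (hf' : Continuous f') {t : ℝ} (ht : t ∈ Ioo 0 L) :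
    ‖f t‖ₑ ≤ ∫⁻ x in Ioo 0 L, (ENNReal.ofReal L⁻¹ * ‖f x‖ₑ + ‖f' x‖ₑ) := by
  have hfc : Continuous f := continuous_iff_continuousAt.2 fun x => (hf x).continuousAt
  set D := ∫⁻ x in Ioo 0 L, ‖f' x‖ₑ with hD
  have h1 : ∀ s ∈ Ioo 0 L, ‖f t‖ₑ ≤ ‖f s‖ₑ + D := by
    intro s hs
    have e : f t = f s + ∫ x in s..t, f' x := by
      rw [intervalIntegral.integral_eq_sub_of_hasDerivAt (fun x _ => hf x)
        (hf'.intervalIntegrable _ _)]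
      ring
    have i1 : ‖∫ x in s..t, f' x‖ₑ ≤ D := by
      have e2 : ‖∫ x in s..t, f' x‖ₑ = ‖∫ x in uIoc s t, f' x‖ₑ := by
        rw [← ofReal_norm, ← ofReal_norm, intervalIntegral.norm_intervalIntegral_eq]
      rw [e2]
      refine (enorm_integral_le_lintegral_enorm _).trans (lintegral_mono_set fun x hx => ?_)
      rw [uIoc, mem_Ioc] at hx
      exact ⟨(le_min hs.1.le ht.1.le).trans_lt hx.1, hx.2.trans_lt (max_lt hs.2 ht.2)⟩
    calc ‖f t‖ₑ = ‖f s + ∫ x in s..t, f' x‖ₑ := by rw [← e]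
      _ ≤ ‖f s‖ₑ + ‖∫ x in s..t, f' x‖ₑ := enorm_add_le _ _
      _ ≤ _ := add_le_add le_rfl i1
  have hvol : volume (Ioo 0 L) = ENNReal.ofReal L := by simp
  have h2 : ENNReal.ofReal L * ‖f t‖ₑ ≤ (∫⁻ x in Ioo 0 L, ‖f x‖ₑ) + ENNReal.ofReal L * D := by
    have := setLIntegral_mono_ae' (μ := volume) measurableSet_Ioo (Eventually.of_forall h1)
    rw [setLIntegral_const, lintegral_add_right _ measurable_const, setLIntegral_const, hvol] at this
    rwa [mul_comm, mul_comm _ D]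
  have hinv : ENNReal.ofReal L⁻¹ * ENNReal.ofReal L = 1 := by
    rw [← ENNReal.ofReal_mul (by positivity), inv_mul_cancel₀ hL.ne', ENNReal.ofReal_one]
  rw [lintegral_add_left (by fun_prop), lintegral_const_mul _ (by fun_prop)]
  have h3 := mul_le_mul_right h2 (ENNReal.ofReal L⁻¹)
  rwa [mul_add, ← mul_assoc, ← mul_assoc, hinv, one_mul, one_mul] at h3

theorem hasDerivAt_dx {F : ℝ × ℝ → ℝ} (hF : ContDiff ℝ ∞ F) (x y : ℝ) :
    HasDerivAt (fun x => F (x, y)) (dx F (x, y)) x := by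
  have h1 : HasFDerivAt F (fderiv ℝ F (x, y)) (x, y) :=
    (hF.differentiable (by simp) _).hasFDerivAt
  exact h1.comp_hasDerivAt x ((hasDerivAt_id x).prodMk (hasDerivAt_const x y))

theorem hasDerivAt_dy {F : ℝ × ℝ → ℝ} (hF : ContDiff ℝ ∞ F) (x y : ℝ) :
    HasDerivAt (fun y => F (x, y)) (dy F (x, y)) y := by
  have h1 : HasFDerivAt F (fderiv ℝ F (x, y)) (x, y) :=
    (hF.differentiable (by simp) _).hasFDerivAt
  exact h1.comp_hasDerivAt y ((hasDerivAt_const y x).prodMk (hasDerivAt_id y))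

theorem setLIntegral_rect {f : ℝ × ℝ → ℝ≥0∞} (hf : Measurable f) :
    ∫⁻ p in rect L₁ L₂, f p = ∫⁻ x in Ioo 0 L₁, ∫⁻ y in Ioo 0 L₂, f (x, y) := by
  rw [rect, Measure.volume_eq_prod, ← Measure.prod_restrict, lintegral_prod _ hf.aemeasurable]

theorem setLIntegral_rect_symm {f : ℝ × ℝ → ℝ≥0∞} (hf : Measurable f) :
    ∫⁻ p in rect L₁ L₂, f p = ∫⁻ y in Ioo 0 L₂, ∫⁻ x in Ioo 0 L₁, f (x, y) := by
  rw [rect, Measure.volume_eq_prod, ← Measure.prod_restrict, lintegral_prod_symm _ hf.aemeasurable]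

theorem lintegral_enorm_le_of_sobolevBound {k : ℕ} {u : ℝ × ℝ → ℝ} {C : ℝ≥0}
    (h : SobolevBound (rect L₁ L₂) k u C) :
    ∫⁻ p in rect L₁ L₂, ‖u p‖ₑ ≤ (1 + volume (rect L₁ L₂)) * C := by
  have h1 := lintegral_mul_sq_le (volume.restrict (rect L₁ L₂)) (f := fun _ => 1)
    (g := fun p => ‖u p‖ₑ) aemeasurable_const h.memLp.1.enorm
  simp only [one_mul, one_pow, lintegral_one, Measure.restrict_apply_univ] at h1
  rw [← eLpNorm_two_sq] at h1
  refine le_of_sq_le_sq_ennreal (h1.trans ?_)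
  rw [mul_pow]
  refine mul_le_mul' ?_ (pow_le_pow_left₀ zero_le h.norm_le 2)
  -- The inequality `V ≤ (1 + V)²` replaces the square root of the area by `1 + V` and avoids roots.
  refine le_self_add.trans (b := volume (rect L₁ L₂) + (1 + volume (rect L₁ L₂) +
    volume (rect L₁ L₂) ^ 2)) (le_of_eq ?_)
  ring

/-- Apply the one-dimensional embedding in `x`, then in `y` to both `F` and `F_x`. Only the mixed
second derivative appears. -/
theorem enorm_le_of_contDiff_of_sobolevBound (hL₁ : 0 < L₁) (hL₂ : 0 < L₂) {F : ℝ × ℝ → ℝ}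
    {C : ℝ≥0} (hF : ContDiff ℝ ∞ F) (h : SobolevBound (rect L₁ L₂) 2 F C) {p : ℝ × ℝ}
    (hp : p ∈ rect L₁ L₂) :
    ‖F p‖ₑ ≤ (ENNReal.ofReal L₁⁻¹ + 1) * (ENNReal.ofReal L₂⁻¹ + 1) *
      (1 + volume (rect L₁ L₂)) * C := by
  obtain ⟨x, y⟩ := p
  set a := ENNReal.ofReal L₁⁻¹
  set b := ENNReal.ofReal L₂⁻¹
  have hFx := contDiff_dx hF
  have hFy := contDiff_dy hF
  have hFxy := contDiff_dy hFx
  have cF := hF.continuous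
  have cx := hFx.continuous
  have cy := hFy.continuous
  have cxy := hFxy.continuous
  have mF := cF.measurable
  have mx := cx.measurable
  have my := cy.measurable
  have bx := h.of_hasWeakDeriv_x isOpen_rect (hasWeakDeriv_dx hF)
  have b_y := h.of_hasWeakDeriv_y isOpen_rect (hasWeakDeriv_dy hF)
  have bxy := bx.of_hasWeakDeriv_y isOpen_rect (hasWeakDeriv_dy hFx)
  have i1 : ‖F (x, y)‖ₑ ≤ ∫⁻ s in Ioo 0 L₁, (a * ‖F (s, y)‖ₑ + ‖dx F (s, y)‖ₑ) :=
    enorm_le_lintegral_Ioo hL₁ (f := fun s => F (s, y)) (fun s => hasDerivAt_dx hF s y)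
      (by fun_prop) hp.1
  have i2 : ∀ s, a * ‖F (s, y)‖ₑ + ‖dx F (s, y)‖ₑ ≤ ∫⁻ t in Ioo 0 L₂,
      (a * (b * ‖F (s, t)‖ₑ + ‖dy F (s, t)‖ₑ) + (b * ‖dx F (s, t)‖ₑ + ‖dy (dx F) (s, t)‖ₑ)) := by
    intro s
    rw [lintegral_add_left (by fun_prop), lintegral_const_mul _ (by fun_prop)]
    refine add_le_add (mul_le_mul' le_rfl ?_) ?_
    · exact enorm_le_lintegral_Ioo hL₂ (f := fun t => F (s, t)) (fun t => hasDerivAt_dy hF s t)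
        (by fun_prop) hp.2
    · exact enorm_le_lintegral_Ioo hL₂ (f := fun t => dx F (s, t))
        (fun t => hasDerivAt_dy hFx s t) (by fun_prop) hp.2
  refine (i1.trans (lintegral_mono i2)).trans ?_
  rw [← setLIntegral_rect (f := fun p => a * (b * ‖F p‖ₑ + ‖dy F p‖ₑ) +
    (b * ‖dx F p‖ₑ + ‖dy (dx F) p‖ₑ)) (by fun_prop),
    lintegral_add_left (by fun_prop), lintegral_const_mul _ (by fun_prop),
    lintegral_add_left (by fun_prop), lintegral_const_mul _ (by fun_prop),
    lintegral_add_left (by fun_prop), lintegral_const_mul _ (by fun_prop)]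
  calc _ ≤ a * (b * ((1 + volume (rect L₁ L₂)) * C) + (1 + volume (rect L₁ L₂)) * C) +
        (b * ((1 + volume (rect L₁ L₂)) * C) + (1 + volume (rect L₁ L₂)) * C) := by
        gcongr
        · exact lintegral_enorm_le_of_sobolevBound h
        · exact lintegral_enorm_le_of_sobolevBound b_y
        · exact lintegral_enorm_le_of_sobolevBound bx
        · exact lintegral_enorm_le_of_sobolevBound bxy
    _ = _ := by ring

theorem le_mul_of_forall_add_le {x : ℝ≥0∞} {K C : ℝ≥0}
    (h : ∀ η : ℝ≥0, 0 < η → x ≤ ((K * (C + η) : ℝ≥0) : ℝ≥0∞)) : x ≤ ((K * C : ℝ≥0) : ℝ≥0∞) := by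
  have ht : Tendsto (fun η : ℝ≥0 => ((K * (C + η) : ℝ≥0) : ℝ≥0∞)) (𝓝[>] 0)
      (𝓝 ((K * (C + 0) : ℝ≥0) : ℝ≥0∞)) := by
    refine ENNReal.tendsto_coe.2 (Tendsto.mono_left ?_ nhdsWithin_le_nhds)
    exact (Continuous.tendsto (by fun_prop) 0)
  rw [add_zero] at ht
  exact ge_of_tendsto ht (by filter_upwards [self_mem_nhdsWithin] with η hη using h η hη)

/-- Almost everywhere convergent smooth approximations which satisfy nearly the same bounds. -/
theorem SobolevBound.exists_seq (hL₁ : 0 < L₁) (hL₂ : 0 < L₂) {k : ℕ} {u : ℝ × ℝ → ℝ} {C η : ℝ≥0}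
    (h : SobolevBound (rect L₁ L₂) k u C) (hη : 0 < η) : ∃ F : ℕ → ℝ × ℝ → ℝ,
      (∀ n, ContDiff ℝ ∞ (F n) ∧ SobolevBound (rect L₁ L₂) k (F n) (C + η)) ∧
      ∀ᵐ p ∂(volume.restrict (rect L₁ L₂)), Tendsto (fun n => F n p) atTop (𝓝 (u p)) := by
  have ht := sobolevTendsto_mollify hL₁ hL₂ h
  obtain ⟨e, he, -, hae⟩ := (ht.of_le (Nat.zero_le k)).exists_seq_ae h.memLp
    ((eventually_smallRadius hL₁ hL₂).and (ht η hη))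
  refine ⟨fun n => mollify L₁ L₂ (e n) u, fun n => ⟨contDiff_mollify (he n).1.1 h.memLp, ?_⟩, hae⟩
  have := (he n).2.add h
  rwa [sub_add_cancel, add_comm] at this

/-- The embedding of `H²` into `L^∞`. -/
theorem exists_ae_bound_of_sobolevBound_two (hL₁ : 0 < L₁) (hL₂ : 0 < L₂) :
    ∃ K : ℝ≥0, ∀ u C, SobolevBound (rect L₁ L₂) 2 u C →
      MemLp u ⊤ (volume.restrict (rect L₁ L₂)) ∧
      eLpNorm u ⊤ (volume.restrict (rect L₁ L₂)) ≤ ((K * C : ℝ≥0) : ℝ≥0∞) := by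
  have hK : (ENNReal.ofReal L₁⁻¹ + 1) * (ENNReal.ofReal L₂⁻¹ + 1) *
      (1 + volume (rect L₁ L₂)) ≠ ⊤ := by
    refine ENNReal.mul_ne_top (ENNReal.mul_ne_top ?_ ?_) ?_ <;>
      simp [volume_rect_lt_top.ne]
  lift (ENNReal.ofReal L₁⁻¹ + 1) * (ENNReal.ofReal L₂⁻¹ + 1) *
      (1 + volume (rect L₁ L₂)) to ℝ≥0 using hK with K hKeq
  refine ⟨K, fun u C h => ?_⟩
  have hle : eLpNorm u ⊤ (volume.restrict (rect L₁ L₂)) ≤ ((K * C : ℝ≥0) : ℝ≥0∞) := by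
    refine le_mul_of_forall_add_le fun η hη => ?_
    obtain ⟨F, hF, hae⟩ := h.exists_seq hL₁ hL₂ hη
    rw [eLpNorm_exponent_top]
    refine eLpNormEssSup_le_of_ae_enorm_bound ?_
    filter_upwards [hae, ae_restrict_mem measurableSet_rect] with p hp hp'
    refine le_of_tendsto hp.enorm (Eventually.of_forall fun n => ?_)
    refine (enorm_le_of_contDiff_of_sobolevBound hL₁ hL₂ (hF n).1 (hF n).2 hp').trans_eq ?_
    rw [← hKeq]
    push_cast
    rfl
  exact ⟨⟨h.memLp.1, hle.trans_lt ENNReal.coe_lt_top⟩, hle⟩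

theorem hasDerivAt_sq {f : ℝ → ℝ} {f' x : ℝ} (h : HasDerivAt f f' x) :
    HasDerivAt (fun x => f x ^ 2) (2 * f x * f') x := by
  refine (h.pow 2).congr_deriv ?_
  simp

/-- Ladyzhenskaya's argument: the one-dimensional embedding for `F²` along vertical and horizontal
lines gives `F² ≤ A(x)` and `F² ≤ B(y)`. The integral of `F⁴` is then at most `∫ A · ∫ B`, and
Cauchy–Schwarz bounds each factor by the `H¹` norm. -/
theorem lintegral_enorm_pow_four_le_of_contDiff (hL₁ : 0 < L₁) (hL₂ : 0 < L₂) {F : ℝ × ℝ → ℝ}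
    {C : ℝ≥0} (hF : ContDiff ℝ ∞ F) (h : SobolevBound (rect L₁ L₂) 1 F C) :
    ∫⁻ p in rect L₁ L₂, ‖F p‖ₑ ^ 4 ≤
      (ENNReal.ofReal L₁⁻¹ + 2) * (ENNReal.ofReal L₂⁻¹ + 2) * (C : ℝ≥0∞) ^ 4 := by
  set a := ENNReal.ofReal L₁⁻¹
  set b := ENNReal.ofReal L₂⁻¹
  have cF := hF.continuous
  have cx := (contDiff_dx hF).continuous
  have cy := (contDiff_dy hF).continuous
  have bx := h.of_hasWeakDeriv_x isOpen_rect (hasWeakDeriv_dx hF)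
  have b_y := h.of_hasWeakDeriv_y isOpen_rect (hasWeakDeriv_dy hF)
  set A : ℝ → ℝ≥0∞ := fun x => ∫⁻ t in Ioo 0 L₂, (b * ‖F (x, t) ^ 2‖ₑ +
    ‖2 * F (x, t) * dy F (x, t)‖ₑ) with hA
  set B : ℝ → ℝ≥0∞ := fun y => ∫⁻ s in Ioo 0 L₁, (a * ‖F (s, y) ^ 2‖ₑ +
    ‖2 * F (s, y) * dx F (s, y)‖ₑ) with hB
  have mA : Measurable (fun p => b * ‖F p ^ 2‖ₑ + ‖2 * F p * dy F p‖ₑ) := by fun_prop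
  have mB : Measurable (fun p => a * ‖F p ^ 2‖ₑ + ‖2 * F p * dx F p‖ₑ) := by fun_prop
  have mA' : Measurable A := mA.lintegral_prod_right'
  have mB' : Measurable B := mB.lintegral_prod_left'
  have hsq : ∀ {G : ℝ × ℝ → ℝ} {c : ℝ≥0∞}, Continuous G → SobolevBound (rect L₁ L₂) 0 G C →
      ∫⁻ p in rect L₁ L₂, (c * ‖F p ^ 2‖ₑ + ‖2 * F p * G p‖ₑ) ≤ (c + 2) * (C : ℝ≥0∞) ^ 2 := by
    intro G c cG hG
    rw [lintegral_add_left (by fun_prop), lintegral_const_mul _ (by fun_prop), add_mul]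
    refine add_le_add (mul_le_mul' le_rfl ?_) ?_
    · simp only [enorm_pow]
      rw [← eLpNorm_two_sq]
      exact pow_le_pow_left₀ zero_le h.norm_le 2
    · have e2 : ‖(2 : ℝ)‖ₑ = 2 := by
        rw [Real.enorm_eq_ofReal (by norm_num)]; simp
      simp only [mul_assoc, enorm_mul, e2]
      rw [lintegral_const_mul _ (by fun_prop)]
      refine mul_le_mul' le_rfl (le_of_sq_le_sq_ennreal ?_)
      refine (lintegral_mul_sq_le _ (by fun_prop) (by fun_prop)).trans ?_
      rw [← eLpNorm_two_sq, ← eLpNorm_two_sq, sq ((C : ℝ≥0∞) ^ 2)]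
      exact mul_le_mul' (pow_le_pow_left₀ zero_le h.norm_le 2)
        (pow_le_pow_left₀ zero_le hG.norm_le 2)
  have i1 : ∀ p ∈ rect L₁ L₂, ‖F p‖ₑ ^ 4 ≤ A p.1 * B p.2 := by
    rintro ⟨x, y⟩ hp
    have e4 : ‖F (x, y)‖ₑ ^ 4 = ‖F (x, y) ^ 2‖ₑ * ‖F (x, y) ^ 2‖ₑ := by
      rw [enorm_pow]; ring
    rw [e4]
    refine mul_le_mul' ?_ ?_
    · exact enorm_le_lintegral_Ioo hL₂ (f := fun t => F (x, t) ^ 2)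
        (fun t => hasDerivAt_sq (hasDerivAt_dy hF x t)) (by fun_prop) hp.2
    · exact enorm_le_lintegral_Ioo hL₁ (f := fun s => F (s, y) ^ 2)
        (fun s => hasDerivAt_sq (hasDerivAt_dx hF s y)) (by fun_prop) hp.1
  calc ∫⁻ p in rect L₁ L₂, ‖F p‖ₑ ^ 4 ≤ ∫⁻ p in rect L₁ L₂, A p.1 * B p.2 :=
        setLIntegral_mono_ae' measurableSet_rect (Eventually.of_forall i1)
    _ = (∫⁻ x in Ioo 0 L₁, A x) * ∫⁻ y in Ioo 0 L₂, B y := by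
        rw [rect, Measure.volume_eq_prod, ← Measure.prod_restrict,
          lintegral_prod_mul mA'.aemeasurable mB'.aemeasurable]
    _ ≤ ((b + 2) * (C : ℝ≥0∞) ^ 2) * ((a + 2) * (C : ℝ≥0∞) ^ 2) := by
        refine mul_le_mul' ?_ ?_
        · rw [hA, ← setLIntegral_rect mA]
          exact hsq cy b_y
        · rw [hB, ← setLIntegral_rect_symm mB]
          exact hsq cx bx
    _ = _ := by ring

/-- Fatou's lemma along smooth approximations, followed by the limit in the slack `η`. -/
theorem exists_lintegral_enorm_pow_four_bound (hL₁ : 0 < L₁) (hL₂ : 0 < L₂) :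
    ∃ K : ℝ≥0, ∀ u C, SobolevBound (rect L₁ L₂) 1 u C →
      ∫⁻ p in rect L₁ L₂, ‖u p‖ₑ ^ 4 ≤ (((K * C) ^ 4 : ℝ≥0) : ℝ≥0∞) := by
  set K : ℝ≥0 := (L₁⁻¹.toNNReal + 2) * (L₂⁻¹.toNNReal + 2) with hK
  -- Since `K ≤ K ^ 4`, the constant may be put under the fourth power.
  have hK1 : 1 ≤ K := by
    have h2 : (1 : ℝ≥0) ≤ 2 := by norm_num
    exact one_le_mul_of_one_le_of_one_le (h2.trans le_add_self) (h2.trans le_add_self)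
  refine ⟨K, fun u C h => ?_⟩
  have key : ∀ η : ℝ≥0, 0 < η →
      ∫⁻ p in rect L₁ L₂, ‖u p‖ₑ ^ 4 ≤ (((K * (C + η)) ^ 4 : ℝ≥0) : ℝ≥0∞) := by
    intro η hη
    obtain ⟨F, hF, hae⟩ := h.exists_seq hL₁ hL₂ hη
    have hb : ∀ n, ∫⁻ p in rect L₁ L₂, ‖F n p‖ₑ ^ 4 ≤ (((K * (C + η)) ^ 4 : ℝ≥0) : ℝ≥0∞) := by
      intro n
      refine (lintegral_enorm_pow_four_le_of_contDiff hL₁ hL₂ (hF n).1 (hF n).2).trans ?_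
      have : K * (C + η) ^ 4 ≤ (K * (C + η)) ^ 4 := by
        rw [mul_pow]
        exact mul_le_mul_left (le_self_pow₀ hK1 (by norm_num)) _
      rw [hK] at this
      change ((L₁⁻¹.toNNReal : ℝ≥0∞) + 2) * ((L₂⁻¹.toNNReal : ℝ≥0∞) + 2) * ((C + η : ℝ≥0) : ℝ≥0∞) ^ 4
        ≤ (((K * (C + η)) ^ 4 : ℝ≥0) : ℝ≥0∞)
      exact_mod_cast this
    calc ∫⁻ p in rect L₁ L₂, ‖u p‖ₑ ^ 4
        = ∫⁻ p in rect L₁ L₂, liminf (fun n => ‖F n p‖ₑ ^ 4) atTop := by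
          refine lintegral_congr_ae ?_
          filter_upwards [hae] with p hp
          exact (((ENNReal.continuous_pow 4).tendsto _).comp hp.enorm).liminf_eq.symm
      _ ≤ liminf (fun n => ∫⁻ p in rect L₁ L₂, ‖F n p‖ₑ ^ 4) atTop :=
          lintegral_liminf_le fun n => by
            have := (hF n).1.continuous
            fun_prop
      _ ≤ liminf (fun _ => (((K * (C + η)) ^ 4 : ℝ≥0) : ℝ≥0∞)) atTop :=
          liminf_le_liminf (Eventually.of_forall hb)
      _ = _ := by simp
  have ht : Tendsto (fun η : ℝ≥0 => (((K * (C + η)) ^ 4 : ℝ≥0) : ℝ≥0∞)) (𝓝[>] 0)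
      (𝓝 (((K * (C + 0)) ^ 4 : ℝ≥0) : ℝ≥0∞)) := by
    refine ENNReal.tendsto_coe.2 (Tendsto.mono_left ?_ nhdsWithin_le_nhds)
    exact (Continuous.tendsto (by fun_prop) 0)
  rw [add_zero] at ht
  exact ge_of_tendsto ht (by filter_upwards [self_mem_nhdsWithin] with η hη using key η hη)

/-- The product of two functions in `H¹` is in `L²`. -/
theorem exists_mul_bound_one_one (hL₁ : 0 < L₁) (hL₂ : 0 < L₂) :
    ∃ K : ℝ≥0, ∀ u v C D, SobolevBound (rect L₁ L₂) 1 u C → SobolevBound (rect L₁ L₂) 1 v D →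
      SobolevBound (rect L₁ L₂) 0 (u * v) (K * C * D) := by
  obtain ⟨K, hK⟩ := exists_lintegral_enorm_pow_four_bound hL₁ hL₂
  refine ⟨K * K, fun u v C D hu hv => ⟨hu.memLp.1.mul hv.memLp.1, ?_⟩⟩
  -- Squaring twice reaches fourth powers, where Cauchy–Schwarz separates `u` from `v`.
  refine le_of_sq_le_sq_ennreal (le_of_sq_le_sq_ennreal ?_)
  rw [eLpNorm_two_sq]
  simp only [Pi.mul_apply, enorm_mul, mul_pow]
  refine (lintegral_mul_sq_le _ (hu.memLp.1.enorm.pow_const 2)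
    (hv.memLp.1.enorm.pow_const 2)).trans ?_
  simp only [← pow_mul]
  refine (mul_le_mul' (hK u C hu) (hK v D hv)).trans_eq ?_
  push_cast
  ring

/-! ### Multipliers of Sobolev spaces -/

/-- Multiplication by `g` is bounded on `H^k(Ω)`. -/
def IsMultiplier (Ω : Set (ℝ × ℝ)) (k : ℕ) (g : ℝ × ℝ → ℝ) : Prop :=
  ∃ K : ℝ≥0, ∀ u C, SobolevBound Ω k u C → SobolevBound Ω k (g * u) (K * C)

theorem sobolevBound_zero_mul_of_memLp_top {u g : ℝ × ℝ → ℝ} {K C : ℝ≥0}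
    (hg : MemLp g ⊤ (volume.restrict Ω)) (hgK : eLpNorm g ⊤ (volume.restrict Ω) ≤ K)
    (hu : SobolevBound Ω 0 u C) : SobolevBound Ω 0 (g * u) (K * C) := by
  refine ⟨hg.1.mul hu.1, ?_⟩
  refine (eLpNorm_smul_le_eLpNorm_top_mul_eLpNorm 2 hu.1 g).trans ?_
  push_cast
  exact mul_le_mul' hgK hu.2

theorem isMultiplier_zero_of_memLp_top {g : ℝ × ℝ → ℝ} (hg : MemLp g ⊤ (volume.restrict Ω)) :
    IsMultiplier Ω 0 g :=
  ⟨_, fun _ _ hu => sobolevBound_zero_mul_of_memLp_top hg (ENNReal.coe_toNNReal hg.2.ne).ge hu⟩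

/-- Induction on `k` by the product rule. The term with a derivative of `u` is covered by the
induction hypothesis, and order zero by `H² ⊂ L^∞`; the term with a derivative of `v` needs a
separate bound. -/
theorem exists_mul_bound (hL₁ : 0 < L₁) (hL₂ : 0 < L₂) (k : ℕ) :
    ∃ K : ℝ≥0, ∀ u v C D, SobolevBound (rect L₁ L₂) k u C →
      SobolevBound (rect L₁ L₂) (max k 2) v D → SobolevBound (rect L₁ L₂) k (u * v) (K * C * D) := by
  obtain ⟨K₀, hK₀⟩ := exists_ae_bound_of_sobolevBound_two hL₁ hL₂
  have h0 : ∀ u v C D, SobolevBound (rect L₁ L₂) 0 u C →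
      SobolevBound (rect L₁ L₂) 2 v D → SobolevBound (rect L₁ L₂) 0 (u * v) (K₀ * C * D) := by
    intro u v C D hu hv
    obtain ⟨h1, h2⟩ := hK₀ v D hv
    have := sobolevBound_zero_mul_of_memLp_top h1 h2 hu
    rwa [mul_comm u v, mul_right_comm]
  induction k with
  | zero => exact ⟨K₀, h0⟩
  | succ k ih =>
    obtain ⟨K₁, hK₁⟩ := ih
    -- A derivative of `v` is only in `H^{max(k,1)}`. For `k ≥ 1` the two factors exchange roles,
    -- since `H^{k+1}` lies in `H^{max(k,2)}`; for `k = 0` the product `H¹ · H¹ ⊂ L²` takes over.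
    obtain ⟨K₂, hK₂⟩ : ∃ K : ℝ≥0, ∀ u v C D, SobolevBound (rect L₁ L₂) (k + 1) u C →
        SobolevBound (rect L₁ L₂) (max k 1) v D →
        SobolevBound (rect L₁ L₂) k (u * v) (K * C * D) := by
      rcases Nat.eq_zero_or_pos k with rfl | hk
      · obtain ⟨K, hK⟩ := exists_mul_bound_one_one hL₁ hL₂
        exact ⟨K, hK⟩
      · refine ⟨K₁, fun u v C D hu hv => ?_⟩
        have := hK₁ v u D C (hv.of_le (le_max_left _ _)) (hu.of_le (by omega))
        rwa [mul_comm u v, mul_right_comm]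
    refine ⟨K₀ + K₁ + K₂, fun u v C D hu hv => ?_⟩
    have e : max (k + 1) 2 = max k 1 + 1 := by omega
    have b0 := h0 u v C D hu.zero_order (hv.of_le (le_max_right _ _))
    have hv1 : SobolevBound (rect L₁ L₂) (max k 2) v D := hv.of_le (by omega)
    rw [e] at hv
    have u2 := hu.memLp
    have v2 := hv.memLp
    have hu' := hu
    obtain ⟨-, ux, uy, hux, huy, bux, buy⟩ := hu
    obtain ⟨-, vx, vy, hvx, hvy, bvx, bvy⟩ := hv
    have le1 : K₀ * C * D ≤ (K₀ + K₁ + K₂) * C * D := by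
      gcongr; rw [add_assoc]; exact le_self_add
    have le2 : K₁ * C * D + K₂ * C * D ≤ (K₀ + K₁ + K₂) * C * D := by
      rw [← add_mul, ← add_mul]
      gcongr
      exact le_add_self
    exact ⟨b0.mono le1, _, _, hux.mul_x hL₁ hL₂ hvx u2 bux.memLp v2 bvx.memLp,
      huy.mul_y hL₁ hL₂ hvy u2 buy.memLp v2 bvy.memLp,
      ((hK₁ _ _ _ _ bux hv1).add (hK₂ _ _ _ _ hu' bvx)).mono le2,
      ((hK₁ _ _ _ _ buy hv1).add (hK₂ _ _ _ _ hu' bvy)).mono le2⟩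

theorem SobolevBound.isMultiplier (hL₁ : 0 < L₁) (hL₂ : 0 < L₂) {k : ℕ} {g : ℝ × ℝ → ℝ} {D : ℝ≥0}
    (hg : SobolevBound (rect L₁ L₂) (max k 2) g D) : IsMultiplier (rect L₁ L₂) k g := by
  obtain ⟨K, hK⟩ := exists_mul_bound hL₁ hL₂ k
  refine ⟨K * D, fun u C hu => ?_⟩
  have := hK u g C D hu hg
  rwa [mul_comm g u, mul_right_comm]

theorem SobolevTendsto.mul {k : ℕ} {g : ℝ × ℝ → ℝ} (hg : IsMultiplier Ω k g)
    {F : ℝ → ℝ × ℝ → ℝ} {v : ℝ × ℝ → ℝ} (h : SobolevTendsto Ω k F v) :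
    SobolevTendsto Ω k (fun ε => g * F ε) (g * v) := by
  obtain ⟨K, hK⟩ := hg
  refine h.of_bound_mul (K := K) fun ε η hε => ?_
  have := hK _ _ hε
  rwa [mul_sub] at this

/-! ### The transport operator -/

/-- `w = lam θ_x + θ_y` in the sense of distributions, where `lx` is the derivative of `lam`. -/
def WeakTransport (Ω : Set (ℝ × ℝ)) (lam lx θ w : ℝ × ℝ → ℝ) : Prop :=
  LocallyIntegrableOn w Ω ∧ ∀ φ, IsTest Ω φ → ∫ p in Ω, w p * φ p =
    - ∫ p in Ω, θ p * (lam p * dx φ p + lx p * φ p + dy φ p)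

/-- A Lipschitz coefficient, bounded on the rectangle, with its weak derivatives. -/
structure LipschitzCoefficient (L₁ L₂ : ℝ) (lam lx ly : ℝ × ℝ → ℝ) : Prop where
  lipschitz : ∃ K : ℝ≥0, LipschitzWith K lam
  hasDeriv_x : HasWeakDeriv (rect L₁ L₂) (1, 0) lam lx
  hasDeriv_y : HasWeakDeriv (rect L₁ L₂) (0, 1) lam ly
  memLp_x : MemLp lx ⊤ (volume.restrict (rect L₁ L₂))
  memLp_y : MemLp ly ⊤ (volume.restrict (rect L₁ L₂))

theorem exists_abs_le_on_rect {F : ℝ × ℝ → ℝ} (hF : Continuous F) :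
    ∃ M : ℝ, 0 ≤ M ∧ ∀ p ∈ rect L₁ L₂, |F p| ≤ M := by
  obtain ⟨M, hM⟩ := (isCompact_Icc.prod isCompact_Icc :
    IsCompact (Icc 0 L₁ ×ˢ Icc 0 L₂)).exists_bound_of_continuousOn hF.continuousOn
  refine ⟨max M 0, le_max_right _ _, fun p hp => (hM p ?_).trans (le_max_left _ _)⟩
  exact ⟨Ioo_subset_Icc_self hp.1, Ioo_subset_Icc_self hp.2⟩

theorem memLp_of_continuous {F : ℝ × ℝ → ℝ} (hF : Continuous F) (q : ℝ≥0∞) :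
    MemLp F q (volume.restrict (rect L₁ L₂)) := by
  obtain ⟨M, -, hM⟩ := exists_abs_le_on_rect (L₁ := L₁) (L₂ := L₂) hF
  refine MemLp.of_bound hF.aestronglyMeasurable M ?_
  filter_upwards [ae_restrict_mem measurableSet_rect] with p hp using hM p hp

theorem LipschitzCoefficient.continuous {lam lx ly : ℝ × ℝ → ℝ}
    (h : LipschitzCoefficient L₁ L₂ lam lx ly) : Continuous lam :=
  h.lipschitz.choose_spec.continuous

theorem memLp_transport_adjoint {lam lx φ : ℝ × ℝ → ℝ} (hl : MemLp lam 2 (volume.restrict Ω))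
    (hx : MemLp lx 2 (volume.restrict Ω)) (hφ : IsTest Ω φ) :
    MemLp (fun p => lam p * dx φ p + lx p * φ p + dy φ p) 2 (volume.restrict Ω) :=
  ((hφ.dx.memLp_mul hl).add (hφ.memLp_mul hx)).add hφ.dy.memLp

theorem WeakTransport.sub {lam lx θ w θ' w' : ℝ × ℝ → ℝ}
    (hl : MemLp lam 2 (volume.restrict Ω)) (hx : MemLp lx 2 (volume.restrict Ω))
    (h : WeakTransport Ω lam lx θ w) (h' : WeakTransport Ω lam lx θ' w')
    (hθ : MemLp θ 2 (volume.restrict Ω)) (hθ' : MemLp θ' 2 (volume.restrict Ω)) :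
    WeakTransport Ω lam lx (θ - θ') (w - w') := by
  refine ⟨h.1.sub h'.1, fun φ hφ => ?_⟩
  have ha := memLp_transport_adjoint hl hx hφ
  simp only [Pi.sub_apply, sub_mul]
  have e := integral_sub (hθ.integrable_mul ha) (hθ'.integrable_mul ha)
  simp only [Pi.mul_apply] at e
  rw [integral_sub (hφ.integrableOn_mul h.1) (hφ.integrableOn_mul h'.1), e, h.2 φ hφ, h'.2 φ hφ]
  ring

theorem WeakTransport.unique (hΩ : IsOpen Ω) {lam lx θ w w' : ℝ × ℝ → ℝ}
    (h : WeakTransport Ω lam lx θ w) (h' : WeakTransport Ω lam lx θ w') :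
    w =ᵐ[volume.restrict Ω] w' :=
  ae_eq_of_forall_integral_test_eq hΩ h.1 h'.1 fun φ hφ => (h.2 φ hφ).trans (h'.2 φ hφ).symm

theorem WeakTransport.congr {lam lx lam' lx' θ w : ℝ × ℝ → ℝ} (h : WeakTransport Ω lam lx θ w)
    (hl : lam =ᵐ[volume.restrict Ω] lam') (hx : lx =ᵐ[volume.restrict Ω] lx') :
    WeakTransport Ω lam' lx' θ w := by
  refine ⟨h.1, fun φ hφ => ?_⟩
  rw [h.2 φ hφ]
  congr 1
  refine integral_congr_ae ?_
  filter_upwards [hl, hx] with p h1 h2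
  rw [h1, h2]

/-- For differentiable `θ` the distributional definition agrees with the pointwise formula. The
product rule for `lam * θ` is an assumption, so that smooth and Sobolev functions `θ` are both
covered. -/
theorem weakTransport_of_hasWeakDeriv {lam lx θ θx θy : ℝ × ℝ → ℝ}
    (hl : MemLp lam 2 (volume.restrict Ω)) (hlx : MemLp lx 2 (volume.restrict Ω))
    (hθ : MemLp θ 2 (volume.restrict Ω)) (hθx : MemLp θx 2 (volume.restrict Ω))
    (h : HasWeakDeriv Ω (1, 0) (lam * θ) (lx * θ + lam * θx)) (hy : HasWeakDeriv Ω (0, 1) θ θy) :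
    WeakTransport Ω lam lx θ (lam * θx + θy) := by
  have l1 := locallyIntegrableOn_mul hl hθx
  have l2 := locallyIntegrableOn_mul hlx hθ
  refine ⟨l1.add hy.2, fun φ hφ => ?_⟩
  have e1 := (hasWeakDeriv_x_iff.1 h).2.2 φ hφ
  have e2 := (hasWeakDeriv_y_iff.1 hy).2.2 φ hφ
  simp only [Pi.add_apply, add_mul] at e1 ⊢
  rw [integral_add (hφ.integrableOn_mul l2) (hφ.integrableOn_mul l1)] at e1
  rw [integral_add (hφ.integrableOn_mul l1) (hφ.integrableOn_mul hy.2)]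
  have e3 : ∫ p in Ω, θ p * (lam p * dx φ p + lx p * φ p + dy φ p) =
      (∫ p in Ω, (lam * θ) p * dx φ p) + (∫ p in Ω, (lx * θ) p * φ p) +
        ∫ p in Ω, θ p * dy φ p := by
    have i12 : IntegrableOn (fun p => (lam * θ) p * dx φ p + (lx * θ) p * φ p) Ω :=
      (hφ.dx.integrableOn_mul h.1).add (hφ.integrableOn_mul l2)
    rw [← integral_add (hφ.dx.integrableOn_mul h.1) (hφ.integrableOn_mul l2),
      ← integral_add i12 (hφ.dy.integrableOn_mul hy.1)]
    refine integral_congr_ae (Eventually.of_forall fun p => ?_)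
    simp only [Pi.mul_apply]; ring
  rw [e3, e1, e2]
  ring

theorem LipschitzCoefficient.weakTransport_smooth {lam lx ly F : ℝ × ℝ → ℝ}
    (h : LipschitzCoefficient L₁ L₂ lam lx ly) (hF : ContDiff ℝ ∞ F) :
    WeakTransport (rect L₁ L₂) lam lx F (lam * dx F + dy F) :=
  weakTransport_of_hasWeakDeriv (memLp_of_continuous h.continuous 2)
    (h.memLp_x.mono_exponent le_top) (memLp_of_continuous hF.continuous 2)
    (memLp_of_continuous (contDiff_dx hF).continuous 2)
    (h.hasDeriv_x.mul_smooth_x isOpen_rect hF) (hasWeakDeriv_dy hF)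

/-! ### The commutator of the transport operator and the regularization -/

/-- Test the equation for `w` against the kernel and put all derivatives on it: only `θ` remains
under the integral, so that an `L²` bound becomes possible. -/
theorem SmallRadius.commutator_eq {ε : ℝ} (h : SmallRadius L₁ L₂ ε) {lam lx θ w : ℝ × ℝ → ℝ}
    (hl : MemLp lam 2 (volume.restrict (rect L₁ L₂)))
    (hlx : MemLp lx 2 (volume.restrict (rect L₁ L₂)))
    (hθ : MemLp θ 2 (volume.restrict (rect L₁ L₂))) (hw : WeakTransport (rect L₁ L₂) lam lx θ w)
    {p : ℝ × ℝ} (hp : p ∈ rect L₁ L₂) :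
    lam p * dx (mollify L₁ L₂ ε θ) p + dy (mollify L₁ L₂ ε θ) p - mollify L₁ L₂ ε w p =
      ∫ q in rect L₁ L₂, ((shrink L₁ L₂ ε * lam p - lam q) *
        dx (kernel ε) (contraction L₁ L₂ ε p - q) +
        lx q * kernel ε (contraction L₁ L₂ ε p - q) +
        (shrink L₁ L₂ ε - 1) * dy (kernel ε) (contraction L₁ L₂ ε p - q)) * θ q := by
  set s := shrink L₁ L₂ ε
  set a := contraction L₁ L₂ ε p
  have ht : IsTest (rect L₁ L₂) (fun q => kernel ε (a - q)) := h.isTest_kernel hp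
  have ex : ∀ q, dx (fun q => kernel ε (a - q)) q = -dx (kernel ε) (a - q) := fun q =>
    fderiv_comp_sub_left (contDiff_kernel ε) _ _ _
  have ey : ∀ q, dy (fun q => kernel ε (a - q)) q = -dy (kernel ε) (a - q) := fun q =>
    fderiv_comp_sub_left (contDiff_kernel ε) _ _ _
  have e1 := hw.2 _ ht
  have iθ := hθ.integrable_mul (memLp_transport_adjoint hl hlx ht)
  have hloc := locallyIntegrableOn_of_memLp (by norm_num) hθ
  have ix := ht.dx.integrableOn_mul hloc
  have iy := ht.dy.integrableOn_mul hloc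
  simp only [ex, ey, Pi.mul_def] at e1 iθ ix iy
  have ex' : dx (mollify L₁ L₂ ε θ) p = -s * ∫ q in rect L₁ L₂, θ q * -dx (kernel ε) (a - q) := by
    rw [dx, fderiv_mollify h.1 hθ]
    simp only [mul_neg, integral_neg, neg_mul, neg_neg, mul_comm (θ _)]
    rfl
  have ey' : dy (mollify L₁ L₂ ε θ) p = -s * ∫ q in rect L₁ L₂, θ q * -dy (kernel ε) (a - q) := by
    rw [dy, fderiv_mollify h.1 hθ]
    simp only [mul_neg, integral_neg, neg_mul, neg_neg, mul_comm (θ _)]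
    rfl
  have ew : mollify L₁ L₂ ε w p = ∫ q in rect L₁ L₂, w q * kernel ε (a - q) := by
    rw [mollify]
    simp only [mul_comm (w _)]
    rfl
  have ixy : IntegrableOn (fun q => lam p * -s * (θ q * -dx (kernel ε) (a - q)) +
      -s * (θ q * -dy (kernel ε) (a - q))) (rect L₁ L₂) := (ix.const_mul _).add (iy.const_mul _)
  rw [ew, e1, ex', ey', sub_neg_eq_add, ← mul_assoc, ← integral_const_mul, ← integral_const_mul,
    ← integral_add (ix.const_mul _) (iy.const_mul _),
    ← integral_add ixy iθ]
  refine integral_congr_ae (Eventually.of_forall fun q => ?_)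
  simp only
  ring

/-- Where the kernel lives, `p` and `q` are at distance `O(ε)`, so `shrink * lam p - lam q` and
`shrink - 1` are `O(ε)`. Each multiplies a derivative of size `ε⁻³`; all terms are thus `O(ε⁻²)` on
a ball of radius `ε`. -/
theorem LipschitzCoefficient.exists_commutator_bound {lam lx ly : ℝ × ℝ → ℝ}
    (hc : LipschitzCoefficient L₁ L₂ lam lx ly) :
    ∃ M : ℝ≥0, ∀ ε, SmallRadius L₁ L₂ ε → ∀ θ w : ℝ × ℝ → ℝ,
      MemLp θ 2 (volume.restrict (rect L₁ L₂)) → WeakTransport (rect L₁ L₂) lam lx θ w →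
      eLpNorm (fun p => lam p * dx (mollify L₁ L₂ ε θ) p + dy (mollify L₁ L₂ ε θ) p
        - mollify L₁ L₂ ε w p) 2 (volume.restrict (rect L₁ L₂)) ≤
        M * eLpNorm θ 2 (volume.restrict (rect L₁ L₂)) := by
  obtain ⟨M, hM, hk⟩ := exists_kernel_bound
  obtain ⟨Λ, hΛ0, hΛ⟩ := exists_abs_le_on_rect (L₁ := L₁) (L₂ := L₂) hc.continuous
  obtain ⟨K, hK⟩ := hc.lipschitz
  obtain ⟨B, hB⟩ : ∃ B : ℝ≥0, ∀ᵐ p ∂(volume.restrict (rect L₁ L₂)), |lx p| ≤ B := by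
    refine ⟨(eLpNorm lx ⊤ (volume.restrict (rect L₁ L₂))).toNNReal, ?_⟩
    filter_upwards [ae_le_eLpNormEssSup (f := lx) (μ := volume.restrict (rect L₁ L₂))] with p hp
    rw [← eLpNorm_exponent_top, ← ENNReal.coe_toNNReal hc.memLp_x.2.ne] at hp
    have : ‖lx p‖₊ ≤ (eLpNorm lx ⊤ (volume.restrict (rect L₁ L₂))).toNNReal := by
      exact_mod_cast hp
    exact_mod_cast this
  -- Positivity of the sides is part of `SmallRadius`, so the other case is vacuous.
  by_cases hL : 0 < L₁ ∧ 0 < L₂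
  swap
  · exact ⟨0, fun ε h => absurd ⟨h.2.1, h.2.2.1⟩ hL⟩
  obtain ⟨hL₁, hL₂⟩ := hL
  set κ := 2 / L₁ + 2 / L₂ with hκ
  have hκ0 : 0 < κ := by positivity
  -- The first summand is the Lipschitz bound over the distance from `p` to `q`; the second comes
  -- from `shrink ≠ 1` times the bound `Λ` for `lam`.
  set c := K * (1 + κ * (L₁ + L₂)) + κ * Λ with hcdef
  have hc0 : 0 ≤ c := by positivity
  refine ⟨(8 * (c * M + B * M + κ * M)).toNNReal, fun ε h θ w hθ hw => ?_⟩
  have hε := h.1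
  have hs : |shrink L₁ L₂ ε - 1| = κ * ε := by
    rw [shrink, ← hκ, sub_sub_cancel_left, abs_neg, abs_of_nonneg (by positivity)]
  refine eLpNorm_le_of_concentrated h (by positivity) hθ.1
    (fun p hp => h.commutator_eq (memLp_of_continuous hc.continuous 2)
      (hc.memLp_x.mono_exponent le_top) hθ hw hp) (fun p hp => ?_) (fun p hp q hq => ?_)
  · filter_upwards [hB, ae_restrict_mem measurableSet_rect] with q hq hq'
    by_cases hqb : ε < ‖contraction L₁ L₂ ε p - q‖
    · rw [kernel_eq_zero hε hqb, dx, dy, fderiv_kernel_eq_zero hε hqb,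
        fderiv_kernel_eq_zero hε hqb]
      simp only [mul_zero, add_zero, abs_zero]
      positivity
    · obtain ⟨k0, k1, k2⟩ := hk ε hε (contraction L₁ L₂ ε p - q)
      have d : |shrink L₁ L₂ ε * lam p - lam q| ≤ c * ε := by
        have e : shrink L₁ L₂ ε * lam p - lam q =
          (lam p - lam q) + (shrink L₁ L₂ ε - 1) * lam p := by ring
        rw [e]
        refine (abs_add_le _ _).trans ?_
        rw [abs_mul, hs]
        have d1 := h.dist_contraction_le hp
        rw [dist_comm] at d1
        have d2 : dist (contraction L₁ L₂ ε p) q ≤ ε := by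
          rw [dist_eq_norm]; exact not_lt.1 hqb
        have d3 := (dist_triangle p (contraction L₁ L₂ ε p) q).trans (add_le_add d1 d2)
        have d4 := (hK.dist_le_mul p q).trans (mul_le_mul_of_nonneg_left d3 K.2)
        rw [Real.dist_eq] at d4
        have d5 := mul_le_mul_of_nonneg_left (hΛ p hp) (by positivity : 0 ≤ κ * ε)
        refine (add_le_add d4 d5).trans_eq ?_
        rw [hcdef, ← hκ]
        ring
      have t1 : |(shrink L₁ L₂ ε * lam p - lam q) * dx (kernel ε) (contraction L₁ L₂ ε p - q)| ≤
          c * M / ε ^ 2 := by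
        rw [abs_mul]
        refine (mul_le_mul d k1 (abs_nonneg _) (by positivity)).trans_eq ?_
        field_simp
      have t2 : |lx q * kernel ε (contraction L₁ L₂ ε p - q)| ≤ B * M / ε ^ 2 := by
        rw [abs_mul, mul_div_assoc]
        exact mul_le_mul hq k0 (abs_nonneg _) B.2
      have t3 : |(shrink L₁ L₂ ε - 1) * dy (kernel ε) (contraction L₁ L₂ ε p - q)| ≤
          κ * M / ε ^ 2 := by
        rw [abs_mul, hs]
        refine (mul_le_mul_of_nonneg_left k2 (by positivity)).trans_eq ?_
        field_simp
      refine (abs_add_le _ _).trans ((add_le_add ((abs_add_le _ _).trans (add_le_add t1 t2))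
        t3).trans_eq ?_)
      ring
  · rw [mem_closedBall_iff_norm', not_le] at hq
    rw [kernel_eq_zero hε hq, dx, dy, fderiv_kernel_eq_zero hε hq, fderiv_kernel_eq_zero hε hq]
    simp

/-! ### Convergence of the regularizations in the graph norm -/

theorem LipschitzCoefficient.memLp {lam lx ly : ℝ × ℝ → ℝ}
    (hc : LipschitzCoefficient L₁ L₂ lam lx ly) (q : ℝ≥0∞) :
    MemLp lam q (volume.restrict (rect L₁ L₂)) := memLp_of_continuous hc.continuous q

theorem LipschitzCoefficient.memLp_two_x {lam lx ly : ℝ × ℝ → ℝ}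
    (hc : LipschitzCoefficient L₁ L₂ lam lx ly) : MemLp lx 2 (volume.restrict (rect L₁ L₂)) :=
  hc.memLp_x.mono_exponent le_top

theorem LipschitzCoefficient.memLp_two_y {lam lx ly : ℝ × ℝ → ℝ}
    (hc : LipschitzCoefficient L₁ L₂ lam lx ly) : MemLp ly 2 (volume.restrict (rect L₁ L₂)) :=
  hc.memLp_y.mono_exponent le_top

theorem sobolevTendsto_transport_mollify_smooth (hL₁ : 0 < L₁) (hL₂ : 0 < L₂)
    {lam lx ly G : ℝ × ℝ → ℝ} (hc : LipschitzCoefficient L₁ L₂ lam lx ly) (hG : ContDiff ℝ ∞ G) :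
    SobolevTendsto (rect L₁ L₂) 0
      (fun ε => lam * dx (mollify L₁ L₂ ε G) + dy (mollify L₁ L₂ ε G)) (lam * dx G + dy G) := by
  have G2 : MemLp G 2 (volume.restrict (rect L₁ L₂)) := memLp_of_continuous hG.continuous 2
  obtain ⟨Cx, hCx⟩ := SobolevBound.of_memLp
    (memLp_of_continuous (L₁ := L₁) (L₂ := L₂) (contDiff_dx hG).continuous 2)
  obtain ⟨Cy, hCy⟩ := SobolevBound.of_memLp
    (memLp_of_continuous (L₁ := L₁) (L₂ := L₂) (contDiff_dy hG).continuous 2)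
  exact ((sobolevTendsto_dx_mollify hL₁ hL₂ G2 hCx (hasWeakDeriv_dx hG)).mul
    (isMultiplier_zero_of_memLp_top (hc.memLp ⊤))).add
    (sobolevTendsto_dy_mollify hL₁ hL₂ G2 hCy (hasWeakDeriv_dy hG))

/-- Friedrichs' lemma: the commutator with the regularization tends to zero in `L²`. -/
theorem sobolevTendsto_transport_mollify_zero (hL₁ : 0 < L₁) (hL₂ : 0 < L₂)
    {lam lx ly θ w : ℝ × ℝ → ℝ} (hc : LipschitzCoefficient L₁ L₂ lam lx ly)
    (hθ : MemLp θ 2 (volume.restrict (rect L₁ L₂))) (hw2 : MemLp w 2 (volume.restrict (rect L₁ L₂)))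
    (hw : WeakTransport (rect L₁ L₂) lam lx θ w) :
    SobolevTendsto (rect L₁ L₂) 0
      (fun ε => lam * dx (mollify L₁ L₂ ε θ) + dy (mollify L₁ L₂ ε θ)) w := by
  set T : (ℝ × ℝ → ℝ) → ℝ × ℝ → ℝ := fun F => lam * dx F + dy F with hT
  have mT : ∀ {F : ℝ × ℝ → ℝ}, ContDiff ℝ ∞ F → MemLp (T F) 2 (volume.restrict (rect L₁ L₂)) :=
    fun hF => memLp_of_continuous
      ((hc.continuous.mul (contDiff_dx hF).continuous).add (contDiff_dy hF).continuous) 2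
  obtain ⟨M, hM⟩ := hc.exists_commutator_bound
  have hM0 : 0 < M + 1 := by positivity
  have hcomm : SobolevTendsto (rect L₁ L₂) 0
      (fun ε => T (mollify L₁ L₂ ε θ) - mollify L₁ L₂ ε w) 0 := by
    intro η hη
    obtain ⟨C, hC⟩ := SobolevBound.of_memLp hθ
    -- The commutator applied to `θ - G` is at most `η / 2` uniformly in `ε`, and the one applied to
    -- the smooth `G` is small once `ε` is.
    obtain ⟨G, hG, hGθ⟩ := exists_contDiff_sobolevBound_sub hL₁ hL₂ hC
      (div_pos (half_pos hη) hM0)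
    have G2 : MemLp G 2 (volume.restrict (rect L₁ L₂)) := memLp_of_continuous hG.continuous 2
    have hTG := hc.weakTransport_smooth hG
    have tG := (sobolevTendsto_transport_mollify_smooth hL₁ hL₂ hc hG).sub
      (sobolevTendsto_mollify_zero hL₁ hL₂ (mT hG))
    have hdiff := hw.sub (hc.memLp 2) hc.memLp_two_x hTG hθ G2
    filter_upwards [eventually_smallRadius hL₁ hL₂, tG (η / 2) (half_pos hη)] with ε h hε
    have b1 := hM ε h (θ - G) (w - T G) (hθ.sub G2) hdiff
    have e : (fun p => lam p * dx (mollify L₁ L₂ ε (θ - G)) p + dy (mollify L₁ L₂ ε (θ - G)) p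
        - mollify L₁ L₂ ε (w - T G) p) =ᵐ[volume.restrict (rect L₁ L₂)]
        (T (mollify L₁ L₂ ε θ) - mollify L₁ L₂ ε w) -
          (T (mollify L₁ L₂ ε G) - mollify L₁ L₂ ε (T G)) := by
      filter_upwards [ae_restrict_mem measurableSet_rect] with p hp
      have sub_d : ∀ v : ℝ × ℝ, fderiv ℝ (mollify L₁ L₂ ε (θ - G)) p v =
          fderiv ℝ (mollify L₁ L₂ ε θ) p v - fderiv ℝ (mollify L₁ L₂ ε G) p v := by
        intro v
        -- Linearity is available at points of the rectangle; since it is open, this suffices for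
        -- derivatives at `p`.
        have heq : mollify L₁ L₂ ε (θ - G) =ᶠ[𝓝 p] mollify L₁ L₂ ε θ - mollify L₁ L₂ ε G := by
          filter_upwards [isOpen_rect.mem_nhds hp] with q hq using h.mollify_sub hθ G2 hq
        rw [heq.fderiv_eq, fderiv_sub ((contDiff_mollify h.1 hθ).differentiable (by simp) p)
          ((contDiff_mollify h.1 G2).differentiable (by simp) p)]
        rfl
      simp only [hT, dx, dy, sub_d, Pi.add_apply, Pi.sub_apply, Pi.mul_apply]
      rw [h.mollify_sub hw2 (mT hG) hp]
      simp only [hT]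
      ring
    rw [eLpNorm_congr_ae e] at b1
    have hGθ' : eLpNorm (θ - G) 2 (volume.restrict (rect L₁ L₂)) ≤ (η / 2 / (M + 1) : ℝ≥0) := by
      rw [eLpNorm_sub_comm]; exact hGθ.norm_le
    have b2 : SobolevBound (rect L₁ L₂) 0 ((T (mollify L₁ L₂ ε θ) - mollify L₁ L₂ ε w) -
        (T (mollify L₁ L₂ ε G) - mollify L₁ L₂ ε (T G))) (η / 2) := by
      refine ⟨(((mT (contDiff_mollify h.1 hθ)).sub
        (memLp_of_continuous (contDiff_mollify h.1 hw2).continuous 2)).sub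
        ((mT (contDiff_mollify h.1 G2)).sub
        (memLp_of_continuous (contDiff_mollify h.1 (mT hG)).continuous 2))).1, ?_⟩
      refine (b1.trans (mul_le_mul' le_rfl hGθ')).trans ?_
      have : M * (η / 2 / (M + 1)) ≤ η / 2 := by
        rw [← mul_div_assoc, div_le_iff₀ hM0, mul_comm]
        exact mul_le_mul_right le_self_add _
      exact_mod_cast this
    have b3 := b2.add hε
    rw [add_halves] at b3
    refine b3.congr (Eventually.of_forall fun p => ?_)
    simp only [hT, Pi.add_apply, Pi.sub_apply, Pi.mul_apply, Pi.zero_apply]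
    ring
  have := hcomm.add (sobolevTendsto_mollify_zero hL₁ hL₂ hw2)
  simpa using this

/-- Formally this differentiates the equation in `x`. As `θ` may have no second derivatives, they
are avoided through `∫ θ_y φ_x = ∫ θ_x φ_y`, both being `-∫ θ φ_{xy}`. -/
theorem weakTransport_deriv_x {lam lx ly θ θx θy w wx : ℝ × ℝ → ℝ}
    (hc : LipschitzCoefficient L₁ L₂ lam lx ly)
    (hθx : MemLp θx 2 (volume.restrict (rect L₁ L₂)))
    (hx : HasWeakDeriv (rect L₁ L₂) (1, 0) θ θx) (hy : HasWeakDeriv (rect L₁ L₂) (0, 1) θ θy)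
    (hw : w =ᵐ[volume.restrict (rect L₁ L₂)] lam * θx + θy)
    (hwx : HasWeakDeriv (rect L₁ L₂) (1, 0) w wx) :
    WeakTransport (rect L₁ L₂) lam lx θx (wx - lx * θx) := by
  have l1 := locallyIntegrableOn_mul (hc.memLp 2) hθx
  have l2 := locallyIntegrableOn_mul hc.memLp_two_x hθx
  refine ⟨hwx.2.sub l2, fun φ hφ => ?_⟩
  have e1 := (hasWeakDeriv_x_iff.1 (hwx.congr hw .rfl)).2.2 φ hφ
  have e2 := (hasWeakDeriv_x_iff.1 hx).2.2 _ hφ.dy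
  have e3 := (hasWeakDeriv_y_iff.1 hy).2.2 _ hφ.dx
  rw [dy_dx_comm hφ.smooth, e2, neg_inj] at e3
  simp only [Pi.add_apply, Pi.sub_apply, add_mul, sub_mul] at e1 ⊢
  rw [integral_add (hφ.dx.integrableOn_mul l1) (hφ.dx.integrableOn_mul hy.2), ← e3] at e1
  rw [integral_sub (hφ.integrableOn_mul hwx.2) (hφ.integrableOn_mul l2)]
  have i12 : IntegrableOn (fun p => (lam * θx) p * dx φ p + (lx * θx) p * φ p) (rect L₁ L₂) :=
    (hφ.dx.integrableOn_mul l1).add (hφ.integrableOn_mul l2)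
  have e4 : ∫ p in rect L₁ L₂, θx p * (lam p * dx φ p + lx p * φ p + dy φ p) =
      (∫ p in rect L₁ L₂, (lam * θx) p * dx φ p) + (∫ p in rect L₁ L₂, (lx * θx) p * φ p) +
        ∫ p in rect L₁ L₂, θx p * dy φ p := by
    rw [← integral_add (hφ.dx.integrableOn_mul l1) (hφ.integrableOn_mul l2),
      ← integral_add i12 (hφ.dy.integrableOn_mul hx.2)]
    refine integral_congr_ae (Eventually.of_forall fun p => ?_)
    simp only [Pi.mul_apply]; ring
  rw [e4]
  linarith

/-- The same in `y`, where the coefficient interferes: the required exchange is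
`integral_cross_deriv` with `v = lam`. -/
theorem weakTransport_deriv_y (hL₁ : 0 < L₁) (hL₂ : 0 < L₂) {lam lx ly θ θx θy w wy : ℝ × ℝ → ℝ}
    (hc : LipschitzCoefficient L₁ L₂ lam lx ly)
    (hθx : MemLp θx 2 (volume.restrict (rect L₁ L₂)))
    (hθy : MemLp θy 2 (volume.restrict (rect L₁ L₂)))
    (hx : HasWeakDeriv (rect L₁ L₂) (1, 0) θ θx) (hy : HasWeakDeriv (rect L₁ L₂) (0, 1) θ θy)
    (hw : w =ᵐ[volume.restrict (rect L₁ L₂)] lam * θx + θy)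
    (hwy : HasWeakDeriv (rect L₁ L₂) (0, 1) w wy) :
    WeakTransport (rect L₁ L₂) lam lx θy (wy - ly * θx) := by
  have l1 := locallyIntegrableOn_mul (hc.memLp 2) hθx
  have l2 := locallyIntegrableOn_mul hc.memLp_two_y hθx
  have l3 := locallyIntegrableOn_mul (hc.memLp 2) hθy
  have l4 := locallyIntegrableOn_mul hc.memLp_two_x hθy
  refine ⟨hwy.2.sub l2, fun φ hφ => ?_⟩
  have e1 := (hasWeakDeriv_y_iff.1 (hwy.congr hw .rfl)).2.2 φ hφ
  have e2 := integral_cross_deriv hL₁ hL₂ hx hy hc.hasDeriv_x hc.hasDeriv_y hθx hθy (hc.memLp 2)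
    hc.memLp_two_x hc.memLp_two_y hφ
  have r : ∀ f g h : ℝ × ℝ → ℝ, ∫ p in rect L₁ L₂, f p * g p * h p =
      ∫ p in rect L₁ L₂, (h * f) p * g p := fun f g h =>
    integral_congr_ae (Eventually.of_forall fun p => by simp only [Pi.mul_apply]; ring)
  rw [r, r, r, r] at e2
  simp only [Pi.add_apply, Pi.sub_apply, add_mul, sub_mul] at e1 ⊢
  rw [integral_add (hφ.dy.integrableOn_mul l1) (hφ.dy.integrableOn_mul hy.2)] at e1
  rw [integral_sub (hφ.integrableOn_mul hwy.2) (hφ.integrableOn_mul l2)]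
  have i12 : IntegrableOn (fun p => (lam * θy) p * dx φ p + (lx * θy) p * φ p) (rect L₁ L₂) :=
    (hφ.dx.integrableOn_mul l3).add (hφ.integrableOn_mul l4)
  have e4 : ∫ p in rect L₁ L₂, θy p * (lam p * dx φ p + lx p * φ p + dy φ p) =
      (∫ p in rect L₁ L₂, (lam * θy) p * dx φ p) + (∫ p in rect L₁ L₂, (lx * θy) p * φ p) +
        ∫ p in rect L₁ L₂, θy p * dy φ p := by
    rw [← integral_add (hφ.dx.integrableOn_mul l3) (hφ.integrableOn_mul l4),
      ← integral_add i12 (hφ.dy.integrableOn_mul hy.2)]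
    refine integral_congr_ae (Eventually.of_forall fun p => ?_)
    simp only [Pi.mul_apply]; ring
  rw [e4]
  linarith

theorem SmallRadius.fderiv_dx_mollify {ε : ℝ} (h : SmallRadius L₁ L₂ ε) {u ux : ℝ × ℝ → ℝ}
    (hu : MemLp u 2 (volume.restrict (rect L₁ L₂))) (hx : HasWeakDeriv (rect L₁ L₂) (1, 0) u ux)
    (hux : MemLp ux 2 (volume.restrict (rect L₁ L₂))) {p : ℝ × ℝ} (hp : p ∈ rect L₁ L₂)
    (v : ℝ × ℝ) : fderiv ℝ (dx (mollify L₁ L₂ ε u)) p v =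
      shrink L₁ L₂ ε * fderiv ℝ (mollify L₁ L₂ ε ux) p v := by
  have heq : dx (mollify L₁ L₂ ε u) =ᶠ[𝓝 p] fun q => shrink L₁ L₂ ε * mollify L₁ L₂ ε ux q := by
    filter_upwards [isOpen_rect.mem_nhds hp] with q hq using h.dx_mollify hu hx hq
  rw [heq.fderiv_eq, fderiv_const_mul ((contDiff_mollify h.1 hux).differentiable (by simp) p)]
  rfl

theorem SmallRadius.fderiv_dy_mollify {ε : ℝ} (h : SmallRadius L₁ L₂ ε) {u uy : ℝ × ℝ → ℝ}
    (hu : MemLp u 2 (volume.restrict (rect L₁ L₂))) (hy : HasWeakDeriv (rect L₁ L₂) (0, 1) u uy)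
    (huy : MemLp uy 2 (volume.restrict (rect L₁ L₂))) {p : ℝ × ℝ} (hp : p ∈ rect L₁ L₂)
    (v : ℝ × ℝ) : fderiv ℝ (dy (mollify L₁ L₂ ε u)) p v =
      shrink L₁ L₂ ε * fderiv ℝ (mollify L₁ L₂ ε uy) p v := by
  have heq : dy (mollify L₁ L₂ ε u) =ᶠ[𝓝 p] fun q => shrink L₁ L₂ ε * mollify L₁ L₂ ε uy q := by
    filter_upwards [isOpen_rect.mem_nhds hp] with q hq using h.dy_mollify hu hy hq
  rw [heq.fderiv_eq, fderiv_const_mul ((contDiff_mollify h.1 huy).differentiable (by simp) p)]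
  rfl

/-- Induction on `m`: `θ_x` and `θ_y` solve transport equations with right-hand sides in the space
of one order less, thanks to the multiplier property, so the induction hypothesis applies to them.
-/
theorem sobolevTendsto_transport_mollify (hL₁ : 0 < L₁) (hL₂ : 0 < L₂) {lam lx ly : ℝ × ℝ → ℝ}
    (hc : LipschitzCoefficient L₁ L₂ lam lx ly) {m : ℕ}
    (hmul : ∀ k < m, IsMultiplier (rect L₁ L₂) k lx ∧ IsMultiplier (rect L₁ L₂) k ly)
    {θ w : ℝ × ℝ → ℝ} {C D : ℝ≥0} (hθ : SobolevBound (rect L₁ L₂) m θ C)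
    (hwD : SobolevBound (rect L₁ L₂) m w D) (hw : WeakTransport (rect L₁ L₂) lam lx θ w) :
    SobolevTendsto (rect L₁ L₂) m
      (fun ε => lam * dx (mollify L₁ L₂ ε θ) + dy (mollify L₁ L₂ ε θ)) w := by
  induction m generalizing θ w C D with
  | zero => exact sobolevTendsto_transport_mollify_zero hL₁ hL₂ hc hθ.memLp hwD.memLp hw
  | succ m ih =>
    have θ2 := hθ.memLp
    have t0 := sobolevTendsto_transport_mollify_zero hL₁ hL₂ hc θ2 hwD.memLp hw
    obtain ⟨-, θx, θy, hx, hy, bx, b_y⟩ := hθ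
    obtain ⟨-, wx, wy, hwx, hwy, bwx, bwy⟩ := hwD
    have ih' := fun {θ w C D} => ih (θ := θ) (w := w) (C := C) (D := D)
      fun k hk => hmul k (hk.trans (Nat.lt_succ_self m))
    obtain ⟨mx, my⟩ := hmul m (Nat.lt_succ_self m)
    have hwae : w =ᵐ[volume.restrict (rect L₁ L₂)] lam * θx + θy :=
      hw.unique isOpen_rect (weakTransport_of_hasWeakDeriv (hc.memLp 2) hc.memLp_two_x θ2 bx.memLp
        (hc.hasDeriv_x.mul_x hL₁ hL₂ hx (hc.memLp 2) hc.memLp_two_x θ2 bx.memLp) hy)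
    have tθx := sobolevTendsto_dx_mollify hL₁ hL₂ θ2 bx hx
    obtain ⟨Dx, hDx⟩ : ∃ E, SobolevBound (rect L₁ L₂) m (wx - lx * θx) E := by
      obtain ⟨K, hK⟩ := mx
      exact ⟨_, bwx.sub (hK _ _ bx)⟩
    obtain ⟨Dy, hDy⟩ : ∃ E, SobolevBound (rect L₁ L₂) m (wy - ly * θx) E := by
      obtain ⟨K, hK⟩ := my
      exact ⟨_, bwy.sub (hK _ _ bx)⟩
    -- The limit is `lam_x θ_x + (w_x - lam_x θ_x) = w_x`.
    have tx := (tθx.mul mx).add ((ih' bx hDx (weakTransport_deriv_x hc bx.memLp hx hy hwae hwx)).const_mul hDx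
      (tendsto_shrink (L₁ := L₁) (L₂ := L₂)))
    have ty := (tθx.mul my).add ((ih' b_y hDy (weakTransport_deriv_y hL₁ hL₂ hc bx.memLp b_y.memLp hx hy hwae
      hwy)).const_mul hDy (tendsto_shrink (L₁ := L₁) (L₂ := L₂)))
    simp only [one_mul] at tx ty
    -- `Fx` and `Fy` come from the product rule. On the rectangle one derivative passes through the
    -- regularization, which turns them into the expressions in `tx` and `ty`.
    refine t0.succ
      (Fx := fun ε => lx * dx (mollify L₁ L₂ ε θ) + lam * dx (dx (mollify L₁ L₂ ε θ)) +
        dx (dy (mollify L₁ L₂ ε θ)))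
      (Fy := fun ε => ly * dx (mollify L₁ L₂ ε θ) + lam * dy (dx (mollify L₁ L₂ ε θ)) +
        dy (dy (mollify L₁ L₂ ε θ))) ?_ ?_ hwx hwy (tx.congr ?_ ?_) (ty.congr ?_ ?_)
    · filter_upwards [self_mem_nhdsWithin] with ε hε
      have hs := contDiff_mollify hε θ2
      exact (hc.hasDeriv_x.mul_smooth_x isOpen_rect (contDiff_dx hs)).add
        (hasWeakDeriv_dx (contDiff_dy hs))
    · filter_upwards [self_mem_nhdsWithin] with ε hε
      have hs := contDiff_mollify hε θ2
      exact (hc.hasDeriv_y.mul_smooth_y isOpen_rect (contDiff_dx hs)).add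
        (hasWeakDeriv_dy (contDiff_dy hs))
    · filter_upwards [eventually_smallRadius hL₁ hL₂] with ε h
      filter_upwards [ae_restrict_mem measurableSet_rect] with p hp
      have e1 : dx (dx (mollify L₁ L₂ ε θ)) p = shrink L₁ L₂ ε * dx (mollify L₁ L₂ ε θx) p :=
        h.fderiv_dx_mollify θ2 hx bx.memLp hp _
      have e2 : dx (dy (mollify L₁ L₂ ε θ)) p = shrink L₁ L₂ ε * dy (mollify L₁ L₂ ε θx) p := by
        rw [← dy_dx_comm (contDiff_mollify h.1 θ2)]
        exact h.fderiv_dx_mollify θ2 hx bx.memLp hp _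
      simp only [Pi.add_apply, Pi.mul_apply, e1, e2]
      ring
    · exact Eventually.of_forall fun p => add_sub_cancel _ _
    · filter_upwards [eventually_smallRadius hL₁ hL₂] with ε h
      filter_upwards [ae_restrict_mem measurableSet_rect] with p hp
      have e1 : dy (dx (mollify L₁ L₂ ε θ)) p = shrink L₁ L₂ ε * dx (mollify L₁ L₂ ε θy) p := by
        rw [dy_dx_comm (contDiff_mollify h.1 θ2)]
        exact h.fderiv_dy_mollify θ2 hy b_y.memLp hp _
      have e2 : dy (dy (mollify L₁ L₂ ε θ)) p = shrink L₁ L₂ ε * dy (mollify L₁ L₂ ε θy) p :=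
        h.fderiv_dy_mollify θ2 hy b_y.memLp hp _
      simp only [Pi.add_apply, Pi.mul_apply, e1, e2]
      ring
    · exact Eventually.of_forall fun p => add_sub_cancel _ _

/-! ### The density theorem -/

theorem memLp_top_of_sobolevBound_two (hL₁ : 0 < L₁) (hL₂ : 0 < L₂) {u : ℝ × ℝ → ℝ} {C : ℝ≥0}
    (h : SobolevBound (rect L₁ L₂) 2 u C) : MemLp u ⊤ (volume.restrict (rect L₁ L₂)) := by
  obtain ⟨K, hK⟩ := exists_ae_bound_of_sobolevBound_two hL₁ hL₂
  exact (hK u C h).1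

/-- For `m ≥ 2` the gradient is in `H^{max(2, m-1)}`, hence bounded and a multiplier of `H^k` for `k
< m`. For `m ≤ 1` only `k = 0` can occur, and boundedness suffices. In both cases a bounded gradient
gives a Lipschitz representative. -/
theorem PositiveCondition.exists_lipschitzCoefficient (hL₁ : 0 < L₁) (hL₂ : 0 < L₂) {m : ℕ}
    {lam : ℝ × ℝ → ℝ} (h : PositiveCondition (rect L₁ L₂) m lam) :
    ∃ g lx ly : ℝ × ℝ → ℝ, lam =ᵐ[volume.restrict (rect L₁ L₂)] g ∧
      LipschitzCoefficient L₁ L₂ g lx ly ∧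
      ∀ k < m, IsMultiplier (rect L₁ L₂) k lx ∧ IsMultiplier (rect L₁ L₂) k ly := by
  obtain ⟨lx, ly, hx, hy, bx, b_y, hl, hmul⟩ : ∃ lx ly : ℝ × ℝ → ℝ,
      HasWeakDeriv (rect L₁ L₂) (1, 0) lam lx ∧ HasWeakDeriv (rect L₁ L₂) (0, 1) lam ly ∧
      MemLp lx ⊤ (volume.restrict (rect L₁ L₂)) ∧ MemLp ly ⊤ (volume.restrict (rect L₁ L₂)) ∧
      MemLp lam 2 (volume.restrict (rect L₁ L₂)) ∧
      ∀ k < m, IsMultiplier (rect L₁ L₂) k lx ∧ IsMultiplier (rect L₁ L₂) k ly := by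
    rcases Nat.lt_or_ge 1 m with hm | hm
    · obtain ⟨C, hC⟩ := exists_sobolevBound_of_mem_H isOpen_rect (h.mem_H hm)
      have e : max 3 m = max 2 (m - 1) + 1 := by omega
      have l2 := hC.memLp
      rw [e] at hC
      obtain ⟨-, lx, ly, hx, hy, bx, b_y⟩ := hC
      exact ⟨lx, ly, hx, hy, memLp_top_of_sobolevBound_two hL₁ hL₂ (bx.of_le (le_max_left _ _)),
        memLp_top_of_sobolevBound_two hL₁ hL₂ (b_y.of_le (le_max_left _ _)), l2, fun k hk =>
        ⟨SobolevBound.isMultiplier hL₁ hL₂ (bx.of_le (by omega)),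
          SobolevBound.isMultiplier hL₁ hL₂ (b_y.of_le (by omega))⟩⟩
    · obtain ⟨lx, ly, hx, hy, bx, b_y⟩ := h.grad_bounded hm
      obtain ⟨c₀, c₁, hc₀, -, hb⟩ := h.bounds
      have hl_meas : AEStronglyMeasurable lam (volume.restrict (rect L₁ L₂)) :=
        hx.1.aestronglyMeasurable
      refine ⟨lx, ly, hx, hy, bx, b_y, MemLp.of_bound hl_meas c₁ ?_, fun k hk => ?_⟩
      · filter_upwards [hb] with p hp
        rw [Real.norm_of_nonneg (hc₀.le.trans hp.1)]
        exact hp.2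
      · obtain rfl : k = 0 := by omega
        exact ⟨isMultiplier_zero_of_memLp_top bx, isMultiplier_zero_of_memLp_top b_y⟩
  obtain ⟨K, g, hg, hlg⟩ := exists_lipschitz_representative hL₁ hL₂ hl hx hy bx b_y
  exact ⟨g, lx, ly, hlg, ⟨⟨K, hg⟩, hx.congr hlg .rfl, hy.congr hlg .rfl, bx, b_y⟩, hmul⟩

theorem exists_pos_rpow_lt (N : ℕ) {ε : ℝ≥0∞} (hε : 0 < ε) :
    ∃ η : ℝ≥0, 0 < η ∧ (2 * (N : ℝ≥0∞) * (η : ℝ≥0∞) ^ 2) ^ (1 / 2 : ℝ) < ε := by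
  have hc : Continuous fun η : ℝ≥0 => ((2 * (N : ℝ≥0) * η ^ 2 : ℝ≥0) : ℝ≥0∞) ^ (1 / 2 : ℝ) :=
    ENNReal.continuous_rpow_const.comp (ENNReal.continuous_coe.comp (by fun_prop))
  have ht := hc.tendsto 0
  norm_num at ht
  obtain ⟨η, h1, h2⟩ := (((ht.mono_left nhdsWithin_le_nhds : Tendsto _ (𝓝[>] (0 : ℝ≥0)) _).eventually_lt_const
    hε).and self_mem_nhdsWithin).exists
  refine ⟨η, h2, ?_⟩
  norm_num
  exact h1

theorem exists_smooth_X₁Norm_sub_lt (hL₁ : 0 < L₁) (hL₂ : 0 < L₂) {m : ℕ} {lam : ℝ × ℝ → ℝ}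
    (hlam : PositiveCondition (rect L₁ L₂) m lam) :
    ∀ θ ∈ X₁ (rect L₁ L₂) m lam, ∀ ε : ℝ≥0∞, 0 < ε →
      ∃ f ∈ SmoothUpToBoundary (rect L₁ L₂) ∩ X₁ (rect L₁ L₂) m lam,
        X₁Norm (rect L₁ L₂) m lam (θ - f) < ε := by
  rintro θ ⟨hθ, w, ⟨hw_loc, lx', hlx', hw⟩, hwH⟩ ε hε
  obtain ⟨g, lx, ly, hlg, hc, hmul⟩ := hlam.exists_lipschitzCoefficient hL₁ hL₂
  have hlx : HasWeakDeriv (rect L₁ L₂) (1, 0) lam lx := hc.hasDeriv_x.congr hlg.symm .rfl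
  -- The weak derivative of `lam` hidden in `IsT` agrees almost everywhere with `lx`, so the
  -- equation can be rewritten with the Lipschitz representative.
  have hT : WeakTransport (rect L₁ L₂) g lx θ w :=
    WeakTransport.congr ⟨hw_loc, hw⟩ hlg (hlx'.unique isOpen_rect hlx)
  have isT : ∀ {u v : ℝ × ℝ → ℝ}, WeakTransport (rect L₁ L₂) g lx u v →
      IsT (rect L₁ L₂) lam u v := fun h =>
    ⟨h.1, lx, hlx, (h.congr hlg.symm .rfl).2⟩
  obtain ⟨C, hC⟩ := exists_sobolevBound_of_mem_H isOpen_rect hθ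
  obtain ⟨D, hD⟩ := exists_sobolevBound_of_mem_H isOpen_rect hwH
  obtain ⟨η, hη, hηε⟩ := exists_pos_rpow_lt (multiIdx m).card hε
  obtain ⟨δ, h, b1, b2⟩ := ((eventually_smallRadius hL₁ hL₂).and
    ((sobolevTendsto_mollify hL₁ hL₂ hC η hη).and
      (sobolevTendsto_transport_mollify hL₁ hL₂ hc hmul hC hD hT η hη))).exists
  have hs := contDiff_mollify h.1 hC.memLp
  set f := mollify L₁ L₂ δ θ
  have hTf := hc.weakTransport_smooth hs
  have f1 := b1.add hC
  have f2 := b2.add hD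
  rw [sub_add_cancel] at f1 f2
  refine ⟨f, ⟨⟨f, hs, fun _ _ => rfl⟩, f1.mem_H, _, isT hTf, f2.mem_H⟩, ?_⟩
  have c1 : SobolevBound (rect L₁ L₂) m (θ - f) η := b1.sub_comm
  have c2 : SobolevBound (rect L₁ L₂) m (w - (g * dx f + dy f)) η := b2.sub_comm
  have hdiff := hT.sub (hc.memLp 2) hc.memLp_two_x hTf hC.memLp f1.memLp
  exact (X₁Norm_le c1 (isT hdiff) c2).trans_lt hηε

end TransportSpace

end

theorem mainTheorem8 (L₁ L₂ : ℝ) (hL₁ : 0 < L₁) (hL₂ : 0 < L₂) (m : ℕ) (lam : ℝ × ℝ → ℝ)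
    (hlam : TransportSpace.PositiveCondition (TransportSpace.rect L₁ L₂) m lam) :
    ∀ θ ∈ TransportSpace.X₁ (TransportSpace.rect L₁ L₂) m lam, ∀ ε : ℝ≥0∞, 0 < ε →
      ∃ f ∈ TransportSpace.SmoothUpToBoundary (TransportSpace.rect L₁ L₂) ∩
          TransportSpace.X₁ (TransportSpace.rect L₁ L₂) m lam,
        TransportSpace.X₁Norm (TransportSpace.rect L₁ L₂) m lam (θ - f) < ε :=
  TransportSpace.exists_smooth_X₁Norm_sub_lt hL₁ hL₂ hlam
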